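/- **Setting.** Let $d$ be fixed, $\beta_*\in\mathbb R^d$, $\sigma>0$, and $Y_i=X_i^{\mathsf T}\beta_*+\sigma\epsilon_i$, $i=1,2,\dots$, where the $\epsilon_i$ are i.i.d. with mean zero and unit variance. The $X_i\in\mathbb R^d$ are either i.i.d. random vectors independent of the $\epsilon_i$ with $\Sigma=\mathbb E[X_1X_1^{\mathsf T}]$ positive definite (random design), or fixed vectors (fixed design). For $\ell\le u$ the one-bit quantizer with range $[\ell,u]$ maps $z$ to $q(z+\xi)$, where $q(t)$ is the point of $\{\ell,u\}$ nearest to $t$ and the dither $\xi$ is uniform on $(-\frac{u-\ell}2,\frac{u-\ell}2)$; thus, if $\ell<u$ and $z\in[\ell,u]$, its value is $u$ with probability $\frac{z-\ell}{u-\ell}$ and $\ell$ otherwise. Given ranges $R,L$, let $\widetilde X_{ij}$, $\widetilde{X_{ij}^2}$ and $\widetilde Y_i$ be the quantized versions of $X_{ij}$, $X_{ij}^2$ and $Y_i$ with ranges $[-R,R]$, $[0,R^2]$ and $[-L,L]$, all dithers being independent of each other and of the data. Put $\Delta_i=\mathrm{diag}(\widetilde{X_{i1}^2}-R^2,\dots,\widetilde{X_{id}^2}-R^2)$,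 $$\widehat\Sigma=\frac1n\sum_{i=1}^n(\widetilde X_i\widetilde X_i^{\mathsf T}+\Delta_i),\qquad \widehat\Sigma_{Xy}=\frac1n\sum_{i=1}^n\widetilde X_i\widetilde Y_i,\qquad \widehat\beta=\operatorname*{argmin}_{\beta\in\mathbb R^d}\Big\{\tfrac12\beta^{\mathsf T}\widehat\Sigma\beta-\beta^{\mathsf T}\widehat\Sigma_{Xy}\Big\},$$ where $\widehat\beta$ is any random vector that equals the minimizer whenever there is a unique one. Further put $$\Gamma(R,L)=L^2\{\Sigma-\mathrm{diag}(\Sigma)+R^2I_d\}+\Gamma_a-\Gamma_b,\qquad \Gamma_a=\mathbb E[(\widetilde X_1\widetilde X_1^{\mathsf T}+\Delta_1)\beta_*\beta_*^{\mathsf T}(\widetilde X_1\widetilde X_1^{\mathsf T}+\Delta_1)],$$ $$\Gamma_b=\mathbb E[(\widetilde X_1\widetilde X_1^{\mathsf T}+\Delta_1)\beta_*\widetilde X_1^{\mathsf T}\widetilde Y_1]+\mathbb E[\widetilde X_1\widetilde Y_1\beta_*^{\mathsf T}(\widetilde X_1\widetilde X_1^{\mathsf T}+\Delta_1)].$$ **(I)**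 Random design, fixed ranges: if $|X_{1j}|\le R$ for all $j$ and $|Y_1|\le L$ almost surely, then, with $\Gamma=\Gamma(R,L)$, $$\sqrt n(\widehat\beta-\beta_*)\xrightarrow{D}N_d(0,\Sigma^{-1}\Gamma\Sigma^{-1})\quad(n\to\infty),$$ and every entry of $\Gamma_a-\Gamma_b$ is at most $3R^4\|\beta_*\|_1^2$ in absolute value. **(II)** Random sub-Gaussian design, growing ranges: for a random variable $Z$ let $\|Z\|_{\psi_2}=\inf\{t>0:\mathbb E\exp(Z^2/t^2)\le2\}$, and for a random vector let $\|Z\|_{\psi_2}=\sup_{\|v\|_2=1}\|\langle Z,v\rangle\|_{\psi_2}$. Suppose that the coordinates of $X_1$ have mean zero and variance one and that $\|X_1\|_{\psi_2}$ and $\|\epsilon_1\|_{\psi_2}$ are finite. Let $K=\max_j\|X_{1j}\|_{\psi_2}$, $\overline K=\|\Sigma^{-1/2}X_1\|_{\psi_2}$, $K_\epsilon=\|\epsilon_1\|_{\psi_2}$, let $C\ge\frac12$ be a constant, and write $C_k=Ck^2$. (The condition $C\ge\frac12$ says exactly that $\mathbb P(|Z|\ge t)\le2\exp(-t^2/(2C\|Z\|_{\psi_2}^2))$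 for all $t>0$ and all sub-Gaussian $Z$ with mean zero and unit variance.) For each $n$ quantize the first $n$ observations with ranges $$R_n=\sqrt{6C_K\log(nd)},\qquad L_n=\Big(\sqrt{6C_{\overline K}}\,\|\Sigma^{1/2}\beta_*\|_2+\sigma\sqrt{6C_{K_\epsilon}}\Big)\sqrt{\log n}.$$ Let $(\tau_n)$ be a sequence with $\tau_n\asymp\log n$. If $\tau_n/\log n$ converges, then $\tau_n^{-2}\,\Gamma(R_n,L_n)$ converges. Whenever the limit $\Gamma=\lim_{n\to\infty}\tau_n^{-2}\,\Gamma(R_n,L_n)$ exists, it is a symmetric positive definite matrix and $$\tau_n^{-1}\sqrt n(\widehat\beta-\beta_*)\xrightarrow{D}N_d(0,\Sigma^{-1}\Gamma\Sigma^{-1})\quad(n\to\infty).$$ **(III)** Fixed design, fixed ranges: if $|X_{ij}|\le R$ for all $i,j$, $|Y_i|\le L$ almost surely for all $i$, and $\lim_{n\to\infty}\frac1n\sum_{i=1}^nX_iX_i^{\mathsf T}=\overline\Sigma$ for a symmetric positive definite matrix $\overline\Sigma$, then $\mathbb V_n=n^{-2}\sum_{i=1}^n\mathrm{Cov}(\widetilde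 X_i\widetilde Y_i-(\widetilde X_i\widetilde X_i^{\mathsf T}+\Delta_i)\beta_*)$ is positive definite for all large $n$, $\mathbb V_n=O(n^{-1})$, and $$\mathbb V_n^{-1/2}\,\overline\Sigma(\widehat\beta-\beta_*)\xrightarrow{D}N_d(0,I_d)\quad(n\to\infty).$$ -/

import Mathlib

open MeasureTheory ProbabilityTheory Filter Topology Matrix
open scoped ENNReal MatrixOrder

noncomputable section

namespace QuantReg

/-- Column vectors with `d` real entries and the Euclidean norm. -/
abbrev Vec (d : ℕ) : Type := EuclideanSpace ℝ (Fin d)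

/-- The product of a matrix and a vector, as an element of Euclidean space. -/
def matVec {d : ℕ} (A : Matrix (Fin d) (Fin d) ℝ) (v : Vec d) : Vec d :=
  WithLp.toLp 2 (A *ᵥ v.ofLp)

/-- `A ^ (-1/2)`: the inverse of the positive semidefinite square root of `A`. -/
def invSqrt {d : ℕ} (A : Matrix (Fin d) (Fin d) ℝ) : Matrix (Fin d) (Fin d) ℝ :=
  (CFC.sqrt A)⁻¹

/-! ### Sub-Gaussian norms -/

/-- The sub-Gaussian norm `inf {t > 0 : E exp (|Z|² / t²) ≤ 2}` of a random variable, with value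
`∞` if no such `t` exists. -/
def psiTwo {Ω : Type*} [MeasurableSpace Ω] (P : Measure Ω) (Z : Ω → ℝ) : ℝ≥0∞ :=
  sInf {s : ℝ≥0∞ | ∃ t : ℝ, 0 < t ∧ s = ENNReal.ofReal t ∧
    ∫⁻ ω, ENNReal.ofReal (Real.exp (|Z ω| ^ 2 / t ^ 2)) ∂P ≤ 2}

/-- The sub-Gaussian norm of a random vector: the supremum over all unit vectors `v` of the
sub-Gaussian norm of `⟨Z, v⟩`. -/
def psiTwoVec {d : ℕ} {Ω : Type*} [MeasurableSpace Ω] (P : Measure Ω) (Z : Ω → Vec d) : ℝ≥0∞ :=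
  ⨆ v : {v : Vec d // ‖v‖ = 1}, psiTwo P (fun ω => inner ℝ (Z ω) v.1)

/-! ### One-bit quantization with dithering -/

/-- The point of `{l, u}` that is nearest to `t`. -/
def nearest (l u t : ℝ) : ℝ :=
  if |t - l| < |t - u| then l else u

/-- The dithered one-bit quantizer `z ↦ nearest l u (z + ξ)` with dither `ξ = (u - l) r`.  If `r` is
uniform on `(-1/2, 1/2)`, then `ξ` is uniform on `(-(u - l)/2, (u - l)/2)`, and for `z` in `[l, u]`
the output is `u` with probability `(z - l)/(u - l)` and `l` otherwise. -/
def dithered (l u z r : ℝ) : ℝ :=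
  nearest l u (z + (u - l) * r)

/-- Labels of the quantizers that act on one observation: one for each coordinate of the predictor,
one for each squared coordinate of the predictor, one for the response. -/
abbrev Bit (d : ℕ) : Type := Fin d ⊕ Fin d ⊕ Unit

/-- Everything that enters the estimator: predictors, responses, normalized dithers and the
quantizer ranges `[-R, R]` and `[-L, L]`.  No law is imposed here. -/
structure Scheme (d : ℕ) (Ω : Type*) where
  /-- the predictors -/
  X : ℕ → Ω → Vec d
  /-- the responses -/
  Y : ℕ → Ω → ℝ
  /-- the normalized dithers -/
  U : ℕ → Bit d → Ω → ℝ
  /-- the range of the quantizer for the predictors -/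
  R : ℝ
  /-- the range of the quantizer for the responses -/
  L : ℝ

namespace Scheme

variable {d : ℕ} {Ω : Type*}

/-- The quantized predictor of observation `i`, with entries in `{-R, R}`. -/
def Xq (S : Scheme d Ω) (i : ℕ) (ω : Ω) : Fin d → ℝ :=
  fun j => dithered (-S.R) S.R (S.X i ω j) (S.U i (Sum.inl j) ω)

/-- The quantized squares of the predictor of observation `i`, with entries in `{0, R²}`. -/
def Xsqq (S : Scheme d Ω) (i : ℕ) (ω : Ω) : Fin d → ℝ :=
  fun j => dithered 0 (S.R ^ 2) (S.X i ω j ^ 2) (S.U i (Sum.inr (Sum.inl j)) ω)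

/-- The quantized response of observation `i`, with values in `{-L, L}`. -/
def Yq (S : Scheme d Ω) (i : ℕ) (ω : Ω) : ℝ :=
  dithered (-S.L) S.L (S.Y i ω) (S.U i (Sum.inr (Sum.inr ())) ω)

/-- `Δ_i`, the diagonal correction. -/
def Delta (S : Scheme d Ω) (i : ℕ) (ω : Ω) : Matrix (Fin d) (Fin d) ℝ :=
  Matrix.diagonal (fun j => S.Xsqq i ω j - S.R ^ 2)

/-- `X̃_i X̃_iᵀ + Δ_i`. -/
def Gram (S : Scheme d Ω) (i : ℕ) (ω : Ω) : Matrix (Fin d) (Fin d) ℝ :=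
  Matrix.vecMulVec (S.Xq i ω) (S.Xq i ω) + S.Delta i ω

/-- The plug-in estimator of the covariance matrix from the first `n` observations. -/
def SigmaHat (S : Scheme d Ω) (n : ℕ) (ω : Ω) : Matrix (Fin d) (Fin d) ℝ :=
  (n : ℝ)⁻¹ • ∑ i ∈ Finset.range n, S.Gram i ω

/-- The plug-in estimator of the cross-covariance from the first `n` observations. -/
def SigmaXyHat (S : Scheme d Ω) (n : ℕ) (ω : Ω) : Fin d → ℝ :=
  (n : ℝ)⁻¹ • ∑ i ∈ Finset.range n, S.Yq i ω • S.Xq i ω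

/-- The quadratic objective function based on the first `n` observations. -/
def objective (S : Scheme d Ω) (n : ℕ) (ω : Ω) (b : Vec d) : ℝ :=
  1 / 2 * (b.ofLp ⬝ᵥ (S.SigmaHat n ω *ᵥ b.ofLp)) - b.ofLp ⬝ᵥ S.SigmaXyHat n ω

/-- `bhat` is (a version of) the estimator based on the first `n` observations: a random vector that
is the minimizer of the objective function whenever there is a unique minimizer.  Its value is
arbitrary otherwise. -/
def IsEstimator [MeasurableSpace Ω] (S : Scheme d Ω) (P : Measure Ω) (n : ℕ) (bhat : Ω → Vec d) :
    Prop :=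
  AEMeasurable bhat P ∧ ∀ᵐ ω ∂P, ∀ b : Vec d,
    (∀ c : Vec d, c ≠ b → S.objective n ω b < S.objective n ω c) → bhat ω = b

/-- `Σ = E[X₁ X₁ᵀ]` for identically distributed predictors (indices start at `0`). -/
def Sigma [MeasurableSpace Ω] (S : Scheme d Ω) (P : Measure Ω) : Matrix (Fin d) (Fin d) ℝ :=
  Matrix.of fun j k => ∫ ω, S.X 0 ω j * S.X 0 ω k ∂P

/-- `Γ_a = E[(X̃₁ X̃₁ᵀ + Δ₁) β βᵀ (X̃₁ X̃₁ᵀ + Δ₁)]`. -/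
def GammaA [MeasurableSpace Ω] (S : Scheme d Ω) (P : Measure Ω) (β : Vec d) :
    Matrix (Fin d) (Fin d) ℝ :=
  Matrix.of fun j k =>
    ∫ ω, (S.Gram 0 ω * Matrix.vecMulVec β.ofLp β.ofLp * S.Gram 0 ω) j k ∂P

/-- `Γ_b = E[(X̃₁ X̃₁ᵀ + Δ₁) β X̃₁ᵀ Ỹ₁] + E[X̃₁ Ỹ₁ βᵀ (X̃₁ X̃₁ᵀ + Δ₁)]`. -/
def GammaB [MeasurableSpace Ω] (S : Scheme d Ω) (P : Measure Ω) (β : Vec d) :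
    Matrix (Fin d) (Fin d) ℝ :=
  (Matrix.of fun j k =>
    ∫ ω, (S.Gram 0 ω * Matrix.vecMulVec β.ofLp (S.Xq 0 ω)) j k * S.Yq 0 ω ∂P) +
  (Matrix.of fun j k =>
    ∫ ω, S.Yq 0 ω * (Matrix.vecMulVec (S.Xq 0 ω) β.ofLp * S.Gram 0 ω) j k ∂P)

/-- `Γ = L² {Σ - diag(Σ) + R² I} + Γ_a - Γ_b`. -/
def Gamma [MeasurableSpace Ω] (S : Scheme d Ω) (P : Measure Ω) (β : Vec d) :
    Matrix (Fin d) (Fin d) ℝ :=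
  S.L ^ 2 • (S.Sigma P - Matrix.diagonal (fun j => S.Sigma P j j) + S.R ^ 2 • 1)
    + S.GammaA P β - S.GammaB P β

/-- `X̃_i Ỹ_i - (X̃_i X̃_iᵀ + Δ_i) β`. -/
def score (S : Scheme d Ω) (β : Vec d) (i : ℕ) (ω : Ω) : Fin d → ℝ :=
  S.Yq i ω • S.Xq i ω - S.Gram i ω *ᵥ β.ofLp

/-- `V_n = n⁻² ∑ᵢ Cov(X̃_i Ỹ_i - (X̃_i X̃_iᵀ + Δ_i) β)`, the sum being over the first `n`
observations. -/
def V [MeasurableSpace Ω] (S : Scheme d Ω) (P : Measure Ω) (β : Vec d) (n : ℕ) :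
    Matrix (Fin d) (Fin d) ℝ :=
  ((n : ℝ) ^ 2)⁻¹ • ∑ i ∈ Finset.range n,
    Matrix.of fun j k => cov[fun ω => S.score β i ω j, fun ω => S.score β i ω k; P]

end Scheme

/-! ### The linear model and its probabilistic assumptions -/

/-- The response `Y_i = X_iᵀ β + σ ε_i`. -/
def response {d : ℕ} {Ω : Type*} (β : Vec d) (σ : ℝ) (X : ℕ → Ω → Vec d) (ε : ℕ → Ω → ℝ)
    (i : ℕ) (ω : Ω) : ℝ :=
  (X i ω).ofLp ⬝ᵥ β.ofLp + σ * ε i ω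

/-- The errors are i.i.d. with mean zero and unit variance. -/
structure IsNoise {Ω : Type*} [MeasurableSpace Ω] (P : Measure Ω) (ε : ℕ → Ω → ℝ) : Prop where
  meas : ∀ i, Measurable (ε i)
  indep : iIndepFun ε P
  ident : ∀ i, IdentDistrib (ε i) (ε 0) P P
  mean : ∫ ω, ε 0 ω ∂P = 0
  var : ∫ ω, ε 0 ω ^ 2 ∂P = 1

/-- The predictors are i.i.d. and independent of the errors. -/
structure IsRandomDesign {d : ℕ} {Ω : Type*} [MeasurableSpace Ω] (P : Measure Ω)
    (X : ℕ → Ω → Vec d) (ε : ℕ → Ω → ℝ) : Prop where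
  meas : ∀ i, Measurable (X i)
  indep : iIndepFun X P
  ident : ∀ i, IdentDistrib (X i) (X 0) P P
  indep_noise : IndepFun (fun ω i => X i ω) (fun ω i => ε i ω) P

/-- The normalized dithers are i.i.d. uniform on `(-1/2, 1/2)`, and independent of the data. -/
structure IsDither {d : ℕ} {Ω : Type*} [MeasurableSpace Ω] (P : Measure Ω)
    (X : ℕ → Ω → Vec d) (ε : ℕ → Ω → ℝ) (U : ℕ → Bit d → Ω → ℝ) : Prop where
  meas : ∀ i k, Measurable (U i k)
  unif : ∀ i k, P.map (U i k) = volume.restrict (Set.Ioo (-(1 / 2) : ℝ) (1 / 2))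
  indep : iIndepFun (fun p : ℕ × Bit d => U p.1 p.2) P
  indep_data : IndepFun (fun ω i => (X i ω, ε i ω)) (fun ω (p : ℕ × Bit d) => U p.1 p.2 ω) P

/-- The predictors have mean zero, unit variances and finite sub-Gaussian norm. -/
structure IsSubGaussianDesign {d : ℕ} {Ω : Type*} [MeasurableSpace Ω] (P : Measure Ω)
    (X : ℕ → Ω → Vec d) : Prop where
  mean : ∀ j, ∫ ω, X 0 ω j ∂P = 0
  var : ∀ j, ∫ ω, X 0 ω j ^ 2 ∂P = 1
  subGaussian : psiTwoVec P (X 0) < ∞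

/-- The quantizer range `R_n = √(2 C_K (q + 1) log (n d))`, where `C_K = C K²` and `K` is the maximal
sub-Gaussian norm of the coordinates of `X₁`. -/
def rangeX {d : ℕ} {Ω : Type*} [MeasurableSpace Ω] (P : Measure Ω) (C q : ℝ) (X : ℕ → Ω → Vec d)
    (n : ℕ) : ℝ :=
  let K : ℝ := (⨆ j : Fin d, psiTwo P (fun ω => X 0 ω j)).toReal
  √(2 * (C * K ^ 2) * (q + 1) * Real.log (n * d))

/-- The quantizer range
`L_n = (√(2 (q + 1) C_{K'}) ‖Σ^{1/2} β‖ + σ √(2 (q + 1) C_{K''})) √(log n)`, where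
`C_{K'} = C K'²` and `C_{K''} = C K''²` with `K'` the sub-Gaussian norm of `Σ^{-1/2} X₁` and
`K''` that of `ε₁`. -/
def rangeY {d : ℕ} {Ω : Type*} [MeasurableSpace Ω] (P : Measure Ω) (C q : ℝ) (β : Vec d) (σ : ℝ)
    (Sig : Matrix (Fin d) (Fin d) ℝ) (X : ℕ → Ω → Vec d) (ε : ℕ → Ω → ℝ) (n : ℕ) : ℝ :=
  let K' : ℝ := (psiTwoVec P (fun ω => matVec (invSqrt Sig) (X 0 ω))).toReal
  let K'' : ℝ := (psiTwo P (ε 0)).toReal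
  (√(2 * (q + 1) * (C * K' ^ 2)) * ‖matVec (CFC.sqrt Sig) β‖
    + σ * √(2 * (q + 1) * (C * K'' ^ 2))) * √(Real.log n)

end QuantReg

end

namespace QuantReg

/-! ### A central limit theorem for bounded triangular arrays -/

lemma norm_prod_sub_prod_le {ι : Type*} (s : Finset ι) (z w : ι → ℂ)
    (hz : ∀ i ∈ s, ‖z i‖ ≤ 1) (hw : ∀ i ∈ s, ‖w i‖ ≤ 1) :
    ‖∏ i ∈ s, z i - ∏ i ∈ s, w i‖ ≤ ∑ i ∈ s, ‖z i - w i‖ := by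
  classical
  induction s using Finset.induction_on with
  | empty => simp
  | insert a s ha ih =>
    rw [Finset.prod_insert ha, Finset.prod_insert ha, Finset.sum_insert ha]
    have ih' := ih (fun i hi => hz i (Finset.mem_insert_of_mem hi))
      (fun i hi => hw i (Finset.mem_insert_of_mem hi))
    have hp : ‖∏ i ∈ s, w i‖ ≤ 1 := by
      rw [norm_prod]
      exact Finset.prod_le_one (fun _ _ => norm_nonneg _)
        (fun i hi => hw i (Finset.mem_insert_of_mem hi))
    have e : z a * ∏ i ∈ s, z i - w a * ∏ i ∈ s, w i
        = (z a - w a) * ∏ i ∈ s, w i + z a * (∏ i ∈ s, z i - ∏ i ∈ s, w i) := by ring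
    rw [e]
    refine (norm_add_le _ _).trans ?_
    rw [norm_mul, norm_mul]
    have := hz a (Finset.mem_insert_self _ _)
    have h1 : ‖z a - w a‖ * ‖∏ i ∈ s, w i‖ ≤ ‖z a - w a‖ :=
      mul_le_of_le_one_right (norm_nonneg _) hp
    have h2 : ‖z a‖ * ‖∏ i ∈ s, z i - ∏ i ∈ s, w i‖ ≤ ‖∏ i ∈ s, z i - ∏ i ∈ s, w i‖ :=
      mul_le_of_le_one_left (norm_nonneg _) this
    linarith

lemma norm_cexp_mul_I_sub_le {x : ℝ} (hx : |x| ≤ 1) :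
    ‖Complex.exp (x * Complex.I) - (1 + x * Complex.I - (x : ℂ) ^ 2 / 2)‖ ≤ |x| ^ 3 := by
  have hn : ‖(x : ℂ) * Complex.I‖ = |x| := by simp
  have h := Complex.exp_bound (x := (x : ℂ) * Complex.I) (by rw [hn]; exact hx) (n := 3) (by norm_num)
  rw [hn] at h
  have e : ∑ m ∈ Finset.range 3, ((x : ℂ) * Complex.I) ^ m / (m.factorial : ℂ)
      = 1 + x * Complex.I - (x : ℂ) ^ 2 / 2 := by
    simp [Finset.sum_range_succ, Nat.factorial, mul_pow]
    ring
  rw [e] at h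
  refine h.trans ?_
  have : (0 : ℝ) ≤ |x| ^ 3 := by positivity
  norm_num [Nat.factorial]
  linarith

variable {Ω : Type*} [MeasurableSpace Ω] {P : Measure Ω} [IsProbabilityMeasure P]

/-- A quantitative second-order expansion of the characteristic function of a bounded centered
random variable. -/
lemma norm_charFun_sub_exp_le {Y : Ω → ℝ} (hY : AEMeasurable Y P) {B s : ℝ}
    (hB : ∀ᵐ ω ∂P, |Y ω| ≤ B) (h0 : ∫ ω, Y ω ∂P = 0) (hs : |s| * B ≤ 1) :
    ‖charFun (P.map Y) s - Complex.exp (-(s ^ 2 * (∫ ω, Y ω ^ 2 ∂P) / 2 : ℝ))‖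
      ≤ 2 * (|s| * B) ^ 3 := by
  have hB0 : 0 ≤ B := by
    obtain ⟨ω, hω⟩ := hB.exists
    exact (abs_nonneg _).trans hω
  have hYi : Integrable Y P := Integrable.of_bound hY.aestronglyMeasurable B
    (by simpa [Real.norm_eq_abs] using hB)
  have hY2 : ∀ᵐ ω ∂P, Y ω ^ 2 ≤ B ^ 2 := by
    filter_upwards [hB] with ω hω
    exact sq_le_sq' (by linarith [abs_le.1 hω]) (abs_le.1 hω).2
  have hY2i : Integrable (fun ω => Y ω ^ 2) P :=
    Integrable.of_bound (hY.pow_const 2).aestronglyMeasurable (B ^ 2)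
    (by filter_upwards [hY2] with ω hω; rw [Real.norm_eq_abs, abs_of_nonneg (sq_nonneg _)]; exact hω)
  set v := ∫ ω, Y ω ^ 2 ∂P with hv
  have hv0 : 0 ≤ v := integral_nonneg fun ω => sq_nonneg _
  have hvB : v ≤ B ^ 2 := by
    have := integral_mono_ae hY2i (integrable_const (B ^ 2)) hY2
    simpa using this
  have hsB : 0 ≤ |s| * B := by positivity
  have key : ‖charFun (P.map Y) s - (1 - (s ^ 2 * v / 2 : ℝ))‖ ≤ (|s| * B) ^ 3 := by
    have e1 : charFun (P.map Y) s = ∫ ω, Complex.exp (((s * Y ω : ℝ) : ℂ) * Complex.I) ∂P := by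
      rw [charFun_apply_real, integral_map hY (by fun_prop)]
      simp
    have i1 : Integrable (fun ω => Complex.exp (((s * Y ω : ℝ) : ℂ) * Complex.I)) P := by
      refine Integrable.of_bound (C := 1) ?_ ?_
      · exact (Measurable.aestronglyMeasurable (by fun_prop : Measurable
          (fun y : ℝ => Complex.exp (((s * y : ℝ) : ℂ) * Complex.I)))).comp_aemeasurable hY
      · exact ae_of_all _ fun ω => (Complex.norm_exp_ofReal_mul_I _).le
    have j1 : Integrable (fun ω => ((s * Y ω : ℝ) : ℂ) * Complex.I) P :=
      ((hYi.const_mul s).ofReal).mul_const _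
    have j2 : Integrable (fun ω => ((s * Y ω : ℝ) : ℂ) ^ 2 / 2) P := by
      have : (fun ω => ((s * Y ω : ℝ) : ℂ) ^ 2 / 2) = fun ω => ((s ^ 2 * Y ω ^ 2 / 2: ℝ) : ℂ) := by
        ext ω; push_cast; ring
      rw [this]
      exact (((hY2i.const_mul (s ^ 2)).div_const 2)).ofReal
    have j3 : Integrable (fun ω => (1 : ℂ) + ((s * Y ω : ℝ) : ℂ) * Complex.I) P :=
      (integrable_const 1).add j1
    have e2 : (1 - (s ^ 2 * v / 2 : ℝ) : ℂ) = ∫ ω, (1 + ((s * Y ω : ℝ) : ℂ) * Complex.I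
        - ((s * Y ω : ℝ) : ℂ) ^ 2 / 2) ∂P := by
      have a1 : ∫ ω, ((s * Y ω : ℝ) : ℂ) * Complex.I ∂P = 0 := by
        rw [integral_mul_const, integral_complex_ofReal, integral_const_mul, h0]; simp
      have a2 : ∫ ω, ((s * Y ω : ℝ) : ℂ) ^ 2 / 2 ∂P = ((s ^ 2 * v / 2 : ℝ) : ℂ) := by
        rw [integral_div]
        have : ∀ ω, ((s * Y ω : ℝ) : ℂ) ^ 2 = ((s ^ 2 * Y ω ^ 2 : ℝ) : ℂ) := by
          intro ω; push_cast; ring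
        simp_rw [this]
        rw [integral_complex_ofReal, integral_const_mul]
        push_cast; rfl
      rw [integral_sub j3 j2, integral_add (integrable_const 1) j1, a1, a2]
      simp
    have i2 : Integrable (fun ω => (1 + ((s * Y ω : ℝ) : ℂ) * Complex.I
        - ((s * Y ω : ℝ) : ℂ) ^ 2 / 2)) P := j3.sub j2
    rw [e1, e2, ← integral_sub i1 i2]
    have hb : ∀ᵐ ω ∂P, ‖Complex.exp (((s * Y ω : ℝ) : ℂ) * Complex.I) -
        (1 + ((s * Y ω : ℝ) : ℂ) * Complex.I - ((s * Y ω : ℝ) : ℂ) ^ 2 / 2)‖ ≤ (|s| * B) ^ 3 := by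
      filter_upwards [hB] with ω hω
      have h1 : |s * Y ω| ≤ |s| * B := by
        rw [abs_mul]; exact mul_le_mul_of_nonneg_left hω (abs_nonneg _)
      exact (norm_cexp_mul_I_sub_le (h1.trans hs)).trans (by gcongr)
    simpa using norm_integral_le_of_norm_le_const hb
  have hu : |-(s ^ 2 * v / 2)| ≤ (|s| * B) ^ 2 / 2 := by
    rw [abs_neg, abs_of_nonneg (by positivity), mul_pow, sq_abs]
    have := mul_le_mul_of_nonneg_left hvB (sq_nonneg s)
    linarith
  have hsB2 : (|s| * B) ^ 2 ≤ 1 := pow_le_one₀ hsB hs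
  have h2 : ‖Complex.exp (-(s ^ 2 * v / 2 : ℝ)) - (1 - (s ^ 2 * v / 2 : ℝ))‖ ≤ (|s| * B) ^ 3 := by
    have h := Complex.norm_exp_sub_one_sub_id_le (x := ((-(s ^ 2 * v / 2) : ℝ) : ℂ))
      (by rw [Complex.norm_real, Real.norm_eq_abs]; linarith)
    rw [Complex.norm_real, Real.norm_eq_abs] at h
    have e : Complex.exp (-(s ^ 2 * v / 2 : ℝ)) - (1 - (s ^ 2 * v / 2 : ℝ))
        = Complex.exp ((-(s ^ 2 * v / 2) : ℝ) : ℂ) - 1 - ((-(s ^ 2 * v / 2) : ℝ) : ℂ) := by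
      push_cast; ring
    rw [e]
    refine h.trans ?_
    have : |-(s ^ 2 * v / 2)| ^ 2 ≤ ((|s| * B) ^ 2 / 2) ^ 2 := by gcongr
    refine this.trans ?_
    have h4 : (|s| * B) ^ 4 ≤ (|s| * B) ^ 3 := pow_le_pow_of_le_one hsB hs (by norm_num)
    have h5 : ((|s| * B) ^ 2 / 2) ^ 2 = (|s| * B) ^ 4 / 4 := by ring
    have h6 : 0 ≤ (|s| * B) ^ 3 := by positivity
    rw [h5]; linarith
  calc _ = ‖(charFun (P.map Y) s - (1 - (s ^ 2 * v / 2 : ℝ)))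
        - (Complex.exp (-(s ^ 2 * v / 2 : ℝ)) - (1 - (s ^ 2 * v / 2 : ℝ)))‖ := by congr 1; ring
    _ ≤ _ := (norm_sub_le _ _).trans (by linarith)

/-- Characteristic functions of normalized row sums of a bounded triangular array. -/
lemma tendsto_charFun_row_sum {Y : ℕ → ℕ → Ω → ℝ} (hY : ∀ n i, AEMeasurable (Y n i) P)
    (hind : ∀ n, iIndepFun (Y n) P) {B v : ℝ}
    (hB : ∀ᶠ n in atTop, ∀ i < n, ∀ᵐ ω ∂P, |Y n i ω| ≤ B)
    (h0 : ∀ᶠ n in atTop, ∀ i < n, ∫ ω, Y n i ω ∂P = 0)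
    (hv : Tendsto (fun n : ℕ => (n : ℝ)⁻¹ * ∑ i ∈ Finset.range n, ∫ ω, Y n i ω ^ 2 ∂P)
      atTop (𝓝 v)) :
    Tendsto (fun n : ℕ => charFun (P.map (fun ω => ∑ i ∈ Finset.range n, Y n i ω)) (√n)⁻¹) atTop
      (𝓝 (Complex.exp (-(v / 2 : ℝ)))) := by
  have hsq : Tendsto (fun n : ℕ => (√(n : ℝ))⁻¹) atTop (𝓝 0) :=
    tendsto_inv_atTop_zero.comp (Real.tendsto_sqrt_atTop.comp tendsto_natCast_atTop_atTop)
  have hsmall : ∀ᶠ n : ℕ in atTop, (√(n : ℝ))⁻¹ * |B| < 1 := by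
    have : Tendsto (fun n : ℕ => (√(n : ℝ))⁻¹ * |B|) atTop (𝓝 (0 * |B|)) := hsq.mul_const _
    rw [zero_mul] at this
    exact this.eventually_lt_const one_pos
  have hmain : ∀ᶠ n : ℕ in atTop,
      ‖charFun (P.map (fun ω => ∑ i ∈ Finset.range n, Y n i ω)) (√n)⁻¹
        - Complex.exp (-(((n : ℝ)⁻¹ * ∑ i ∈ Finset.range n, ∫ ω, Y n i ω ^ 2 ∂P) / 2 : ℝ))‖
      ≤ 2 * |B| ^ 3 * (√(n : ℝ))⁻¹ := by
    filter_upwards [hB, h0, hsmall, eventually_gt_atTop 0] with n hBn h0n hsn hn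
    have hn' : (0 : ℝ) < n := by exact_mod_cast hn
    rw [((hind n).restrict _).charFun_map_fun_finsetSum_eq_prod (fun _ _ => hY n _)]
    have e : Complex.exp (-(((n : ℝ)⁻¹ * ∑ i ∈ Finset.range n, ∫ ω, Y n i ω ^ 2 ∂P) / 2 : ℝ))
        = ∏ i ∈ Finset.range n,
          Complex.exp (-((√n)⁻¹ ^ 2 * (∫ ω, Y n i ω ^ 2 ∂P) / 2 : ℝ)) := by
      rw [← Complex.exp_sum]
      congr 1
      have : (√(n : ℝ))⁻¹ ^ 2 = (n : ℝ)⁻¹ := by rw [inv_pow, Real.sq_sqrt hn'.le]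
      rw [this, ← Complex.ofReal_neg, Finset.mul_sum, Finset.sum_div, ← Finset.sum_neg_distrib]
      push_cast
      rfl
    rw [e, Finset.prod_apply]
    refine (norm_prod_sub_prod_le _ _ _ ?_ ?_).trans ?_
    · intro i _
      have := Measure.isProbabilityMeasure_map (hY n i)
      exact norm_charFun_le_one _
    · intro i _
      rw [← Complex.ofReal_neg, Complex.norm_exp_ofReal]
      rw [Real.exp_le_one_iff]
      have : 0 ≤ ∫ ω, Y n i ω ^ 2 ∂P := integral_nonneg fun ω => sq_nonneg _
      have : 0 ≤ (√(n : ℝ))⁻¹ ^ 2 * (∫ ω, Y n i ω ^ 2 ∂P) / 2 := by positivity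
      linarith
    · have hb : ∀ i ∈ Finset.range n, ‖charFun (P.map (Y n i)) (√n)⁻¹
          - Complex.exp (-((√n)⁻¹ ^ 2 * (∫ ω, Y n i ω ^ 2 ∂P) / 2 : ℝ))‖
          ≤ 2 * ((√(n : ℝ))⁻¹ * |B|) ^ 3 := by
        intro i hi
        have hi := Finset.mem_range.1 hi
        have hs : |(√(n : ℝ))⁻¹| = (√(n : ℝ))⁻¹ := abs_of_nonneg (by positivity)
        have := norm_charFun_sub_exp_le (hY n i) (B := |B|) (s := (√(n : ℝ))⁻¹)
          (by filter_upwards [hBn i hi] with ω hω using hω.trans (le_abs_self B)) (h0n i hi)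
          (by rw [hs]; exact hsn.le)
        rwa [hs] at this
      refine (Finset.sum_le_sum hb).trans (le_of_eq ?_)
      have : (n : ℝ) * (√(n : ℝ))⁻¹ ^ 2 = 1 := by
        rw [inv_pow, Real.sq_sqrt hn'.le, mul_inv_cancel₀ hn'.ne']
      rw [Finset.sum_const, Finset.card_range, nsmul_eq_mul]
      calc (n : ℝ) * (2 * ((√(n : ℝ))⁻¹ * |B|) ^ 3)
          = ((n : ℝ) * (√(n : ℝ))⁻¹ ^ 2) * (2 * |B| ^ 3 * (√(n : ℝ))⁻¹) := by ring
        _ = _ := by rw [this, one_mul]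
  have hlim : Tendsto (fun n : ℕ =>
      Complex.exp (-(((n : ℝ)⁻¹ * ∑ i ∈ Finset.range n, ∫ ω, Y n i ω ^ 2 ∂P) / 2 : ℝ)))
      atTop (𝓝 (Complex.exp (-(v / 2 : ℝ)))) := by
    have hc : Continuous fun x : ℝ => Complex.exp (-(x / 2 : ℝ)) := by fun_prop
    exact (hc.tendsto v).comp hv
  have hdiff : Tendsto (fun n : ℕ =>
      charFun (P.map (fun ω => ∑ i ∈ Finset.range n, Y n i ω)) (√n)⁻¹
        - Complex.exp (-(((n : ℝ)⁻¹ * ∑ i ∈ Finset.range n, ∫ ω, Y n i ω ^ 2 ∂P) / 2 : ℝ)))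
      atTop (𝓝 0) := by
    refine squeeze_zero_norm' hmain ?_
    simpa using hsq.const_mul (2 * |B| ^ 3)
  simpa using hdiff.add hlim

/-- **Central limit theorem** for row-wise independent, uniformly bounded, centered random vectors
whose average covariance converges. -/
theorem tendstoInDistribution_row_sum {d : ℕ} {ξ : ℕ → ℕ → Ω → Vec d}
    (hξ : ∀ n i, Measurable (ξ n i)) (hind : ∀ n, iIndepFun (ξ n) P)
    {B : ℝ} {Γ : Matrix (Fin d) (Fin d) ℝ} (hΓ : Γ.PosSemidef)
    (hB : ∀ᶠ n in atTop, ∀ i < n, ∀ᵐ ω ∂P, ‖ξ n i ω‖ ≤ B)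
    (h0 : ∀ᶠ n in atTop, ∀ i < n, ∀ t : Vec d, ∫ ω, inner ℝ (ξ n i ω) t ∂P = 0)
    (hv : ∀ t : Vec d, Tendsto (fun n : ℕ => (n : ℝ)⁻¹ *
      ∑ i ∈ Finset.range n, ∫ ω, inner ℝ (ξ n i ω) t ^ 2 ∂P) atTop
      (𝓝 (t.ofLp ⬝ᵥ Γ *ᵥ t.ofLp))) :
    TendstoInDistribution (fun (n : ℕ) ω => (√(n : ℝ))⁻¹ • ∑ i ∈ Finset.range n, ξ n i ω) atTop id
      (fun _ => P) (multivariateGaussian 0 Γ) where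
  forall_aemeasurable n := by fun_prop
  aemeasurable_limit := aemeasurable_id
  tendsto := by
    refine ProbabilityMeasure.tendsto_iff_tendsto_charFun.2 fun t => ?_
    have h := tendsto_charFun_row_sum (P := P) (Y := fun n i ω => inner ℝ (ξ n i ω) t)
      (B := B * ‖t‖) (fun n i => ((hξ n i).inner_const).aemeasurable)
      (fun n => (hind n).comp (fun _ x => inner ℝ x t) (fun _ => by fun_prop))
      (by
        filter_upwards [hB] with n hn i hi
        filter_upwards [hn i hi] with ω hω
        exact (abs_real_inner_le_norm _ _).trans (by gcongr))
      (by filter_upwards [h0] with n hn i hi using hn i hi t) (hv t)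
    simp only [ProbabilityMeasure.coe_mk, Measure.map_id]
    rw [charFun_multivariateGaussian hΓ]
    convert h using 2 with n
    · rw [charFun_apply, charFun_apply_real, integral_map (by fun_prop) (by fun_prop),
        integral_map (by fun_prop) (by fun_prop)]
      congr 1; ext ω
      rw [real_inner_smul_left, sum_inner]
      push_cast
      rfl
    · simp

/-! ### Independence of blocks -/

section Blocks

variable {Ω : Type*} [MeasurableSpace Ω] {P : Measure Ω}

lemma iIndepFun.prodMk_of_indepFun {ι : Type*} {α β : Type*} [MeasurableSpace α]
    [MeasurableSpace β] {f : ι → Ω → α} {g : ι → Ω → β} (hfm : ∀ i, Measurable (f i))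
    (hgm : ∀ i, Measurable (g i)) (hf : iIndepFun f P) (hg : iIndepFun g P)
    (hfg : IndepFun (fun ω i => f i ω) (fun ω i => g i ω) P) :
    iIndepFun (fun i ω => (f i ω, g i ω)) P := by
  rw [iIndepFun_iff_iIndep]
  refine iIndepSets.iIndep (fun i => ((hfm i).prodMk (hgm i)).comap_le)
    (fun i => Set.preimage (fun ω => (f i ω, g i ω)) ''
      Set.image2 (· ×ˢ ·) {s : Set α | MeasurableSet s} {t : Set β | MeasurableSet t})
    (fun i => by
      have := (isPiSystem_prod (α := α) (β := β)).comap (fun ω => (f i ω, g i ω))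
      exact this)
    (fun i => by rw [← MeasurableSpace.comap_generateFrom, generateFrom_prod]) ?_
  rw [iIndepSets_iff]
  intro s F hF
  have hF' : ∀ i : ι, ∃ A : Set α, ∃ B : Set β, MeasurableSet A ∧ MeasurableSet B ∧
      (i ∈ s → F i = f i ⁻¹' A ∩ g i ⁻¹' B) := by
    intro i
    by_cases hi : i ∈ s
    · obtain ⟨_, ⟨A, hA, B, hB, rfl⟩, hFi⟩ := hF i hi
      exact ⟨A, B, hA, hB, fun _ => hFi.symm⟩
    · exact ⟨∅, ∅, MeasurableSet.empty, MeasurableSet.empty, fun h => absurd h hi⟩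
  choose A B hA hB hAB using hF'
  have e1 : ⋂ i ∈ s, F i = (fun ω i => f i ω) ⁻¹' ((s : Set ι).pi A) ∩
      (fun ω i => g i ω) ⁻¹' ((s : Set ι).pi B) := by
    ext ω
    simp only [Set.mem_iInter, Set.mem_inter_iff, Set.mem_preimage, Set.mem_pi, Finset.mem_coe]
    constructor
    · intro h
      exact ⟨fun i hi => by have := h i hi; rw [hAB i hi] at this; exact this.1,
        fun i hi => by have := h i hi; rw [hAB i hi] at this; exact this.2⟩
    · intro h i hi
      rw [hAB i hi]
      exact ⟨h.1 i hi, h.2 i hi⟩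
  have e2 : (fun ω i => f i ω) ⁻¹' ((s : Set ι).pi A) = ⋂ i ∈ s, f i ⁻¹' A i := by
    ext ω; simp [Set.mem_pi]
  have e3 : (fun ω i => g i ω) ⁻¹' ((s : Set ι).pi B) = ⋂ i ∈ s, g i ⁻¹' B i := by
    ext ω; simp [Set.mem_pi]
  rw [e1, hfg.measure_inter_preimage_eq_mul _ _
    (MeasurableSet.pi s.countable_toSet fun i _ => hA i)
    (MeasurableSet.pi s.countable_toSet fun i _ => hB i), e2, e3,
    hf.measure_inter_preimage_eq_mul s (fun i _ => hA i),
    hg.measure_inter_preimage_eq_mul s (fun i _ => hB i), ← Finset.prod_mul_distrib]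
  refine Finset.prod_congr rfl fun i hi => ?_
  have hi2 : IndepFun (f i) (g i) P :=
    hfg.comp (measurable_pi_apply i) (measurable_pi_apply i)
  rw [hAB i hi, hi2.measure_inter_preimage_eq_mul _ _ (hA i) (hB i)]

lemma iIndepFun.curry [IsProbabilityMeasure P] {ι κ α : Type*} [MeasurableSpace α] {U : ι → κ → Ω → α}
    (hU : ∀ i k, Measurable (U i k)) (h : iIndepFun (fun p : ι × κ => U p.1 p.2) P) :
    iIndepFun (fun i ω k => U i k ω) P := by
  have hrow : ∀ i, iIndepFun (U i) P := fun i =>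
    h.precomp (g := fun k => (i, k)) (fun a b hab => by simpa using hab)
  have hpr : ∀ p : ι × κ, IsProbabilityMeasure (P.map (U p.1 p.2)) := fun p =>
    Measure.isProbabilityMeasure_map (hU _ _).aemeasurable
  have hpr2 : ∀ i k, IsProbabilityMeasure (P.map (U i k)) := fun i k => hpr (i, k)
  rw [iIndepFun_iff_map_fun_eq_infinitePi_map (fun i => measurable_pi_lambda _ (hU i))]
  have h1 := h.map_fun_eq_infinitePi_map (fun p : ι × κ => hU p.1 p.2)
  have h2 : ∀ i, P.map (fun ω k => U i k ω) = Measure.infinitePi (fun k => P.map (U i k)) :=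
    fun i => (hrow i).map_fun_eq_infinitePi_map (hU i)
  simp_rw [h2]
  rw [← Measure.infinitePi_map_curry (μ := fun i k => P.map (U i k)), ← h1,
    Measure.map_map (by fun_prop) (measurable_pi_lambda _ fun p : ι × κ => hU p.1 p.2)]
  rfl

lemma IndepFun.prodMk_left_of_prodMk_right [IsProbabilityMeasure P] {α β γ : Type*} [MeasurableSpace α]
    [MeasurableSpace β] [MeasurableSpace γ] {D : Ω → α} {V : Ω → β} {u : Ω → γ}
    (hD : Measurable D) (hV : Measurable V) (hu : Measurable u)
    (h : IndepFun D (fun ω => (V ω, u ω)) P) (h' : IndepFun V u P) :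
    IndepFun (fun ω => (D ω, V ω)) u P := by
  have := Measure.isProbabilityMeasure_map (μ := P) hD.aemeasurable
  have := Measure.isProbabilityMeasure_map (μ := P) hV.aemeasurable
  have := Measure.isProbabilityMeasure_map (μ := P) hu.aemeasurable
  have h1 := (indepFun_iff_map_prod_eq_prod_map_map hD.aemeasurable
    (hV.prodMk hu).aemeasurable).1 h
  rw [(indepFun_iff_map_prod_eq_prod_map_map hV.aemeasurable hu.aemeasurable).1 h'] at h1
  have hDV : IndepFun D V P := h.comp (φ := id) (ψ := Prod.fst) measurable_id measurable_fst
  rw [indepFun_iff_map_prod_eq_prod_map_map (hD.prodMk hV).aemeasurable hu.aemeasurable,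
    (indepFun_iff_map_prod_eq_prod_map_map hD.aemeasurable hV.aemeasurable).1 hDV,
    ← (measurePreserving_prodAssoc (P.map D) (P.map V) (P.map u)).symm.map_eq, ← h1,
    Measure.map_map (by fun_prop) (hD.prodMk (hV.prodMk hu))]
  rfl

end Blocks

/-! ### The dithered quantizer -/

/-- Projection of `z` onto the interval `[l, u]`. -/
noncomputable def clip (l u z : ℝ) : ℝ := max l (min u z)

lemma measurable_clip (l u : ℝ) : Measurable (clip l u) := by
  unfold clip; fun_prop

lemma clip_eq_self {l u z : ℝ} (h1 : l ≤ z) (h2 : z ≤ u) : clip l u z = z := by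
  simp [clip, h1, h2]

lemma clip_symm_eq_self {u z : ℝ} (h : |z| ≤ u) : clip (-u) u z = z :=
  clip_eq_self (abs_le.1 h).1 (abs_le.1 h).2

lemma abs_clip_symm_le {u : ℝ} (hu : 0 ≤ u) (z : ℝ) : |clip (-u) u z| ≤ u := by
  unfold clip
  rw [abs_le]
  exact ⟨le_max_left _ _, max_le (by linarith) (min_le_left _ _)⟩

lemma abs_clip_symm_le_abs {u : ℝ} (hu : 0 ≤ u) (z : ℝ) : |clip (-u) u z| ≤ |z| := by
  unfold clip
  rcases abs_cases z with ⟨h, h'⟩ | ⟨h, h'⟩ <;> rw [abs_le, h] <;> constructor <;>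
    rcases max_cases (-u) (min u z) with ⟨e, e'⟩ | ⟨e, e'⟩ <;>
    rcases min_cases u z with ⟨f, f'⟩ | ⟨f, f'⟩ <;> linarith

lemma clip_sq {u : ℝ} (hu : 0 ≤ u) (z : ℝ) : clip 0 (u ^ 2) (z ^ 2) = clip (-u) u z ^ 2 := by
  by_cases h : |z| ≤ u
  · rw [clip_symm_eq_self h, clip_eq_self (sq_nonneg _) (sq_le_sq.2 (by rwa [abs_of_nonneg hu]))]
  · have h := not_le.1 h
    have h1 : u ^ 2 ≤ z ^ 2 := sq_le_sq.2 (by rw [abs_of_nonneg hu]; exact h.le)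
    have h2 : clip 0 (u ^ 2) (z ^ 2) = u ^ 2 := by simp [clip, h1, sq_nonneg]
    rw [h2]
    rcases le_total 0 z with hz | hz
    · rw [abs_of_nonneg hz] at h
      have : clip (-u) u z = u := by simp [clip, h.le, hu]
      rw [this]
    · rw [abs_of_nonpos hz] at h
      have : clip (-u) u z = -u := by
        unfold clip
        rw [min_eq_right (by linarith), max_eq_left (by linarith)]
      rw [this]; ring

lemma dithered_eq_or (l u z r : ℝ) : dithered l u z r = l ∨ dithered l u z r = u := by
  unfold dithered nearest
  split_ifs <;> simp

lemma measurable_dithered (l u : ℝ) : Measurable (fun p : ℝ × ℝ => dithered l u p.1 p.2) := by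
  unfold dithered nearest
  refine Measurable.ite (measurableSet_lt ?_ ?_) measurable_const measurable_const <;> fun_prop

lemma abs_dithered_symm (u z r : ℝ) : |dithered (-u) u z r| = |u| := by
  rcases dithered_eq_or (-u) u z r with h | h <;> simp [h]

lemma dithered_symm_sq (u z r : ℝ) : dithered (-u) u z r ^ 2 = u ^ 2 := by
  rw [← sq_abs, abs_dithered_symm, sq_abs]

lemma abs_dithered_le (l u z r : ℝ) : |dithered l u z r| ≤ |l| + |u| := by
  rcases dithered_eq_or l u z r with h | h <;> simp [h]

/-- The uniform distribution on `(-1/2, 1/2)`. -/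
noncomputable abbrev unifHalf : Measure ℝ := volume.restrict (Set.Ioo (-(1 / 2) : ℝ) (1 / 2))

instance : IsProbabilityMeasure unifHalf := ⟨by
  rw [Measure.restrict_apply_univ, Real.volume_Ioo]; norm_num⟩

lemma integral_dithered {l u : ℝ} (h : l ≤ u) (z : ℝ) :
    ∫ r, dithered l u z r ∂unifHalf = clip l u z := by
  rcases h.eq_or_lt with rfl | h
  · have : ∀ r, dithered l l z r = l := fun r => by rcases dithered_eq_or l l z r with h | h <;> exact h
    simp_rw [this]
    simp [clip]
  have hlu : 0 < u - l := by linarith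
  set c := ((l + u) / 2 - z) / (u - l) with hc
  have hcz : c * (u - l) = (l + u) / 2 - z := by rw [hc]; field_simp
  have e : ∀ r, dithered l u z r = l + (u - l) * (Set.Ici c).indicator 1 r := by
    intro r
    unfold dithered nearest
    have iff1 : |z + (u - l) * r - l| < |z + (u - l) * r - u| ↔ r < c := by
      rw [← sq_lt_sq]
      constructor
      · intro hh; by_contra hr; have hr := not_lt.1 hr
        nlinarith [mul_le_mul_of_nonneg_right hr hlu.le]
      · intro hr
        nlinarith [mul_lt_mul_of_pos_right hr hlu]
    by_cases hr : r < c
    · rw [if_pos (iff1.2 hr), Set.indicator_of_notMem (by simpa using hr)]; ring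
    · rw [if_neg (fun hh => hr (iff1.1 hh)), Set.indicator_of_mem (by simpa using hr)]; simp
  simp_rw [e]
  have hint : Integrable (fun r => (u - l) * (Set.Ici c).indicator (1 : ℝ → ℝ) r) unifHalf :=
    ((integrable_const (1 : ℝ)).indicator measurableSet_Ici).const_mul _
  rw [integral_add (integrable_const _) hint,
    integral_const_mul, integral_indicator_one measurableSet_Ici, integral_const]
  simp only [measureReal_def, measure_univ, ENNReal.toReal_one, one_smul]
  rw [Measure.restrict_apply measurableSet_Ici]
  have key : (volume (Set.Ici c ∩ Set.Ioo (-(1 / 2) : ℝ) (1 / 2))).toReal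
      = max 0 (min 1 (1 / 2 - c)) := by
    rcases lt_or_ge (-(1 / 2)) c with h1 | h1
    · have : Set.Ici c ∩ Set.Ioo (-(1 / 2) : ℝ) (1 / 2) = Set.Ico c (1 / 2) := by
        ext r; simp only [Set.mem_inter_iff, Set.mem_Ici, Set.mem_Ioo, Set.mem_Ico]
        constructor
        · rintro ⟨a, b, c⟩; exact ⟨a, c⟩
        · rintro ⟨a, b⟩; exact ⟨a, by linarith, b⟩
      rw [this, Real.volume_Ico, ENNReal.toReal_ofReal', min_eq_right (by linarith), max_comm]
    · have : Set.Ici c ∩ Set.Ioo (-(1 / 2) : ℝ) (1 / 2) = Set.Ioo (-(1 / 2)) (1 / 2) := by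
        ext r; simp only [Set.mem_inter_iff, Set.mem_Ici, Set.mem_Ioo]
        constructor
        · rintro ⟨a, b⟩; exact b
        · rintro ⟨a, b⟩; exact ⟨by linarith, a, b⟩
      rw [this, Real.volume_Ioo, min_eq_left (by linarith)]
      norm_num
  rw [key, mul_max_of_nonneg _ _ hlu.le, mul_min_of_nonneg _ _ hlu.le, clip, ← max_add_add_left,
    ← min_add_add_left]
  congr 1
  · ring
  · congr 1
    · ring
    · have : (u - l) * (1 / 2 - c) = (u - l) / 2 - c * (u - l) := by ring
      rw [this, hcz]; ring

section Expectation

variable {Ω : Type*} [MeasurableSpace Ω] {P : Measure Ω} [IsProbabilityMeasure P]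

/-- Averaging over an independent dither replaces the quantized value by the clipped value. -/
lemma integral_mul_dithered {V Z r : Ω → ℝ} {l u : ℝ} (hlu : l ≤ u) (hV : Measurable V)
    (hZ : Measurable Z) (hr : Measurable r) (hVi : Integrable V P)
    (hunif : P.map r = unifHalf) (hind : IndepFun (fun ω => (V ω, Z ω)) r P) :
    ∫ ω, V ω * dithered l u (Z ω) (r ω) ∂P = ∫ ω, V ω * clip l u (Z ω) ∂P := by
  have hmap := (indepFun_iff_map_prod_eq_prod_map_map (hV.prodMk hZ).aemeasurable hr.aemeasurable).1 hind
  rw [hunif] at hmap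
  have hVZ := Measure.isProbabilityMeasure_map (μ := P) (hV.prodMk hZ).aemeasurable
  set f : (ℝ × ℝ) × ℝ → ℝ := fun p => p.1.1 * dithered l u p.1.2 p.2 with hf
  have hfm : Measurable f :=
    measurable_fst.fst.mul ((measurable_dithered l u).comp (measurable_fst.snd.prodMk measurable_snd))
  have hfi : Integrable f ((P.map fun ω => (V ω, Z ω)).prod unifHalf) := by
    rw [← hmap, integrable_map_measure hfm.aestronglyMeasurable
      ((hV.prodMk hZ).prodMk hr).aemeasurable]
    refine hVi.mul_bdd (c := |l| + |u|) ?_ (ae_of_all _ fun ω => ?_)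
    · exact ((measurable_dithered l u).comp (hZ.prodMk hr)).aestronglyMeasurable
    · exact abs_dithered_le _ _ _ _
  calc ∫ ω, V ω * dithered l u (Z ω) (r ω) ∂P
      = ∫ p, f p ∂(P.map fun ω => ((V ω, Z ω), r ω)) := by
        rw [integral_map ((hV.prodMk hZ).prodMk hr).aemeasurable hfm.aestronglyMeasurable]
    _ = ∫ q, q.1 * clip l u q.2 ∂(P.map fun ω => (V ω, Z ω)) := by
        rw [hmap, integral_prod _ hfi]
        congr 1; ext q
        simp only [hf]
        rw [integral_const_mul, integral_dithered hlu]
    _ = _ := by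
        rw [integral_map (hV.prodMk hZ).aemeasurable]
        exact (measurable_fst.mul ((measurable_clip l u).comp measurable_snd)).aestronglyMeasurable

end Expectation

/-! ### One observation -/

/-- Predictor, error and normalized dithers of one observation. -/
abbrev Obs (d : ℕ) : Type := (Vec d × ℝ) × (Bit d → ℝ)

/-- The deterministic parameters of the quantized linear model. -/
structure Params (d : ℕ) where
  /-- the regression vector -/
  β : Vec d
  /-- the noise level -/
  σ : ℝ
  /-- the range of the quantizer for the predictors -/
  R : ℝ
  /-- the range of the quantizer for the responses -/
  L : ℝ

namespace Params

variable {d : ℕ} (θ : Params d)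

/-- The lower quantization level. -/
def lo : Bit d → ℝ
  | .inl _ => -θ.R
  | .inr (.inl _) => 0
  | .inr (.inr _) => -θ.L

/-- The upper quantization level. -/
def hi : Bit d → ℝ
  | .inl _ => θ.R
  | .inr (.inl _) => θ.R ^ 2
  | .inr (.inr _) => θ.L

/-- The quantity to be quantized. -/
noncomputable def target : Bit d → Vec d × ℝ → ℝ
  | .inl j, p => p.1 j
  | .inr (.inl j), p => p.1 j ^ 2
  | .inr (.inr _), p => p.1.ofLp ⬝ᵥ θ.β.ofLp + θ.σ * p.2

/-- The output of a quantizer. -/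
noncomputable def quant (a : Bit d) (o : Obs d) : ℝ :=
  dithered (θ.lo a) (θ.hi a) (θ.target a o.1) (o.2 a)

/-- The conditional expectation of the output of a quantizer, given the data. -/
noncomputable def clipped (a : Bit d) (o : Obs d) : ℝ :=
  clip (θ.lo a) (θ.hi a) (θ.target a o.1)

/-- The matrix `X̃ X̃ᵀ + Δ` of one observation. -/
noncomputable def gram (o : Obs d) (j k : Fin d) : ℝ :=
  if j = k then θ.quant (.inr (.inl j)) o else θ.quant (.inl j) o * θ.quant (.inl k) o

/-- The score of one observation. -/
noncomputable def score (o : Obs d) (j : Fin d) : ℝ :=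
  θ.quant (.inr (.inr ())) o * θ.quant (.inl j) o - ∑ l, θ.gram o j l * θ.β l

variable {Ω : Type*}

/-- The scheme with responses from the linear model. -/
def scheme (X : ℕ → Ω → Vec d) (ε : ℕ → Ω → ℝ) (U : ℕ → Bit d → Ω → ℝ) : Scheme d Ω where
  X := X
  Y := response θ.β θ.σ X ε
  U := U
  R := θ.R
  L := θ.L

end Params

/-- The `i`-th observation. -/
def obs {d : ℕ} {Ω : Type*} (X : ℕ → Ω → Vec d) (ε : ℕ → Ω → ℝ) (U : ℕ → Bit d → Ω → ℝ) (i : ℕ)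
    (ω : Ω) : Obs d :=
  ((X i ω, ε i ω), fun k => U i k ω)

namespace Params

variable {d : ℕ} (θ : Params d) {Ω : Type*} (X : ℕ → Ω → Vec d) (ε : ℕ → Ω → ℝ)
  (U : ℕ → Bit d → Ω → ℝ)

lemma scheme_Xq (i : ℕ) (ω : Ω) (j : Fin d) :
    (θ.scheme X ε U).Xq i ω j = θ.quant (.inl j) (obs X ε U i ω) := rfl

lemma scheme_Yq (i : ℕ) (ω : Ω) :
    (θ.scheme X ε U).Yq i ω = θ.quant (.inr (.inr ())) (obs X ε U i ω) := rfl

lemma quant_inl_sq (j : Fin d) (o : Obs d) : θ.quant (.inl j) o ^ 2 = θ.R ^ 2 :=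
  dithered_symm_sq _ _ _

lemma quant_Y_sq (o : Obs d) : θ.quant (.inr (.inr ())) o ^ 2 = θ.L ^ 2 :=
  dithered_symm_sq _ _ _

lemma scheme_Gram (i : ℕ) (ω : Ω) (j k : Fin d) :
    (θ.scheme X ε U).Gram i ω j k = θ.gram (obs X ε U i ω) j k := by
  unfold Scheme.Gram Scheme.Delta gram
  rw [Matrix.add_apply, Matrix.vecMulVec_apply, scheme_Xq, scheme_Xq]
  split_ifs with h
  · subst h
    rw [Matrix.diagonal_apply_eq, ← sq, quant_inl_sq]
    change θ.R ^ 2 + (θ.quant (.inr (.inl j)) (obs X ε U i ω) - θ.R ^ 2) = _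
    ring
  · rw [Matrix.diagonal_apply_ne _ h, add_zero]

lemma scheme_score (i : ℕ) (ω : Ω) (j : Fin d) :
    (θ.scheme X ε U).score θ.β i ω j = θ.score (obs X ε U i ω) j := by
  unfold Scheme.score score
  rw [Pi.sub_apply, Pi.smul_apply, scheme_Yq, scheme_Xq, smul_eq_mul, Matrix.mulVec, dotProduct]
  simp_rw [scheme_Gram]

lemma gram_symm (o : Obs d) (j k : Fin d) : θ.gram o j k = θ.gram o k j := by
  unfold gram
  by_cases h : j = k
  · subst h; rfl
  · rw [if_neg h, if_neg (Ne.symm h), mul_comm]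

lemma measurable_target (a : Bit d) : Measurable (θ.target a) := by
  rcases a with j | j | j
  · change Measurable (fun p : Vec d × ℝ => p.1 j); fun_prop
  · change Measurable (fun p : Vec d × ℝ => p.1 j ^ 2); fun_prop
  · change Measurable (fun p : Vec d × ℝ => p.1.ofLp ⬝ᵥ θ.β.ofLp + θ.σ * p.2)
    simp only [dotProduct]
    fun_prop

lemma measurable_quant (a : Bit d) : Measurable (θ.quant a) :=
  (measurable_dithered _ _).comp
    (((θ.measurable_target a).comp measurable_fst).prodMk ((measurable_pi_apply a).comp measurable_snd))

lemma measurable_clipped (a : Bit d) : Measurable (θ.clipped a) :=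
  (measurable_clip _ _).comp ((θ.measurable_target a).comp measurable_fst)

lemma measurable_gram (j k : Fin d) : Measurable (fun o => θ.gram o j k) := by
  unfold gram
  split_ifs
  · exact θ.measurable_quant _
  · exact (θ.measurable_quant _).mul (θ.measurable_quant _)

lemma measurable_score (j : Fin d) : Measurable (fun o => θ.score o j) := by
  unfold score
  refine ((θ.measurable_quant _).mul (θ.measurable_quant _)).sub ?_
  exact Finset.measurable_fun_sum _ fun l _ => (θ.measurable_gram j l).mul_const _

lemma abs_quant_inl (j : Fin d) (o : Obs d) : |θ.quant (.inl j) o| = |θ.R| :=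
  abs_dithered_symm _ _ _

lemma abs_quant_Y (o : Obs d) : |θ.quant (.inr (.inr ())) o| = |θ.L| :=
  abs_dithered_symm _ _ _

lemma quant_sq_nonneg (j : Fin d) (o : Obs d) : 0 ≤ θ.quant (.inr (.inl j)) o := by
  rcases dithered_eq_or 0 (θ.R ^ 2) (θ.target (.inr (.inl j)) o.1) (o.2 (.inr (.inl j))) with h | h
  · exact h.ge
  · exact (sq_nonneg θ.R).trans h.ge

lemma quant_sq_le (j : Fin d) (o : Obs d) : θ.quant (.inr (.inl j)) o ≤ θ.R ^ 2 := by
  rcases dithered_eq_or 0 (θ.R ^ 2) (θ.target (.inr (.inl j)) o.1) (o.2 (.inr (.inl j))) with h | h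
  · exact h.le.trans (sq_nonneg θ.R)
  · exact h.le

lemma abs_gram_le (o : Obs d) (j k : Fin d) : |θ.gram o j k| ≤ θ.R ^ 2 := by
  unfold gram
  split_ifs
  · rw [abs_of_nonneg (θ.quant_sq_nonneg _ _)]
    exact θ.quant_sq_le _ _
  · rw [abs_mul, abs_quant_inl, abs_quant_inl, ← sq, sq_abs]

lemma abs_sum_gram_le (o : Obs d) (j : Fin d) :
    |∑ l, θ.gram o j l * θ.β l| ≤ θ.R ^ 2 * ∑ l, |θ.β l| := by
  refine (Finset.abs_sum_le_sum_abs _ _).trans ?_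
  rw [Finset.mul_sum]
  refine Finset.sum_le_sum fun l _ => ?_
  rw [abs_mul]
  exact mul_le_mul_of_nonneg_right (θ.abs_gram_le o j l) (abs_nonneg _)

/-- A bound for the score. -/
noncomputable def scoreBound : ℝ := |θ.L| * |θ.R| + θ.R ^ 2 * ∑ l, |θ.β l|

lemma abs_score_le (o : Obs d) (j : Fin d) : |θ.score o j| ≤ θ.scoreBound := by
  unfold score scoreBound
  refine (abs_sub _ _).trans (add_le_add ?_ (θ.abs_sum_gram_le o j))
  rw [abs_mul, abs_quant_Y, abs_quant_inl]

lemma abs_quant_le (a : Bit d) (o : Obs d) : |θ.quant a o| ≤ |θ.lo a| + |θ.hi a| :=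
  abs_dithered_le _ _ _ _

/-- The ranges of the quantizers are nonempty. -/
lemma lo_le_hi (hR : 0 ≤ θ.R) (hL : 0 ≤ θ.L) (a : Bit d) : θ.lo a ≤ θ.hi a := by
  rcases a with j | j | j
  · change -θ.R ≤ θ.R; linarith
  · exact sq_nonneg θ.R
  · change -θ.L ≤ θ.L; linarith

lemma abs_clipped_le (hR : 0 ≤ θ.R) (hL : 0 ≤ θ.L) (a : Bit d) (o : Obs d) :
    |θ.clipped a o| ≤ |θ.lo a| + |θ.hi a| := by
  have h1 : θ.lo a ≤ θ.clipped a o := le_max_left _ _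
  have h2 : θ.clipped a o ≤ θ.hi a := max_le (θ.lo_le_hi hR hL a) (min_le_left _ _)
  rw [abs_le]
  constructor
  · linarith [neg_abs_le (θ.lo a), abs_nonneg (θ.hi a)]
  · linarith [le_abs_self (θ.hi a), abs_nonneg (θ.lo a)]

lemma quant_update_of_ne {a b : Bit d} (h : b ≠ a) (o : Obs d) (r : ℝ) :
    θ.quant b (o.1, Function.update o.2 a r) = θ.quant b o := by
  unfold quant
  simp only [Function.update_of_ne h]

end Params

/-! ### Independence in the model -/

/-- The common part of the random and the fixed design. -/
structure IsModel {d : ℕ} {Ω : Type*} [MeasurableSpace Ω] (P : Measure Ω) (X : ℕ → Ω → Vec d)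
    (ε : ℕ → Ω → ℝ) (U : ℕ → Bit d → Ω → ℝ) : Prop where
  noise : IsNoise P ε
  measX : ∀ i, Measurable (X i)
  indepX : iIndepFun X P
  indep_noise : IndepFun (fun ω i => X i ω) (fun ω i => ε i ω) P
  dither : IsDither P X ε U

namespace IsModel

variable {d : ℕ} {Ω : Type*} [MeasurableSpace Ω] {P : Measure Ω}
  {X : ℕ → Ω → Vec d} {ε : ℕ → Ω → ℝ} {U : ℕ → Bit d → Ω → ℝ}

lemma measurable_obs (h : IsModel P X ε U) (i : ℕ) : Measurable (obs X ε U i) :=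
  ((h.measX i).prodMk (h.noise.meas i)).prodMk (measurable_pi_lambda _ fun k => h.dither.meas i k)

lemma indepFun_data_dither (h : IsModel P X ε U) :
    IndepFun (fun ω i => (X i ω, ε i ω)) (fun ω i k => U i k ω) P :=
  h.dither.indep_data.comp (φ := id) (ψ := fun (f : ℕ × Bit d → ℝ) i k => f (i, k))
    measurable_id (by fun_prop)

lemma iIndepFun_obs [IsProbabilityMeasure P] (h : IsModel P X ε U) : iIndepFun (obs X ε U) P :=
  iIndepFun.prodMk_of_indepFun (f := fun i ω => (X i ω, ε i ω)) (g := fun i ω k => U i k ω)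
    (fun i => (h.measX i).prodMk (h.noise.meas i))
    (fun i => measurable_pi_lambda _ fun k => h.dither.meas i k)
    (iIndepFun.prodMk_of_indepFun h.measX h.noise.meas h.indepX h.noise.indep h.indep_noise)
    (iIndepFun.curry h.dither.meas h.dither.indep) h.indepFun_data_dither

lemma indepFun_data_dither_row (h : IsModel P X ε U) (i : ℕ) :
    IndepFun (fun ω => (X i ω, ε i ω)) (fun ω k => U i k ω) P :=
  h.indepFun_data_dither.comp (measurable_pi_apply i) (measurable_pi_apply i)

variable [IsProbabilityMeasure P]

lemma indepFun_update (h : IsModel P X ε U) (i : ℕ) (a : Bit d) :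
    IndepFun (fun ω => ((X i ω, ε i ω), Function.update (fun k => U i k ω) a 0)) (U i a) P := by
  have hU : Measurable (fun ω k => U i k ω) := measurable_pi_lambda _ fun k => h.dither.meas i k
  have hup : Measurable (fun f : Bit d → ℝ => Function.update f a 0) := by
    refine measurable_pi_lambda _ fun k => ?_
    by_cases hk : k = a
    · subst hk; simp
    · simp only [Function.update_of_ne hk]; fun_prop
  refine IndepFun.prodMk_left_of_prodMk_right ((h.measX i).prodMk (h.noise.meas i))
    (hup.comp hU) (h.dither.meas i a) ?_ ?_
  · exact (h.indepFun_data_dither_row i).comp (φ := id)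
      (ψ := fun f => (Function.update f a 0, f a)) measurable_id
      (hup.prodMk (measurable_pi_apply a))
  · have hrow : iIndepFun (U i) P := h.dither.indep.precomp (g := fun k => (i, k))
      (fun a b hab => by simpa using hab)
    have h2 := hrow.indepFun_finset {a}ᶜ {a} disjoint_compl_left (h.dither.meas i)
    have e : (fun ω => Function.update (fun k => U i k ω) a 0) =
        (fun (f : ({a}ᶜ : Finset (Bit d)) → ℝ) (k : Bit d) =>
          if hk : k = a then (0 : ℝ) else f ⟨k, by simpa using hk⟩) ∘
        (fun ω (k : ({a}ᶜ : Finset (Bit d))) => U i k ω) := by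
      ext ω k
      by_cases hk : k = a
      · simp [hk]
      · simp [hk]
    rw [e]
    refine h2.comp (φ := _) (ψ := fun f : (({a} : Finset (Bit d)) → ℝ) => f ⟨a, by simp⟩) ?_
      (by fun_prop)
    refine measurable_pi_lambda _ fun k => ?_
    by_cases hk : k = a
    · simp [hk]
    · simp only [hk, dite_false]; fun_prop

lemma indepFun_noise (h : IsModel P X ε U) (i : ℕ) :
    IndepFun (fun ω => ((fun k => U i k ω), X i ω)) (ε i) P :=
  IndepFun.prodMk_left_of_prodMk_right (measurable_pi_lambda _ fun k => h.dither.meas i k)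
    (h.measX i) (h.noise.meas i) (h.indepFun_data_dither_row i).symm
    (h.indep_noise.comp (measurable_pi_apply i) (measurable_pi_apply i))

variable (θ : Params d)

/-- Averaging over the dither of one quantizer. -/
lemma integral_mul_quant (h : IsModel P X ε U) (hR : 0 ≤ θ.R) (hL : 0 ≤ θ.L) (i : ℕ) (a : Bit d)
    {v : Obs d → ℝ} (hv : Measurable v) {B : ℝ} (hB : ∀ o, |v o| ≤ B)
    (hva : ∀ o : Obs d, v (o.1, Function.update o.2 a 0) = v o) :
    ∫ ω, v (obs X ε U i ω) * θ.quant a (obs X ε U i ω) ∂P =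
      ∫ ω, v (obs X ε U i ω) * θ.clipped a (obs X ε U i ω) ∂P := by
  have hobs := h.measurable_obs i
  have hind := (h.indepFun_update i a).comp
    (φ := fun o : Obs d => (v o, θ.target a o.1)) (ψ := id)
    (hv.prodMk ((θ.measurable_target a).comp measurable_fst)) measurable_id
  have e : ((fun o : Obs d => (v o, θ.target a o.1)) ∘
      fun ω => ((X i ω, ε i ω), Function.update (fun k => U i k ω) a 0)) =
      fun ω => (v (obs X ε U i ω), θ.target a (X i ω, ε i ω)) := by
    ext1 ω
    simp only [Function.comp]
    rw [← hva (obs X ε U i ω)]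
    rfl
  rw [e] at hind
  exact integral_mul_dithered (θ.lo_le_hi hR hL a) (hv.comp hobs)
    ((θ.measurable_target a).comp ((h.measX i).prodMk (h.noise.meas i))) (h.dither.meas i a)
    (Integrable.of_bound (hv.comp hobs).aestronglyMeasurable B (ae_of_all _ fun ω => hB _))
    (h.dither.unif i a) hind

/-- Averaging over the dithers of two different quantizers. -/
lemma integral_mul_quant_mul_quant (h : IsModel P X ε U) (hR : 0 ≤ θ.R) (hL : 0 ≤ θ.L) (i : ℕ)
    {a b : Bit d} (hab : a ≠ b) {v : Obs d → ℝ} (hv : Measurable v) {B : ℝ} (hB : ∀ o, |v o| ≤ B)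
    (hva : ∀ o : Obs d, v (o.1, Function.update o.2 a 0) = v o)
    (hvb : ∀ o : Obs d, v (o.1, Function.update o.2 b 0) = v o) :
    ∫ ω, v (obs X ε U i ω) * θ.quant a (obs X ε U i ω) * θ.quant b (obs X ε U i ω) ∂P =
      ∫ ω, v (obs X ε U i ω) * θ.clipped a (obs X ε U i ω) * θ.clipped b (obs X ε U i ω) ∂P := by
  have hB0 : 0 ≤ B := (abs_nonneg _).trans (hB 0)
  have h1 := h.integral_mul_quant θ hR hL i b (v := fun o => v o * θ.quant a o)
    (hv.mul (θ.measurable_quant a)) (B := B * (|θ.lo a| + |θ.hi a|))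
    (fun o => by rw [abs_mul]; exact mul_le_mul (hB o) (θ.abs_quant_le a o) (abs_nonneg _) hB0)
    (fun o => by rw [hvb, θ.quant_update_of_ne hab])
  have h2 := h.integral_mul_quant θ hR hL i a (v := fun o => v o * θ.clipped b o)
    (hv.mul (θ.measurable_clipped b)) (B := B * (|θ.lo b| + |θ.hi b|))
    (fun o => by
      rw [abs_mul]; exact mul_le_mul (hB o) (θ.abs_clipped_le hR hL b o) (abs_nonneg _) hB0)
    (fun o => by rw [hva]; rfl)
  rw [h1]
  calc _ = ∫ ω, v (obs X ε U i ω) * θ.clipped b (obs X ε U i ω) * θ.quant a (obs X ε U i ω) ∂P := by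
        congr 1; ext ω; ring
    _ = _ := by rw [h2]; congr 1; ext ω; ring

lemma integrable_of_bound (h : IsModel P X ε U) (i : ℕ) {v : Obs d → ℝ} (hv : Measurable v) {B : ℝ}
    (hB : ∀ o, |v o| ≤ B) : Integrable (fun ω => v (obs X ε U i ω)) P :=
  Integrable.of_bound (hv.comp (h.measurable_obs i)).aestronglyMeasurable B
    (ae_of_all _ fun _ => hB _)

lemma integrable_quant_mul_quant (h : IsModel P X ε U) (i : ℕ) (a b : Bit d) :
    Integrable (fun ω => θ.quant a (obs X ε U i ω) * θ.quant b (obs X ε U i ω)) P :=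
  h.integrable_of_bound i (v := fun o => θ.quant a o * θ.quant b o)
    ((θ.measurable_quant a).mul (θ.measurable_quant b))
    (B := (|θ.lo a| + |θ.hi a|) * (|θ.lo b| + |θ.hi b|)) fun o => by
      rw [abs_mul]
      exact mul_le_mul (θ.abs_quant_le a o) (θ.abs_quant_le b o) (abs_nonneg _) (by positivity)

lemma integrable_clipped_mul_clipped (h : IsModel P X ε U) (hR : 0 ≤ θ.R) (hL : 0 ≤ θ.L) (i : ℕ)
    (a b : Bit d) :
    Integrable (fun ω => θ.clipped a (obs X ε U i ω) * θ.clipped b (obs X ε U i ω)) P :=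
  h.integrable_of_bound i (v := fun o => θ.clipped a o * θ.clipped b o)
    ((θ.measurable_clipped a).mul (θ.measurable_clipped b))
    (B := (|θ.lo a| + |θ.hi a|) * (|θ.lo b| + |θ.hi b|)) fun o => by
      rw [abs_mul]
      exact mul_le_mul (θ.abs_clipped_le hR hL a o) (θ.abs_clipped_le hR hL b o)
        (abs_nonneg _) (by positivity)

lemma integral_gram (h : IsModel P X ε U) (hR : 0 ≤ θ.R) (hL : 0 ≤ θ.L) (i : ℕ) (j k : Fin d) :
    ∫ ω, θ.gram (obs X ε U i ω) j k ∂P =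
      ∫ ω, θ.clipped (.inl j) (obs X ε U i ω) * θ.clipped (.inl k) (obs X ε U i ω) ∂P := by
  unfold Params.gram
  by_cases hjk : j = k
  · subst hjk
    have h1 := h.integral_mul_quant θ hR hL i (.inr (.inl j)) (v := fun _ => 1) measurable_const
      (B := 1) (by simp) (by simp)
    simp only [one_mul] at h1
    simp only [if_true]
    rw [h1]
    congr 1; ext ω
    rw [← sq]
    exact clip_sq hR _
  · simp only [if_neg hjk]
    have h1 := h.integral_mul_quant_mul_quant θ hR hL i (a := .inl j) (b := .inl k)
      (by simpa using hjk) (v := fun _ => 1) measurable_const (B := 1) (by simp) (by simp) (by simp)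
    simpa only [one_mul] using h1

lemma integral_score (h : IsModel P X ε U) (hR : 0 ≤ θ.R) (hL : 0 ≤ θ.L) (i : ℕ) (j : Fin d) :
    ∫ ω, θ.score (obs X ε U i ω) j ∂P =
      ∫ ω, θ.clipped (.inl j) (obs X ε U i ω) * (θ.clipped (.inr (.inr ())) (obs X ε U i ω)
        - ∑ l, θ.clipped (.inl l) (obs X ε U i ω) * θ.β l) ∂P := by
  unfold Params.score
  have hq := h.integrable_quant_mul_quant θ i
  have hc := h.integrable_clipped_mul_clipped θ hR hL i
  have hg : ∀ l, Integrable (fun ω => θ.gram (obs X ε U i ω) j l * θ.β l) P := fun l =>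
    (h.integrable_of_bound i (θ.measurable_gram j l) (fun o => θ.abs_gram_le o j l)).mul_const _
  rw [integral_sub (hq _ _) (integrable_finsetSum _ fun l _ => hg l),
    integral_finsetSum _ fun l _ => hg l]
  have h1 := h.integral_mul_quant_mul_quant θ hR hL i (a := .inr (.inr ())) (b := .inl j)
      (by simp) (v := fun _ => 1) measurable_const (B := 1) (by simp) (by simp) (by simp)
  simp only [one_mul] at h1
  rw [h1]
  simp_rw [integral_mul_const, h.integral_gram θ hR hL, ← integral_mul_const]
  rw [← integral_finsetSum _ fun l _ => (hc (.inl j) (.inl l)).mul_const _, ← integral_sub (hc _ _)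
    (integrable_finsetSum _ fun l _ => (hc (.inl j) (.inl l)).mul_const _)]
  congr 1; ext ω
  rw [mul_sub, Finset.mul_sum, mul_comm (θ.clipped (.inr (.inr ())) _)]
  congr 1
  refine Finset.sum_congr rfl fun l _ => by ring

end IsModel

/-! ### Positive definite matrices -/

section PosDef

variable {d : ℕ}

lemma dotProduct_self_eq_norm_sq (v : Fin d → ℝ) : v ⬝ᵥ v = ‖(WithLp.toLp 2 v : Vec d)‖ ^ 2 := by
  rw [EuclideanSpace.norm_sq_eq, dotProduct]
  refine Finset.sum_congr rfl fun i _ => ?_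
  rw [Real.norm_eq_abs, sq_abs, sq]

lemma posDef_iff_real {A : Matrix (Fin d) (Fin d) ℝ} :
    A.PosDef ↔ A.IsHermitian ∧ ∀ v : Fin d → ℝ, v ≠ 0 → 0 < v ⬝ᵥ A *ᵥ v := by
  rw [Matrix.posDef_iff_dotProduct_mulVec]
  simp

lemma exists_coercive_of_posDef {A : Matrix (Fin d) (Fin d) ℝ} (hA : A.PosDef) :
    ∃ c : ℝ, 0 < c ∧ ∀ v : Fin d → ℝ, c * (v ⬝ᵥ v) ≤ v ⬝ᵥ A *ᵥ v := by
  set q : Vec d → ℝ := fun v => v.ofLp ⬝ᵥ A *ᵥ v.ofLp with hq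
  have hqc : Continuous q := by
    simp only [hq, dotProduct, Matrix.mulVec]
    fun_prop
  have hqs : ∀ (r : ℝ) (v : Vec d), q (r • v) = r ^ 2 * q v := by
    intro r v
    simp only [hq, WithLp.ofLp_smul, Matrix.mulVec_smul, dotProduct_smul, smul_dotProduct, smul_eq_mul]
    ring
  have key : ∃ c : ℝ, 0 < c ∧ ∀ v : Vec d, c * ‖v‖ ^ 2 ≤ q v := by
    rcases (Metric.sphere (0 : Vec d) 1).eq_empty_or_nonempty with he | hne
    · refine ⟨1, one_pos, fun v => ?_⟩
      have hv : v = 0 := by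
        by_contra hv
        have : (‖v‖⁻¹ • v) ∈ Metric.sphere (0 : Vec d) 1 := by
          rw [mem_sphere_zero_iff_norm, norm_smul, norm_inv, norm_norm,
            inv_mul_cancel₀ (norm_ne_zero_iff.2 hv)]
        rw [he] at this
        exact this
      simp [hv, hq]
    · obtain ⟨w, hw, hmin⟩ := (isCompact_sphere (0 : Vec d) 1).exists_isMinOn hne hqc.continuousOn
      have hw0 : w.ofLp ≠ 0 := by
        intro h
        have : w = 0 := by ext i; simp [h]
        rw [this] at hw
        simp at hw
      refine ⟨q w, (posDef_iff_real.1 hA).2 _ hw0, fun v => ?_⟩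
      by_cases hv : v = 0
      · simp [hv, hq]
      have hn : ‖v‖ ≠ 0 := norm_ne_zero_iff.2 hv
      have hm : (‖v‖⁻¹ • v) ∈ Metric.sphere (0 : Vec d) 1 := by
        rw [mem_sphere_zero_iff_norm, norm_smul, norm_inv, norm_norm, inv_mul_cancel₀ hn]
      have h1 : q w ≤ q (‖v‖⁻¹ • v) := hmin hm
      have h2 : q v = ‖v‖ ^ 2 * q (‖v‖⁻¹ • v) := by
        rw [hqs, ← mul_assoc, ← mul_pow, mul_inv_cancel₀ hn]; simp
      rw [h2, mul_comm]
      exact mul_le_mul_of_nonneg_left h1 (sq_nonneg _)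
  obtain ⟨c, hc, h⟩ := key
  refine ⟨c, hc, fun v => ?_⟩
  rw [dotProduct_self_eq_norm_sq]
  exact h (WithLp.toLp 2 v)

lemma abs_dotProduct_mulVec_le {A : Matrix (Fin d) (Fin d) ℝ} {δ : ℝ} (hA : ∀ j k, |A j k| ≤ δ)
    (v : Fin d → ℝ) : |v ⬝ᵥ A *ᵥ v| ≤ δ * d * (v ⬝ᵥ v) := by
  by_cases hd : IsEmpty (Fin d)
  · simp [dotProduct, Subsingleton.elim v 0]
  have hδ : 0 ≤ δ := by
    obtain ⟨j⟩ := not_isEmpty_iff.1 hd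
    exact (abs_nonneg _).trans (hA j j)
  have h1 : |v ⬝ᵥ A *ᵥ v| ≤ ∑ j, ∑ k, δ * (|v j| * |v k|) := by
    simp only [dotProduct, Matrix.mulVec, Finset.mul_sum]
    refine (Finset.abs_sum_le_sum_abs _ _).trans (Finset.sum_le_sum fun j _ => ?_)
    refine (Finset.abs_sum_le_sum_abs _ _).trans (Finset.sum_le_sum fun k _ => ?_)
    rw [abs_mul, abs_mul]
    calc |v j| * (|A j k| * |v k|) = |A j k| * (|v j| * |v k|) := by ring
      _ ≤ _ := mul_le_mul_of_nonneg_right (hA j k) (by positivity)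
  have h2 : ∑ j, ∑ k, δ * (|v j| * |v k|) = δ * (∑ j, |v j|) ^ 2 := by
    rw [sq, Finset.sum_mul_sum, Finset.mul_sum]
    simp_rw [Finset.mul_sum]
  have h3 : (∑ j, |v j|) ^ 2 ≤ d * ∑ j, |v j| ^ 2 := by
    simpa using sq_sum_le_card_mul_sum_sq (s := Finset.univ) (f := fun j => |v j|)
  have h4 : ∑ j, |v j| ^ 2 = v ⬝ᵥ v := by
    simp [dotProduct, sq]
  rw [h4] at h3
  calc _ ≤ δ * (∑ j, |v j|) ^ 2 := h1.trans h2.le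
    _ ≤ δ * (d * (v ⬝ᵥ v)) := mul_le_mul_of_nonneg_left h3 hδ
    _ = _ := by ring

lemma eventually_abs_sub_lt (A : Matrix (Fin d) (Fin d) ℝ) {δ : ℝ} (hδ : 0 < δ) :
    ∀ᶠ B in 𝓝 A, ∀ j k, |B j k - A j k| < δ := by
  refine eventually_all.2 fun j => eventually_all.2 fun k => ?_
  have hc : Continuous fun B : Matrix (Fin d) (Fin d) ℝ => |B j k - A j k| := by
    have : Continuous fun B : Matrix (Fin d) (Fin d) ℝ => B j k := continuous_id.matrix_elem j k
    fun_prop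
  have := hc.tendsto A
  simp only [sub_self, abs_zero] at this
  exact this.eventually_lt_const hδ

lemma eventually_coercive {A : Matrix (Fin d) (Fin d) ℝ} {c : ℝ} (hc : 0 < c)
    (hA : ∀ v : Fin d → ℝ, c * (v ⬝ᵥ v) ≤ v ⬝ᵥ A *ᵥ v) :
    ∀ᶠ B in 𝓝 A, ∀ v : Fin d → ℝ, c / 2 * (v ⬝ᵥ v) ≤ v ⬝ᵥ B *ᵥ v := by
  filter_upwards [eventually_abs_sub_lt A (δ := c / (2 * (d + 1))) (by positivity)] with B hB v
  have h1 := abs_dotProduct_mulVec_le (A := B - A) (δ := c / (2 * (d + 1)))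
    (fun j k => (hB j k).le) v
  rw [Matrix.sub_mulVec, dotProduct_sub] at h1
  have h0 : 0 ≤ v ⬝ᵥ v := by rw [dotProduct_self_eq_norm_sq]; positivity
  have h2 : c / (2 * (d + 1)) * d ≤ c / 2 := by
    rw [div_mul_eq_mul_div, div_le_div_iff₀ (by positivity) (by positivity)]
    nlinarith
  have h3 := mul_le_mul_of_nonneg_right h2 h0
  have h4 := neg_le_of_abs_le (h1.trans h3)
  have h5 := hA v
  linarith

lemma posDef_of_coercive {A : Matrix (Fin d) (Fin d) ℝ} (hs : A.IsHermitian) {c : ℝ} (hc : 0 < c)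
    (hA : ∀ v : Fin d → ℝ, c * (v ⬝ᵥ v) ≤ v ⬝ᵥ A *ᵥ v) : A.PosDef := by
  refine posDef_iff_real.2 ⟨hs, fun v hv => lt_of_lt_of_le ?_ (hA v)⟩
  have : 0 < v ⬝ᵥ v := by
    rw [dotProduct_self_eq_norm_sq]
    have : (WithLp.toLp 2 v : Vec d) ≠ 0 := by simpa using hv
    positivity
  positivity

lemma eventually_posDef {A : Matrix (Fin d) (Fin d) ℝ} (hA : A.PosDef) :
    ∀ᶠ B in 𝓝 A, B.IsHermitian → B.PosDef := by
  obtain ⟨c, hc, h⟩ := exists_coercive_of_posDef hA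
  filter_upwards [eventually_coercive hc h] with B hB hs
  exact posDef_of_coercive hs (half_pos hc) hB

lemma isUnit_det_of_posDef {A : Matrix (Fin d) (Fin d) ℝ} (hA : A.PosDef) : IsUnit A.det :=
  (Matrix.isUnit_iff_isUnit_det A).1 hA.isUnit

lemma eventually_abs_mul_inv_sub_one_lt {A : Matrix (Fin d) (Fin d) ℝ} (hA : IsUnit A.det) {δ : ℝ}
    (hδ : 0 < δ) : ∀ᶠ B in 𝓝 A, ∀ j k, |(A * B⁻¹ - 1) j k| < δ := by
  have hinv : ContinuousAt Inv.inv A := by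
    refine continuousAt_matrix_inv A ?_
    rw [Ring.inverse_eq_inv']
    exact continuousAt_inv₀ hA.ne_zero
  have h1 : Tendsto (fun B => A * B⁻¹) (𝓝 A) (𝓝 (A * A⁻¹)) := tendsto_const_nhds.mul hinv.tendsto
  rw [Matrix.mul_nonsing_inv _ hA] at h1
  exact h1.eventually (eventually_abs_sub_lt 1 hδ)

end PosDef

/-! ### The estimator and its normal equation -/

section Estimator

variable {d : ℕ} {Ω : Type*}

lemma gram_isHermitian (S : Scheme d Ω) (i : ℕ) (ω : Ω) : (S.Gram i ω).IsHermitian := by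
  refine Matrix.IsHermitian.add ?_ (Matrix.isHermitian_diagonal _)
  refine Matrix.IsHermitian.ext fun j k => ?_
  simp [Matrix.vecMulVec_apply, mul_comm]

lemma sigmaHat_isHermitian (S : Scheme d Ω) (n : ℕ) (ω : Ω) : (S.SigmaHat n ω).IsHermitian := by
  unfold Scheme.SigmaHat
  rw [Matrix.IsHermitian, Matrix.conjTranspose_smul, Matrix.conjTranspose_sum,
    star_trivial]
  simp_rw [(gram_isHermitian S _ ω).eq]

lemma sigmaXyHat_sub (S : Scheme d Ω) (β : Vec d) (n : ℕ) (ω : Ω) :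
    S.SigmaXyHat n ω - S.SigmaHat n ω *ᵥ β.ofLp =
      (n : ℝ)⁻¹ • ∑ i ∈ Finset.range n, S.score β i ω := by
  unfold Scheme.SigmaXyHat Scheme.SigmaHat Scheme.score
  rw [Matrix.smul_mulVec, Matrix.sum_mulVec, ← smul_sub, ← Finset.sum_sub_distrib]

lemma objective_lt (S : Scheme d Ω) (n : ℕ) (ω : Ω) (hS : (S.SigmaHat n ω).PosDef) {b : Vec d}
    (hb : S.SigmaHat n ω *ᵥ b.ofLp = S.SigmaXyHat n ω) (c : Vec d) (hc : c ≠ b) :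
    S.objective n ω b < S.objective n ω c := by
  have hne : c.ofLp - b.ofLp ≠ 0 := by
    rw [sub_ne_zero]
    intro h
    exact hc (by ext i; rw [h])
  have hpos := (posDef_iff_real.1 hS).2 _ hne
  unfold Scheme.objective
  rw [← hb]
  set A := S.SigmaHat n ω
  have hsym : b.ofLp ⬝ᵥ A *ᵥ c.ofLp = c.ofLp ⬝ᵥ A *ᵥ b.ofLp := by
    have hT : Aᵀ = A := by simpa using hS.isHermitian.eq
    rw [Matrix.dotProduct_mulVec, ← Matrix.mulVec_transpose, hT, dotProduct_comm]
  rw [Matrix.mulVec_sub, sub_dotProduct, dotProduct_sub, dotProduct_sub, hsym] at hpos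
  linarith

/-- On the event that the plug-in covariance is positive definite, the estimation error is a linear
image of the average score. -/
lemma estimator_sub_eq [MeasurableSpace Ω] {P : Measure Ω} {S : Scheme d Ω} {n : ℕ}
    {bhat : Ω → Vec d} (h : S.IsEstimator P n bhat) (β : Vec d) :
    ∀ᵐ ω ∂P, (S.SigmaHat n ω).PosDef → (bhat ω - β).ofLp =
      (S.SigmaHat n ω)⁻¹ *ᵥ ((n : ℝ)⁻¹ • ∑ i ∈ Finset.range n, S.score β i ω) := by
  filter_upwards [h.2] with ω hω hS
  have hu := isUnit_det_of_posDef hS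
  have h1 := hω (WithLp.toLp 2 ((S.SigmaHat n ω)⁻¹ *ᵥ S.SigmaXyHat n ω))
    (objective_lt S n ω hS (by
      simp only [Matrix.mulVec_mulVec, Matrix.mul_nonsing_inv _ hu, Matrix.one_mulVec]))
  rw [h1, ← sigmaXyHat_sub, Matrix.mulVec_sub, Matrix.mulVec_mulVec, Matrix.nonsing_inv_mul _ hu,
    Matrix.one_mulVec]
  rfl

end Estimator

/-! ### Law of large numbers for the plug-in covariance -/

section LLN

variable {d : ℕ} {Ω : Type*} [MeasurableSpace Ω] {P : Measure Ω} [IsProbabilityMeasure P]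

lemma tendsto_measure_abs_mean_sub_ge {Z : ℕ → ℕ → Ω → ℝ} {ρ : ℕ → ℝ} {μ δ : ℝ}
    (hZ : ∀ n i, Measurable (Z n i)) (hind : ∀ n, iIndepFun (Z n) P)
    (hb : ∀ n i ω, |Z n i ω| ≤ ρ n) (hρ : Tendsto (fun n : ℕ => ρ n ^ 2 / n) atTop (𝓝 0))
    (hmean : Tendsto (fun n : ℕ => (n : ℝ)⁻¹ * ∑ i ∈ Finset.range n, ∫ ω, Z n i ω ∂P) atTop (𝓝 μ))
    (hδ : 0 < δ) :
    Tendsto (fun n : ℕ => P {ω | δ ≤ |(n : ℝ)⁻¹ * ∑ i ∈ Finset.range n, Z n i ω - μ|})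
      atTop (𝓝 0) := by
  have hlim : Tendsto (fun n : ℕ => ENNReal.ofReal (ρ n ^ 2 / n / (δ / 2) ^ 2)) atTop (𝓝 0) := by
    have := (ENNReal.continuous_ofReal.tendsto _).comp (hρ.div_const ((δ / 2) ^ 2))
    simpa [Function.comp_def] using this
  refine tendsto_of_tendsto_of_tendsto_of_le_of_le' tendsto_const_nhds hlim
    (Eventually.of_forall fun _ => zero_le) ?_
  have hev := (Metric.tendsto_nhds.1 hmean) (δ / 2) (half_pos hδ)
  filter_upwards [hev, eventually_gt_atTop 0] with n hn hn0
  have hn0' : (0 : ℝ) < n := by exact_mod_cast hn0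
  have hL2 : ∀ i, MemLp (Z n i) 2 P := fun i => MemLp.of_bound (hZ n i).aestronglyMeasurable (ρ n)
    (ae_of_all _ fun ω => hb n i ω)
  have hint : ∀ i, Integrable (Z n i) P := fun i => (hL2 i).integrable (by norm_num)
  set W : Ω → ℝ := fun ω => (n : ℝ)⁻¹ * ∑ i ∈ Finset.range n, Z n i ω with hW
  have hWL2 : MemLp W 2 P := (memLp_finsetSum _ fun i _ => hL2 i).const_mul _
  have hWm : ∫ ω, W ω ∂P = (n : ℝ)⁻¹ * ∑ i ∈ Finset.range n, ∫ ω, Z n i ω ∂P := by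
    rw [hW, integral_const_mul, integral_finsetSum _ fun i _ => hint i]
  have hvar : variance W P ≤ ρ n ^ 2 / n := by
    have e : W = fun ω => (n : ℝ)⁻¹ * (∑ i ∈ Finset.range n, Z n i) ω := by
      ext ω; simp [hW]
    rw [e, variance_const_mul, IndepFun.variance_sum (fun i _ => hL2 i)
      (fun i _ j _ hij => (hind n).indepFun hij)]
    have hv : ∀ i ∈ Finset.range n, variance (Z n i) P ≤ ρ n ^ 2 := by
      intro i _
      have := variance_le_sq_of_bounded (μ := P) (X := Z n i) (a := -ρ n) (b := ρ n)
        (ae_of_all _ fun ω => abs_le.1 (hb n i ω)) (hZ n i).aemeasurable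
      calc _ ≤ _ := this
        _ = _ := by ring
    have h2 := Finset.sum_le_sum hv
    rw [Finset.sum_const, Finset.card_range, nsmul_eq_mul] at h2
    calc (n : ℝ)⁻¹ ^ 2 * ∑ i ∈ Finset.range n, variance (Z n i) P
        ≤ (n : ℝ)⁻¹ ^ 2 * (n * ρ n ^ 2) := by gcongr
      _ = _ := by field_simp
  refine le_trans (measure_mono ?_) ((meas_ge_le_variance_div_sq hWL2 (half_pos hδ)).trans
    (ENNReal.ofReal_le_ofReal (by gcongr)))
  intro ω hω
  simp only [Set.mem_ofPred_eq] at hω ⊢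
  rw [Real.dist_eq] at hn
  rw [hWm]
  have := abs_sub_le (W ω) ((n : ℝ)⁻¹ * ∑ i ∈ Finset.range n, ∫ ω, Z n i ω ∂P) μ
  have h3 : δ ≤ |W ω - μ| := hω
  linarith

/-- The plug-in covariance matrices concentrate on every neighbourhood of the limit of their
means. -/
lemma tendsto_measure_sigmaHat_notMem {S : ℕ → Scheme d Ω} {ρ : ℕ → ℝ}
    {Sig : Matrix (Fin d) (Fin d) ℝ}
    (hm : ∀ n i j k, Measurable fun ω => (S n).Gram i ω j k)
    (hind : ∀ n j k, iIndepFun (fun i ω => (S n).Gram i ω j k) P)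
    (hb : ∀ n i ω j k, |(S n).Gram i ω j k| ≤ ρ n)
    (hρ : Tendsto (fun n : ℕ => ρ n ^ 2 / n) atTop (𝓝 0))
    (hmean : ∀ j k, Tendsto (fun n : ℕ => (n : ℝ)⁻¹ *
      ∑ i ∈ Finset.range n, ∫ ω, (S n).Gram i ω j k ∂P) atTop (𝓝 (Sig j k)))
    {p : Matrix (Fin d) (Fin d) ℝ → Prop} (hp : ∀ᶠ A in 𝓝 Sig, p A) :
    Tendsto (fun n => P {ω | ¬ p ((S n).SigmaHat n ω)}) atTop (𝓝 0) := by
  obtain ⟨δ, hδ, hδp⟩ : ∃ δ > 0, ∀ A : Matrix (Fin d) (Fin d) ℝ,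
      (∀ j k, |A j k - Sig j k| < δ) → p A := by
    obtain ⟨δ, hδ, h⟩ := (@Metric.eventually_nhds_iff (Fin d → Fin d → ℝ) _ Sig p).1 hp
    exact ⟨δ, hδ, fun A hA => h ((dist_pi_lt_iff hδ).2 fun j => (dist_pi_lt_iff hδ).2 fun k => hA j k)⟩
  have hent : ∀ j k, Tendsto (fun n : ℕ => P {ω | δ ≤ |(S n).SigmaHat n ω j k - Sig j k|})
      atTop (𝓝 0) := by
    intro j k
    have := tendsto_measure_abs_mean_sub_ge (Z := fun n i ω => (S n).Gram i ω j k)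
      (fun n i => hm n i j k) (fun n => hind n j k) (fun n i ω => hb n i ω j k) hρ (hmean j k) hδ
    refine this.congr fun n => ?_
    simp only [Scheme.SigmaHat, Matrix.smul_apply, Matrix.sum_apply, smul_eq_mul]
  have hsum : Tendsto (fun n : ℕ => ∑ j, ∑ k, P {ω | δ ≤ |(S n).SigmaHat n ω j k - Sig j k|})
      atTop (𝓝 0) := by
    have := tendsto_finsetSum Finset.univ fun j _ => tendsto_finsetSum Finset.univ fun k _ =>
      hent j k
    simpa using this
  refine tendsto_of_tendsto_of_tendsto_of_le_of_le tendsto_const_nhds hsum (fun _ => zero_le)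
    fun n => ?_
  calc P {ω | ¬ p ((S n).SigmaHat n ω)}
      ≤ P (⋃ j, ⋃ k, {ω | δ ≤ |(S n).SigmaHat n ω j k - Sig j k|}) := by
        refine measure_mono fun ω hω => ?_
        by_contra hcon
        simp only [Set.mem_iUnion, Set.mem_ofPred_eq, not_exists, not_le] at hcon
        exact hω (hδp _ hcon)
    _ ≤ ∑ j, P (⋃ k, {ω | δ ≤ |(S n).SigmaHat n ω j k - Sig j k|}) := measure_iUnion_fintype_le _ _
    _ ≤ _ := Finset.sum_le_sum fun j _ => measure_iUnion_fintype_le _ _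

end LLN

/-! ### From averages of scores to the estimator -/

section Assembly

variable {d : ℕ}

lemma continuous_matVec (A : Matrix (Fin d) (Fin d) ℝ) : Continuous (matVec A) := by
  unfold matVec
  refine (PiLp.continuous_toLp 2 _).comp ?_
  exact continuous_const.matrix_mulVec (PiLp.continuous_ofLp 2 _)

lemma norm_toLp_le {v : Fin d → ℝ} {b : ℝ} (h : ∀ j, |v j| ≤ b) :
    ‖(WithLp.toLp 2 v : Vec d)‖ ≤ √(d * b ^ 2) := by
  refine Real.le_sqrt_of_sq_le ?_
  rw [EuclideanSpace.norm_sq_eq]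
  calc ∑ j, ‖(WithLp.toLp 2 v : Vec d) j‖ ^ 2 ≤ ∑ _j : Fin d, b ^ 2 := by
        refine Finset.sum_le_sum fun j _ => ?_
        rw [Real.norm_eq_abs]
        exact pow_le_pow_left₀ (abs_nonneg _) (h j) 2
    _ = _ := by simp

lemma abs_dotProduct_le {v t : Fin d → ℝ} {b : ℝ} (h : ∀ j, |v j| ≤ b) :
    |t ⬝ᵥ v| ≤ (∑ j, |t j|) * b := by
  rw [dotProduct, Finset.sum_mul]
  refine (Finset.abs_sum_le_sum_abs _ _).trans (Finset.sum_le_sum fun j _ => ?_)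
  rw [abs_mul]
  exact mul_le_mul_of_nonneg_left (h j) (abs_nonneg _)

variable {Ω : Type*} [MeasurableSpace Ω]

lemma measurable_det {A : Ω → Matrix (Fin d) (Fin d) ℝ}
    (hA : ∀ j k, Measurable fun ω => A ω j k) : Measurable fun ω => (A ω).det := by
  simp only [Matrix.det_apply]
  refine Finset.measurable_fun_sum _ fun σ _ => ?_
  refine Measurable.const_smul ?_ _
  exact Finset.measurable_fun_prod _ fun i _ => hA _ _

lemma measurable_inv_apply {A : Ω → Matrix (Fin d) (Fin d) ℝ}
    (hA : ∀ j k, Measurable fun ω => A ω j k) (j k : Fin d) : Measurable fun ω => (A ω)⁻¹ j k := by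
  simp only [Matrix.inv_def, Matrix.smul_apply, Ring.inverse_eq_inv', smul_eq_mul,
    Matrix.adjugate_apply]
  refine (measurable_det hA).inv.mul (measurable_det fun a b => ?_)
  by_cases h : a = k
  · subst h; simp
  · simp only [Matrix.updateRow_ne h]; exact hA a b

lemma measurable_mul_apply {A B : Ω → Matrix (Fin d) (Fin d) ℝ}
    (hA : ∀ j k, Measurable fun ω => A ω j k) (hB : ∀ j k, Measurable fun ω => B ω j k)
    (j k : Fin d) : Measurable fun ω => (A ω * B ω) j k := by
  simp only [Matrix.mul_apply]
  exact Finset.measurable_fun_sum _ fun l _ => (hA j l).mul (hB l k)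

variable {P : Measure Ω}

lemma tendstoInMeasure_const_zero {E : Type*} [SeminormedAddCommGroup E] {m : ℕ → E}
    (hm : Tendsto m atTop (𝓝 0)) : TendstoInMeasure P (fun n (_ : Ω) => m n) atTop 0 := by
  rw [tendstoInMeasure_iff_norm]
  intro ε hε
  have h := (tendsto_zero_iff_norm_tendsto_zero.1 hm).eventually_lt_const hε
  refine tendsto_const_nhds.congr' ?_
  filter_upwards [h] with n hn
  have : {ω : Ω | ε ≤ ‖m n - (0 : Ω → E) ω‖} = ∅ := by
    ext ω
    simp only [Pi.zero_apply, sub_zero, Set.mem_ofPred_eq, Set.mem_empty_iff_false, iff_false,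
      not_le]
    exact hn
  rw [this, measure_empty]

variable [IsProbabilityMeasure P]

/-- Central limit theorem for row-wise independent bounded vectors with asymptotically negligible
means. -/
lemma tendstoInDistribution_row_sum_of_mean {s : ℕ → ℕ → Ω → Fin d → ℝ}
    {Γ : Matrix (Fin d) (Fin d) ℝ} {μ : ℕ → ℝ} {B : ℝ}
    (hsm : ∀ n i, Measurable (s n i)) (hsind : ∀ n, iIndepFun (s n) P) (hΓ : Γ.PosSemidef)
    (hsb : ∀ᶠ n in atTop, ∀ i < n, ∀ ω j, |s n i ω j| ≤ B)
    (hmean : ∀ᶠ n in atTop, ∀ i < n, ∀ j, |∫ ω, s n i ω j ∂P| ≤ μ n)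
    (hμ : Tendsto (fun n : ℕ => √(n : ℝ) * μ n) atTop (𝓝 0))
    (hcov : ∀ t : Fin d → ℝ, Tendsto (fun n : ℕ => (n : ℝ)⁻¹ *
      ∑ i ∈ Finset.range n, ∫ ω, (t ⬝ᵥ s n i ω) ^ 2 ∂P) atTop (𝓝 (t ⬝ᵥ Γ *ᵥ t))) :
    TendstoInDistribution
      (fun (n : ℕ) ω => (√(n : ℝ))⁻¹ • ∑ i ∈ Finset.range n, (WithLp.toLp 2 (s n i ω) : Vec d))
      atTop id (fun _ => P) (multivariateGaussian 0 Γ) := by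
  set m : ℕ → ℕ → Fin d → ℝ := fun n i j => ∫ ω, s n i ω j ∂P with hm
  have hsmj : ∀ n i j, Measurable fun ω => s n i ω j := fun n i j =>
    (measurable_pi_apply j).comp (hsm n i)
  have hμ0 : Tendsto μ atTop (𝓝 0) := by
    refine squeeze_zero_norm' ?_ (by simpa using hμ.norm)
    filter_upwards [eventually_gt_atTop 0] with n hn
    have h1 : 1 ≤ √(n : ℝ) := by
      rw [Real.one_le_sqrt]; exact_mod_cast hn
    rw [abs_of_nonneg (Real.sqrt_nonneg _)]
    exact le_mul_of_one_le_left (norm_nonneg _) h1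
  have hsum : ∀ v : Vec d, ∀ t : Vec d, inner ℝ v t = t.ofLp ⬝ᵥ v.ofLp := by
    intro v t
    simp [PiLp.inner_apply, dotProduct]
  have hclt := tendstoInDistribution_row_sum (P := P)
    (ξ := fun n i ω => (WithLp.toLp 2 (s n i ω - m n i) : Vec d)) (B := √(d * (2 * B) ^ 2)) (Γ := Γ)
    (fun n i => by
      have := hsm n i
      exact (WithLp.measurable_toLp 2 _).comp (this.sub_const _))
    (fun n => (hsind n).comp (fun i v => (WithLp.toLp 2 (v - m n i) : Vec d)) (fun i =>
      (WithLp.measurable_toLp 2 _).comp (measurable_id.sub_const _))) hΓ ?_ ?_ ?_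
  · refine tendstoInDistribution_of_tendstoInMeasure_sub _ _ hclt ?_ ?_
    · have e : ((fun (n : ℕ) ω => (√(n : ℝ))⁻¹ •
          ∑ i ∈ Finset.range n, (WithLp.toLp 2 (s n i ω) : Vec d)) -
          fun (n : ℕ) ω => (√(n : ℝ))⁻¹ •
          ∑ i ∈ Finset.range n, (WithLp.toLp 2 (s n i ω - m n i) : Vec d)) =
          fun (n : ℕ) (_ : Ω) => (√(n : ℝ))⁻¹ •
            ∑ i ∈ Finset.range n, (WithLp.toLp 2 (m n i) : Vec d) := by
        ext1 n; ext1 ω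
        simp only [Pi.sub_apply]
        rw [← smul_sub, ← Finset.sum_sub_distrib]
        congr 1
        refine Finset.sum_congr rfl fun i _ => ?_
        rw [← WithLp.toLp_sub, sub_sub_cancel]
      rw [e]
      refine tendstoInMeasure_const_zero ?_
      refine squeeze_zero_norm' (a := fun n : ℕ => √(d : ℝ) * |√(n : ℝ) * μ n|) ?_ ?_
      · filter_upwards [hmean, eventually_gt_atTop 0] with n hn hn0
        have hn0' : (0 : ℝ) < n := by exact_mod_cast hn0
        have hb : ∀ i ∈ Finset.range n, ‖(WithLp.toLp 2 (m n i) : Vec d)‖ ≤ √d * |μ n| := by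
          intro i hi
          refine (norm_toLp_le (hn i (Finset.mem_range.1 hi))).trans (le_of_eq ?_)
          rw [Real.sqrt_mul (by positivity), Real.sqrt_sq_eq_abs]
        rw [norm_smul, norm_inv, Real.norm_of_nonneg (Real.sqrt_nonneg _)]
        have h2 := (norm_sum_le _ _).trans (Finset.sum_le_sum hb)
        rw [Finset.sum_const, Finset.card_range, nsmul_eq_mul] at h2
        have h3 : (√(n : ℝ))⁻¹ * n = √n := by
          rw [inv_mul_eq_div, Real.div_sqrt]
        calc _ ≤ (√(n : ℝ))⁻¹ * (n * (√d * |μ n|)) := by gcongr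
          _ = ((√(n : ℝ))⁻¹ * n) * (√d * |μ n|) := by ring
          _ = _ := by rw [h3, abs_mul, abs_of_nonneg (Real.sqrt_nonneg (n : ℝ))]; ring
      · simpa using hμ.norm.const_mul (√(d : ℝ))
    · intro n
      have : Measurable fun ω => ∑ i ∈ Finset.range n, (WithLp.toLp 2 (s n i ω) : Vec d) :=
        Finset.measurable_fun_sum _ fun i _ => (WithLp.measurable_toLp 2 _).comp (hsm n i)
      exact ((measurable_const_smul (√(n : ℝ))⁻¹).comp this).aemeasurable
  · filter_upwards [hsb] with n hn i hi
    refine ae_of_all _ fun ω => norm_toLp_le fun j => ?_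
    have h1 : |m n i j| ≤ B := by
      have := norm_integral_le_of_norm_le_const (μ := P) (f := fun ω => s n i ω j) (C := B)
        (ae_of_all _ fun ω => hn i hi ω j)
      simpa using this
    calc |(s n i ω - m n i) j| ≤ |s n i ω j| + |m n i j| := abs_sub _ _
      _ ≤ 2 * B := by linarith [hn i hi ω j]
  · filter_upwards [hsb] with n hn i hi t
    have hint : ∀ j, Integrable (fun ω => s n i ω j) P := fun j =>
      Integrable.of_bound (hsmj n i j).aestronglyMeasurable B (ae_of_all _ fun ω => hn i hi ω j)
    simp_rw [hsum]
    simp only [dotProduct, Pi.sub_apply]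
    have hint' : ∀ j, Integrable (fun ω => t j * (s n i ω j - m n i j)) P := fun j =>
      ((hint j).sub (integrable_const _)).const_mul _
    rw [integral_finsetSum _ fun j _ => hint' j]
    refine Finset.sum_eq_zero fun j _ => ?_
    rw [integral_const_mul, integral_sub (hint j) (integrable_const _)]
    simp [hm]
  · intro t
    have h0 : Tendsto (fun n : ℕ => (n : ℝ)⁻¹ * ∑ i ∈ Finset.range n, (t.ofLp ⬝ᵥ m n i) ^ 2)
        atTop (𝓝 0) := by
      refine squeeze_zero' (g := fun n => ((∑ j, |t j|) * μ n) ^ 2)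
        (Eventually.of_forall fun n => by positivity) ?_ ?_
      · filter_upwards [hmean, eventually_gt_atTop 0] with n hn hn0
        have hn0' : (0 : ℝ) < n := by exact_mod_cast hn0
        have hb : ∀ i ∈ Finset.range n, (t.ofLp ⬝ᵥ m n i) ^ 2 ≤ ((∑ j, |t j|) * μ n) ^ 2 := by
          intro i hi
          have := abs_dotProduct_le (t := t.ofLp) (hn i (Finset.mem_range.1 hi))
          rw [← sq_abs]
          exact pow_le_pow_left₀ (abs_nonneg _) this 2
        have h2 := Finset.sum_le_sum hb
        rw [Finset.sum_const, Finset.card_range, nsmul_eq_mul] at h2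
        rw [inv_mul_le_iff₀ hn0']
        exact h2
      · simpa using (hμ0.const_mul (∑ j, |t j|)).pow 2
    have h1 := (hcov t.ofLp).sub h0
    rw [sub_zero] at h1
    refine h1.congr' ?_
    filter_upwards [hsb] with n hn
    rw [← mul_sub, ← Finset.sum_sub_distrib]
    congr 1
    refine Finset.sum_congr rfl fun i hi => ?_
    have hi := Finset.mem_range.1 hi
    have hint : ∀ j, Integrable (fun ω => s n i ω j) P := fun j =>
      Integrable.of_bound (hsmj n i j).aestronglyMeasurable B (ae_of_all _ fun ω => hn i hi ω j)
    simp_rw [hsum]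
    set c := t.ofLp ⬝ᵥ m n i with hc
    have hfm : Measurable fun ω => t.ofLp ⬝ᵥ s n i ω := by
      simp only [dotProduct]
      exact Finset.measurable_fun_sum _ fun j _ => (hsmj n i j).const_mul _
    have hfb : ∀ ω, |t.ofLp ⬝ᵥ s n i ω| ≤ (∑ j, |t j|) * B := fun ω => abs_dotProduct_le (hn i hi ω)
    have hfi : Integrable (fun ω => t.ofLp ⬝ᵥ s n i ω) P :=
      Integrable.of_bound hfm.aestronglyMeasurable _ (ae_of_all _ hfb)
    have hf2 : Integrable (fun ω => (t.ofLp ⬝ᵥ s n i ω) ^ 2) P :=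
      Integrable.of_bound (hfm.pow_const 2).aestronglyMeasurable (((∑ j, |t j|) * B) ^ 2)
        (ae_of_all _ fun ω => by
          rw [norm_pow]; exact pow_le_pow_left₀ (norm_nonneg _) (hfb ω) 2)
    have hEf : ∫ ω, t.ofLp ⬝ᵥ s n i ω ∂P = c := by
      simp only [dotProduct, hc, hm]
      rw [integral_finsetSum _ fun j _ => (hint j).const_mul _]
      simp_rw [integral_const_mul]
    have e : ∀ ω, (t.ofLp ⬝ᵥ (s n i ω - m n i)) ^ 2 =
        (t.ofLp ⬝ᵥ s n i ω) ^ 2 - 2 * c * (t.ofLp ⬝ᵥ s n i ω) + c ^ 2 := by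
      intro ω; rw [dotProduct_sub]; ring
    simp_rw [e]
    have hi1 : Integrable (fun ω => (t.ofLp ⬝ᵥ s n i ω) ^ 2 - 2 * c * (t.ofLp ⬝ᵥ s n i ω)) P :=
      hf2.sub (hfi.const_mul _)
    rw [integral_add hi1 (integrable_const _), integral_sub hf2 (hfi.const_mul _),
      integral_const_mul, hEf]
    simp
    ring

/-- If the normalized scores satisfy the central limit theorem and the plug-in covariances
converge, then the estimator is asymptotically normal. -/
theorem tendstoInDistribution_estimator {S : ℕ → Scheme d Ω} {bhat : ℕ → Ω → Vec d} {β : Vec d}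
    {Sig Γ : Matrix (Fin d) (Fin d) ℝ} {H : ℕ → Matrix (Fin d) (Fin d) ℝ} {ρ μ : ℕ → ℝ} {B κ : ℝ}
    (hest : ∀ n, (S n).IsEstimator P n (bhat n))
    (hGm : ∀ n i j k, Measurable fun ω => (S n).Gram i ω j k)
    (hGind : ∀ n j k, iIndepFun (fun i ω => (S n).Gram i ω j k) P)
    (hGb : ∀ n i ω j k, |(S n).Gram i ω j k| ≤ ρ n)
    (hρ : Tendsto (fun n : ℕ => ρ n ^ 2 / n) atTop (𝓝 0))
    (hGmean : ∀ j k, Tendsto (fun n : ℕ => (n : ℝ)⁻¹ *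
      ∑ i ∈ Finset.range n, ∫ ω, (S n).Gram i ω j k ∂P) atTop (𝓝 (Sig j k)))
    (hSig : Sig.PosDef)
    (hsm : ∀ n i, Measurable fun ω => (S n).score β i ω)
    (hsind : ∀ n, iIndepFun (fun i ω => (S n).score β i ω) P) (hΓ : Γ.PosSemidef)
    (hHu : ∀ᶠ n in atTop, IsUnit (H n).det)
    (hHκ : ∀ᶠ n in atTop, ∀ j a b k, |H n j a * (H n)⁻¹ b k| ≤ κ)
    (hsb : ∀ᶠ n in atTop, ∀ i < n, ∀ ω j, |(H n *ᵥ (S n).score β i ω) j| ≤ B)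
    (hmean : ∀ᶠ n in atTop, ∀ i < n, ∀ j, |∫ ω, (H n *ᵥ (S n).score β i ω) j ∂P| ≤ μ n)
    (hμ : Tendsto (fun n : ℕ => √(n : ℝ) * μ n) atTop (𝓝 0))
    (hcov : ∀ t : Fin d → ℝ, Tendsto (fun n : ℕ => (n : ℝ)⁻¹ *
      ∑ i ∈ Finset.range n, ∫ ω, (t ⬝ᵥ (H n *ᵥ (S n).score β i ω)) ^ 2 ∂P) atTop
      (𝓝 (t ⬝ᵥ Γ *ᵥ t))) :
    TendstoInDistribution (fun (n : ℕ) ω => √(n : ℝ) • matVec (H n * Sig) (bhat n ω - β)) atTop id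
      (fun _ => P) (multivariateGaussian 0 Γ) := by
  have hmulm : ∀ A : Matrix (Fin d) (Fin d) ℝ, Measurable fun v : Fin d → ℝ => A *ᵥ v := by
    intro A
    exact (continuous_const.matrix_mulVec continuous_id).measurable
  have hclt := tendstoInDistribution_row_sum_of_mean (P := P)
    (s := fun n i ω => H n *ᵥ (S n).score β i ω) (fun n i => (hmulm _).comp (hsm n i))
    (fun n => (hsind n).comp (fun _ v => H n *ᵥ v) fun _ => hmulm _) hΓ hsb hmean hμ hcov
  have hSu := isUnit_det_of_posDef hSig
  set M : ℕ → Ω → Fin d → Fin d → ℝ := fun n ω j k =>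
    (H n * (Sig * ((S n).SigmaHat n ω)⁻¹) * (H n)⁻¹) j k with hM
  set I : Fin d → Fin d → ℝ := fun j k => (1 : Matrix (Fin d) (Fin d) ℝ) j k with hI
  have hSm : ∀ n j k, Measurable fun ω => (S n).SigmaHat n ω j k := by
    intro n j k
    simp only [Scheme.SigmaHat, Matrix.smul_apply, Matrix.sum_apply, smul_eq_mul]
    exact (Finset.measurable_fun_sum _ fun i _ => hGm n i j k).const_mul _
  have hMm : ∀ n, Measurable (M n) := fun n =>
    measurable_pi_lambda _ fun j => measurable_pi_lambda _ fun k =>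
      measurable_mul_apply (A := fun ω => H n * (Sig * ((S n).SigmaHat n ω)⁻¹))
        (measurable_mul_apply (fun _ _ => measurable_const)
          (measurable_mul_apply (fun _ _ => measurable_const) (measurable_inv_apply (hSm n))))
        (B := fun _ => (H n)⁻¹) (fun _ _ => measurable_const) j k
  have hMlim : TendstoInMeasure P M atTop (fun _ => I) := by
    rw [tendstoInMeasure_iff_norm]
    intro ε hε
    set δ := ε / (2 * (|κ| * (d * d) + 1)) with hδ
    have hδ0 : 0 < δ := by positivity
    have hlim := tendsto_measure_sigmaHat_notMem hGm hGind hGb hρ hGmean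
      (eventually_abs_mul_inv_sub_one_lt hSu hδ0)
    refine tendsto_of_tendsto_of_tendsto_of_le_of_le' tendsto_const_nhds hlim
      (Eventually.of_forall fun _ => zero_le) ?_
    filter_upwards [hHu, hHκ] with n hnu hnκ
    refine measure_mono fun ω hω => ?_
    simp only [Set.mem_ofPred_eq] at hω ⊢
    intro hcon
    set N := Sig * ((S n).SigmaHat n ω)⁻¹ - 1 with hN
    have hMN : ∀ j k, M n ω j k - I j k = (H n * N * (H n)⁻¹) j k := by
      intro j k
      have : H n * N * (H n)⁻¹ = H n * (Sig * ((S n).SigmaHat n ω)⁻¹) * (H n)⁻¹ - 1 := by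
        rw [hN, Matrix.mul_sub, Matrix.sub_mul, Matrix.mul_one, Matrix.mul_nonsing_inv _ hnu]
      rw [this, Matrix.sub_apply]
    have hent : ∀ j k, |(H n * N * (H n)⁻¹) j k| ≤ |κ| * (d * d) * δ := by
      intro j k
      rw [Matrix.mul_apply]
      simp only [Matrix.mul_apply, Finset.sum_mul]
      have hb : ∀ b a, |H n j a * N a b * (H n)⁻¹ b k| ≤ |κ| * δ := by
        intro b a
        calc _ = |H n j a * (H n)⁻¹ b k| * |N a b| := by rw [← abs_mul]; congr 1; ring
          _ ≤ |κ| * δ := mul_le_mul ((hnκ j a b k).trans (le_abs_self _)) (hcon a b).le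
              (abs_nonneg _) (abs_nonneg _)
      calc _ ≤ ∑ b, |∑ a, H n j a * N a b * (H n)⁻¹ b k| := Finset.abs_sum_le_sum_abs _ _
        _ ≤ ∑ _b : Fin d, ∑ _a : Fin d, |κ| * δ := Finset.sum_le_sum fun b _ =>
            (Finset.abs_sum_le_sum_abs _ _).trans (Finset.sum_le_sum fun a _ => hb b a)
        _ = _ := by simp; ring
    have hlt : |κ| * (d * d) * δ < ε := by
      have h1 : (|κ| * (d * d) + 1) * δ = ε / 2 := by
        rw [hδ]; field_simp
      nlinarith
    have : ‖M n ω - I‖ < ε := by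
      refine (pi_norm_lt_iff hε).2 fun j => (pi_norm_lt_iff hε).2 fun k => ?_
      rw [Pi.sub_apply, Pi.sub_apply, hMN, Real.norm_eq_abs]
      exact (hent j k).trans_lt hlt
    exact absurd hω (not_le.2 this)
  have hg : Continuous fun p : Vec d × (Fin d → Fin d → ℝ) =>
      (WithLp.toLp 2 (Matrix.of p.2 *ᵥ p.1.ofLp) : Vec d) := by
    refine (PiLp.continuous_toLp 2 _).comp ?_
    refine Continuous.matrix_mulVec continuous_snd ((PiLp.continuous_ofLp 2 _).comp continuous_fst)
  have hsl := hclt.continuous_comp_prodMk_of_tendstoInMeasure_const hg hMlim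
    (fun n => (hMm n).aemeasurable)
  have hid : (fun ω : Vec d => (WithLp.toLp 2 (Matrix.of I *ᵥ (id ω).ofLp) : Vec d)) = id := by
    ext1 ω
    change WithLp.toLp 2 ((1 : Matrix (Fin d) (Fin d) ℝ) *ᵥ ω.ofLp) = ω
    rw [Matrix.one_mulVec]
  simp only at hsl
  rw [hid] at hsl
  refine tendstoInDistribution_of_tendstoInMeasure_sub _ _ hsl ?_ ?_
  · rw [tendstoInMeasure_iff_norm]
    intro ε hε
    have hlim := tendsto_measure_sigmaHat_notMem hGm hGind hGb hρ hGmean (eventually_posDef hSig)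
    refine tendsto_of_tendsto_of_tendsto_of_le_of_le' tendsto_const_nhds hlim
      (Eventually.of_forall fun _ => zero_le) ?_
    filter_upwards [hHu, eventually_gt_atTop 0] with n hnu hn0
    have hn0' : (0 : ℝ) < n := by exact_mod_cast hn0
    refine measure_mono_ae ?_
    filter_upwards [estimator_sub_eq (hest n) β] with ω hω hωε
    by_contra hcon
    have hpd := not_not.1 hcon (sigmaHat_isHermitian _ _ _)
    have heq : √(n : ℝ) • matVec (H n * Sig) (bhat n ω - β) =
        WithLp.toLp 2 (Matrix.of (M n ω) *ᵥ ((√(n : ℝ))⁻¹ •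
          ∑ i ∈ Finset.range n, (WithLp.toLp 2 (H n *ᵥ (S n).score β i ω) : Vec d)).ofLp) := by
      unfold matVec
      rw [hω hpd]
      have e1 : ((√(n : ℝ))⁻¹ • ∑ i ∈ Finset.range n,
          (WithLp.toLp 2 (H n *ᵥ (S n).score β i ω) : Vec d)).ofLp =
          (√(n : ℝ))⁻¹ • (H n *ᵥ ∑ i ∈ Finset.range n, (S n).score β i ω) := by
        rw [Matrix.mulVec_sum, WithLp.ofLp_smul, WithLp.ofLp_sum]
      rw [e1, ← WithLp.toLp_smul]
      congr 1
      change _ = (H n * (Sig * ((S n).SigmaHat n ω)⁻¹) * (H n)⁻¹) *ᵥ _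
      rw [Matrix.mulVec_smul, Matrix.mulVec_smul, Matrix.mulVec_smul, Matrix.mulVec_mulVec,
        Matrix.mulVec_mulVec, smul_smul]
      have e2 : H n * (Sig * ((S n).SigmaHat n ω)⁻¹) * (H n)⁻¹ * H n =
          H n * Sig * ((S n).SigmaHat n ω)⁻¹ := by
        rw [Matrix.mul_assoc _ _ (H n), Matrix.nonsing_inv_mul _ hnu, Matrix.mul_one,
          Matrix.mul_assoc]
      rw [e2]
      congr 1
      rw [← div_eq_mul_inv, Real.sqrt_div_self', one_div]
    have : (0 : ℝ) < 0 := by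
      refine lt_of_lt_of_le hε ?_
      have h3 : ε ≤ _ := hωε
      simp only [Pi.sub_apply, Pi.zero_apply, sub_zero] at h3
      rw [heq, sub_self, norm_zero] at h3
      exact h3
    exact lt_irrefl _ this
  · intro n
    exact (measurable_const_smul (√(n : ℝ))).comp_aemeasurable
      ((continuous_matVec _).measurable.comp_aemeasurable ((hest n).1.sub_const β))

end Assembly

section Gaussian

variable {d : ℕ}

/-- A linear image of a centered Gaussian measure. -/
lemma multivariateGaussian_map_matVec {Γ : Matrix (Fin d) (Fin d) ℝ} (hΓ : Γ.PosSemidef)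
    (A : Matrix (Fin d) (Fin d) ℝ) :
    (multivariateGaussian 0 Γ).map (matVec A) = multivariateGaussian 0 (A * Γ * Aᵀ) := by
  have hAm := (continuous_matVec A).measurable
  have hP := Measure.isProbabilityMeasure_map (μ := multivariateGaussian (0 : Vec d) Γ)
    hAm.aemeasurable
  have hΓA : (A * Γ * Aᵀ).PosSemidef := by
    have := hΓ.mul_mul_conjTranspose_same A
    rwa [Matrix.conjTranspose_eq_transpose_of_trivial] at this
  refine Measure.ext_of_charFun ?_
  ext t
  have e : charFun ((multivariateGaussian 0 Γ).map (matVec A)) t =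
      charFun (multivariateGaussian 0 Γ) (matVec Aᵀ t) := by
    rw [charFun_apply, charFun_apply, integral_map hAm.aemeasurable (by fun_prop)]
    congr 1; ext v
    congr 3
    simp only [matVec, EuclideanSpace.inner_eq_star_dotProduct, star_trivial]
    rw [Matrix.mulVec_transpose, Matrix.dotProduct_mulVec]
  rw [e, charFun_multivariateGaussian hΓ, charFun_multivariateGaussian hΓA]
  simp only [inner_zero_right, matVec]
  congr 4
  rw [← Matrix.mulVec_mulVec, ← Matrix.mulVec_mulVec, Matrix.dotProduct_mulVec t.ofLp A,
    ← Matrix.mulVec_transpose]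

lemma TendstoInDistribution.matVec_comp {Ω : Type*} [MeasurableSpace Ω] {P : Measure Ω}
    [IsProbabilityMeasure P] {W : ℕ → Ω → Vec d} {Γ : Matrix (Fin d) (Fin d) ℝ}
    (hΓ : Γ.PosSemidef)
    (h : TendstoInDistribution W atTop id (fun _ => P) (multivariateGaussian 0 Γ))
    (A : Matrix (Fin d) (Fin d) ℝ) :
    TendstoInDistribution (fun n ω => matVec A (W n ω)) atTop id (fun _ => P)
      (multivariateGaussian 0 (A * Γ * Aᵀ)) where
  forall_aemeasurable n := (continuous_matVec A).measurable.comp_aemeasurable (h.1 n)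
  aemeasurable_limit := aemeasurable_id
  tendsto := by
    have h2 := (h.continuous_comp (continuous_matVec A)).tendsto
    simp only [Measure.map_id, Function.comp_id, multivariateGaussian_map_matVec hΓ] at h2 ⊢
    exact h2

end Gaussian

section Model

variable {d : ℕ} {Ω : Type*} [MeasurableSpace Ω] {P : Measure Ω} [IsProbabilityMeasure P]

lemma dotProduct_mulVec_eq_sum (A : Matrix (Fin d) (Fin d) ℝ) (t : Fin d → ℝ) :
    t ⬝ᵥ A *ᵥ t = ∑ j, ∑ k, t j * t k * A j k := by
  simp only [dotProduct, Matrix.mulVec, Finset.mul_sum]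
  refine Finset.sum_congr rfl fun j _ => Finset.sum_congr rfl fun k _ => by ring

lemma sq_dotProduct_eq_sum (t v : Fin d → ℝ) :
    (t ⬝ᵥ v) ^ 2 = ∑ j, ∑ k, t j * t k * (v j * v k) := by
  simp only [dotProduct, sq, Finset.sum_mul_sum]
  refine Finset.sum_congr rfl fun j _ => Finset.sum_congr rfl fun k _ => by ring

variable {X : ℕ → Ω → Vec d} {ε : ℕ → Ω → ℝ}

/-- Asymptotic normality for quantized schemes with independent observations. -/
theorem tendstoInDistribution_scheme {U : ℕ → ℕ → Bit d → Ω → ℝ} {θ : ℕ → Params d} {β : Vec d}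
    {bhat : ℕ → Ω → Vec d}
    {Sig Γ : Matrix (Fin d) (Fin d) ℝ} {H : ℕ → Matrix (Fin d) (Fin d) ℝ} {μ : ℕ → ℝ} {B κ : ℝ}
    (h : ∀ n, IsModel P X ε (U n)) (hβ : ∀ n, (θ n).β = β)
    (hest : ∀ n, ((θ n).scheme X ε (U n)).IsEstimator P n (bhat n))
    (hR : Tendsto (fun n : ℕ => (θ n).R ^ 4 / n) atTop (𝓝 0))
    (hGmean : ∀ j k, Tendsto (fun n : ℕ => (n : ℝ)⁻¹ *
      ∑ i ∈ Finset.range n, ∫ ω, (θ n).gram (obs X ε (U n) i ω) j k ∂P) atTop (𝓝 (Sig j k)))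
    (hSig : Sig.PosDef) (hΓ : Γ.PosSemidef)
    (hHu : ∀ᶠ n in atTop, IsUnit (H n).det)
    (hHκ : ∀ᶠ n in atTop, ∀ j a b k, |H n j a * (H n)⁻¹ b k| ≤ κ)
    (hsb : ∀ᶠ n in atTop, ∀ o j, |(H n *ᵥ (θ n).score o) j| ≤ B)
    (hmean : ∀ᶠ n in atTop, ∀ i < n, ∀ j,
      |∫ ω, (H n *ᵥ (θ n).score (obs X ε (U n) i ω)) j ∂P| ≤ μ n)
    (hμ : Tendsto (fun n : ℕ => √(n : ℝ) * μ n) atTop (𝓝 0))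
    (hcov : ∀ t : Fin d → ℝ, Tendsto (fun n : ℕ => (n : ℝ)⁻¹ *
      ∑ i ∈ Finset.range n, ∫ ω, (t ⬝ᵥ (H n *ᵥ (θ n).score (obs X ε (U n) i ω))) ^ 2 ∂P) atTop
      (𝓝 (t ⬝ᵥ Γ *ᵥ t))) :
    TendstoInDistribution (fun (n : ℕ) ω => √(n : ℝ) • matVec (H n * Sig) (bhat n ω - β)) atTop id
      (fun _ => P) (multivariateGaussian 0 Γ) := by
  have hs : ∀ n i ω, ((θ n).scheme X ε (U n)).score β i ω = (θ n).score (obs X ε (U n) i ω) := by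
    intro n i ω
    ext j
    rw [← hβ n, Params.scheme_score]
  have hscm : ∀ n, Measurable fun o => (θ n).score o := fun n =>
    measurable_pi_lambda _ fun j => (θ n).measurable_score j
  refine tendstoInDistribution_estimator (S := fun n => (θ n).scheme X ε (U n)) (H := H) (κ := κ)
    (B := B) (μ := μ) (ρ := fun n => (θ n).R ^ 2) hest ?_ ?_ ?_ ?_ ?_ hSig ?_ ?_ hΓ hHu hHκ ?_ ?_
    hμ ?_
  · intro n i j k
    simp_rw [Params.scheme_Gram]
    exact ((θ n).measurable_gram j k).comp ((h n).measurable_obs i)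
  · intro n j k
    simp_rw [Params.scheme_Gram]
    exact (h n).iIndepFun_obs.comp (fun _ o => (θ n).gram o j k) fun _ => (θ n).measurable_gram j k
  · intro n i ω j k
    rw [Params.scheme_Gram]
    exact (θ n).abs_gram_le _ _ _
  · refine hR.congr fun n => by ring
  · simp_rw [Params.scheme_Gram]
    exact hGmean
  · intro n i
    simp_rw [hs]
    exact (hscm n).comp ((h n).measurable_obs i)
  · intro n
    simp_rw [hs]
    exact (h n).iIndepFun_obs.comp (fun _ o => (θ n).score o) fun _ => hscm n
  · filter_upwards [hsb] with n hn i _ ω j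
    rw [hs]
    exact hn _ _
  · filter_upwards [hmean] with n hn i hi j
    simp_rw [hs]
    exact hn i hi j
  · simp_rw [hs]
    exact hcov

namespace IsModel

lemma integrable_score_mul_score {U : ℕ → Bit d → Ω → ℝ} (h : IsModel P X ε U) (θ : Params d)
    (i : ℕ) (j k : Fin d) :
    Integrable (fun ω => θ.score (obs X ε U i ω) j * θ.score (obs X ε U i ω) k) P :=
  h.integrable_of_bound i (v := fun o => θ.score o j * θ.score o k)
    ((θ.measurable_score j).mul (θ.measurable_score k)) (B := θ.scoreBound * θ.scoreBound)
    fun o => by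
      rw [abs_mul]
      exact mul_le_mul (θ.abs_score_le o j) (θ.abs_score_le o k) (abs_nonneg _)
        ((abs_nonneg _).trans (θ.abs_score_le o j))

lemma integral_sq_dotProduct_score {U : ℕ → Bit d → Ω → ℝ} (h : IsModel P X ε U) (θ : Params d)
    (i : ℕ) (t : Fin d → ℝ) :
    ∫ ω, (t ⬝ᵥ θ.score (obs X ε U i ω)) ^ 2 ∂P =
      ∑ j, ∑ k, t j * t k * ∫ ω, θ.score (obs X ε U i ω) j * θ.score (obs X ε U i ω) k ∂P := by
  simp_rw [sq_dotProduct_eq_sum]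
  rw [integral_finsetSum _ fun j _ => integrable_finsetSum _ fun k _ =>
    (h.integrable_score_mul_score θ i j k).const_mul _]
  refine Finset.sum_congr rfl fun j _ => ?_
  rw [integral_finsetSum _ fun k _ => (h.integrable_score_mul_score θ i j k).const_mul _]
  simp_rw [integral_const_mul]

lemma integrable_score {U : ℕ → Bit d → Ω → ℝ} (h : IsModel P X ε U) (θ : Params d)
    (i : ℕ) (j : Fin d) : Integrable (fun ω => θ.score (obs X ε U i ω) j) P :=
  h.integrable_of_bound i (v := fun o => θ.score o j) (θ.measurable_score j)
    (fun o => θ.abs_score_le o j)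

/-- In an i.i.d. model, the observations are identically distributed. -/
lemma identDistrib_obs {U : ℕ → Bit d → Ω → ℝ} (h : IsModel P X ε U)
    (hX : ∀ i, IdentDistrib (X i) (X 0) P P) (i : ℕ) :
    IdentDistrib (obs X ε U i) (obs X ε U 0) P P := by
  have hind : ∀ i, IndepFun (X i) (ε i) P := fun i =>
    h.indep_noise.comp (measurable_pi_apply i) (measurable_pi_apply i)
  have hrow : ∀ i, iIndepFun (U i) P := fun i => h.dither.indep.precomp (g := fun k => (i, k))
      (fun a b hab => by simpa using hab)
  have hU : ∀ i, Measurable (fun ω k => U i k ω) := fun i =>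
    measurable_pi_lambda _ fun k => h.dither.meas i k
  refine IdentDistrib.prodMk ((hX i).prodMk (h.noise.ident i) (hind i) (hind 0)) ?_
    (h.indepFun_data_dither_row i) (h.indepFun_data_dither_row 0)
  refine ⟨(hU i).aemeasurable, (hU 0).aemeasurable, ?_⟩
  rw [(hrow i).map_fun_eq_pi_map fun k => (h.dither.meas i k).aemeasurable,
    (hrow 0).map_fun_eq_pi_map fun k => (h.dither.meas 0 k).aemeasurable]
  simp_rw [h.dither.unif]

end IsModel

/-- Asymptotic normality for i.i.d. observations and scalar normalization. -/
theorem tendstoInDistribution_iid {U : ℕ → ℕ → Bit d → Ω → ℝ} {θ : ℕ → Params d} {β : Vec d}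
    {bhat : ℕ → Ω → Vec d} {Sig Γ : Matrix (Fin d) (Fin d) ℝ} {c : ℕ → ℝ} {B : ℝ}
    (h : ∀ n, IsModel P X ε (U n)) (hX : ∀ i, IdentDistrib (X i) (X 0) P P)
    (hβ : ∀ n, (θ n).β = β)
    (hest : ∀ n, ((θ n).scheme X ε (U n)).IsEstimator P n (bhat n))
    (hc : ∀ᶠ n in atTop, c n ≠ 0)
    (hR : Tendsto (fun n : ℕ => (θ n).R ^ 4 / n) atTop (𝓝 0))
    (hGmean : ∀ j k, Tendsto (fun n : ℕ => ∫ ω, (θ n).gram (obs X ε (U n) 0 ω) j k ∂P) atTop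
      (𝓝 (Sig j k)))
    (hSig : Sig.PosDef)
    (hsb : ∀ᶠ n in atTop, |c n| * (θ n).scoreBound ≤ B)
    (hmean : ∀ j, Tendsto (fun n : ℕ => √(n : ℝ) *
      (c n * ∫ ω, (θ n).score (obs X ε (U n) 0 ω) j ∂P)) atTop (𝓝 0))
    (hcov : ∀ j k, Tendsto (fun n : ℕ => c n ^ 2 * ∫ ω, (θ n).score (obs X ε (U n) 0 ω) j *
      (θ n).score (obs X ε (U n) 0 ω) k ∂P) atTop (𝓝 (Γ j k))) :
    TendstoInDistribution (fun (n : ℕ) ω => (c n * √(n : ℝ)) • (bhat n ω - β)) atTop id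
      (fun _ => P) (multivariateGaussian 0 (Sig⁻¹ * Γ * Sig⁻¹)) := by
  have hid : ∀ n i (f : Obs d → ℝ), Measurable f →
      ∫ ω, f (obs X ε (U n) i ω) ∂P = ∫ ω, f (obs X ε (U n) 0 ω) ∂P := fun n i f hf =>
    (((h n).identDistrib_obs hX i).comp hf).integral_eq
  have hmulV : ∀ n (v : Fin d → ℝ), (c n • (1 : Matrix (Fin d) (Fin d) ℝ)) *ᵥ v = c n • v := by
    intro n v
    rw [Matrix.smul_mulVec, Matrix.one_mulVec]
  have hquad : ∀ t : Fin d → ℝ, Tendsto (fun n : ℕ => c n ^ 2 *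
      ∫ ω, (t ⬝ᵥ (θ n).score (obs X ε (U n) 0 ω)) ^ 2 ∂P) atTop (𝓝 (t ⬝ᵥ Γ *ᵥ t)) := by
    intro t
    rw [dotProduct_mulVec_eq_sum]
    have := tendsto_finsetSum Finset.univ fun j _ => tendsto_finsetSum Finset.univ fun k _ =>
      (hcov j k).const_mul (t j * t k)
    refine this.congr fun n => ?_
    rw [(h n).integral_sq_dotProduct_score, Finset.mul_sum]
    refine Finset.sum_congr rfl fun j _ => ?_
    rw [Finset.mul_sum]
    refine Finset.sum_congr rfl fun k _ => by ring
  have hΓ : Γ.PosSemidef := by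
    refine Matrix.PosSemidef.of_dotProduct_mulVec_nonneg ?_ fun t => ?_
    · refine Matrix.IsHermitian.ext fun j k => ?_
      rw [star_trivial]
      refine tendsto_nhds_unique (hcov k j) ((hcov j k).congr fun n => ?_)
      simp_rw [mul_comm]
    · rw [star_trivial]
      exact ge_of_tendsto' (hquad t) fun n =>
        mul_nonneg (sq_nonneg _) (integral_nonneg fun ω => sq_nonneg _)
  have hmain := tendstoInDistribution_scheme (Sig := Sig) (Γ := Γ)
    (H := fun n => c n • (1 : Matrix (Fin d) (Fin d) ℝ)) (B := B) (κ := 1)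
    (μ := fun n => ∑ j, |c n * ∫ ω, (θ n).score (obs X ε (U n) 0 ω) j ∂P|) h hβ hest hR ?_ hSig hΓ
    ?_ ?_ ?_ ?_ ?_ ?_
  · have hS := isUnit_det_of_posDef hSig
    have hT : (Sig⁻¹)ᵀ = Sig⁻¹ := by simpa using hSig.inv.isHermitian.eq
    have h2 := TendstoInDistribution.matVec_comp hΓ hmain Sig⁻¹
    rw [hT] at h2
    refine h2.congr (fun n => ae_of_all _ fun ω => ?_) ae_eq_rfl
    simp only [matVec]
    rw [Matrix.smul_mul, Matrix.one_mul, WithLp.ofLp_smul, Matrix.mulVec_smul, Matrix.smul_mulVec,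
      Matrix.mulVec_smul, Matrix.mulVec_mulVec, Matrix.nonsing_inv_mul _ hS, Matrix.one_mulVec,
      smul_smul, mul_comm]
    rfl
  · intro j k
    refine (hGmean j k).congr' ?_
    filter_upwards [eventually_gt_atTop 0] with n hn
    have hn' : (n : ℝ) ≠ 0 := by exact_mod_cast hn.ne'
    rw [Finset.sum_congr rfl fun i _ => hid n i _ ((θ n).measurable_gram j k), Finset.sum_const,
      Finset.card_range, nsmul_eq_mul, inv_mul_cancel_left₀ hn']
  · filter_upwards [hc] with n hn
    rw [Matrix.det_smul, Matrix.det_one, mul_one]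
    exact (IsUnit.mk0 _ hn).pow _
  · filter_upwards [hc] with n hn j a b k
    have e : (c n • (1 : Matrix (Fin d) (Fin d) ℝ))⁻¹ = (c n)⁻¹ • (1 : Matrix (Fin d) (Fin d) ℝ) := by
      refine Matrix.inv_eq_left_inv ?_
      rw [Matrix.smul_mul, Matrix.one_mul, smul_smul, inv_mul_cancel₀ hn, one_smul]
    rw [e, Matrix.smul_apply, Matrix.smul_apply, Matrix.one_apply, Matrix.one_apply]
    split_ifs <;> simp [hn]
  · filter_upwards [hsb] with n hn o j
    rw [hmulV, Pi.smul_apply, smul_eq_mul, abs_mul]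
    exact (mul_le_mul_of_nonneg_left ((θ n).abs_score_le o j) (abs_nonneg _)).trans hn
  · refine Eventually.of_forall fun n i _ j => ?_
    simp_rw [hmulV, Pi.smul_apply, smul_eq_mul]
    rw [integral_const_mul, hid n i _ ((θ n).measurable_score j)]
    exact Finset.single_le_sum (f := fun j => |c n * ∫ ω, (θ n).score (obs X ε (U n) 0 ω) j ∂P|)
      (fun _ _ => abs_nonneg _) (Finset.mem_univ j)
  · have := tendsto_finsetSum Finset.univ fun j _ => (hmean j).abs
    simp only [abs_zero, Finset.sum_const_zero] at this
    refine this.congr fun n => ?_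
    rw [Finset.mul_sum]
    refine Finset.sum_congr rfl fun j _ => ?_
    rw [abs_mul, abs_of_nonneg (Real.sqrt_nonneg _)]
  · intro t
    refine (hquad t).congr' ?_
    filter_upwards [eventually_gt_atTop 0] with n hn
    have hn' : (n : ℝ) ≠ 0 := by exact_mod_cast hn.ne'
    have hm : Measurable fun o => (t ⬝ᵥ (θ n).score o) ^ 2 := by
      simp only [dotProduct]
      exact (Finset.measurable_fun_sum _ fun j _ =>
        ((θ n).measurable_score j).const_mul _).pow_const 2
    simp_rw [hmulV, dotProduct_smul, smul_eq_mul, mul_pow, integral_const_mul]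
    rw [Finset.sum_congr rfl fun i _ => by rw [hid n i _ hm], Finset.sum_const,
      Finset.card_range, nsmul_eq_mul, inv_mul_cancel_left₀ hn']

end Model

section Degenerate

lemma tendstoInDistribution_of_subsingleton {E Ω Ω' : Type*} [TopologicalSpace E]
    [MeasurableSpace E] [OpensMeasurableSpace E] [Subsingleton E] [MeasurableSpace Ω]
    [MeasurableSpace Ω'] {P : Measure Ω}
    [IsProbabilityMeasure P] {μ : Measure Ω'} [IsProbabilityMeasure μ] {W : ℕ → Ω → E} {Z : Ω' → E}
    (hW : ∀ n, AEMeasurable (W n) P) (hZ : AEMeasurable Z μ) :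
    TendstoInDistribution W atTop Z (fun _ => P) μ where
  forall_aemeasurable := hW
  aemeasurable_limit := hZ
  tendsto := by
    have : ∀ ν ν' : ProbabilityMeasure E, ν = ν' := by
      intro ν ν'
      refine Subtype.ext (Measure.ext fun s _ => ?_)
      rcases s.eq_empty_or_nonempty with rfl | hs
      · simp
      · rw [Subsingleton.eq_univ_of_nonempty hs]
        exact ν.2.measure_univ.trans ν'.2.measure_univ.symm
    rw [this ⟨μ.map Z, _⟩ ⟨P.map (W 0), Measure.isProbabilityMeasure_map (hW 0)⟩]
    refine tendsto_const_nhds.congr fun n => this _ _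

end Degenerate

section Noise

variable {d : ℕ} {Ω : Type*} [MeasurableSpace Ω] {P : Measure Ω}
  {X : ℕ → Ω → Vec d} {ε : ℕ → Ω → ℝ} {U : ℕ → Bit d → Ω → ℝ}

lemma IsNoise.integrable_sq (h : IsNoise P ε) : Integrable (fun ω => ε 0 ω ^ 2) P :=
  Integrable.of_integral_ne_zero (by rw [h.var]; exact one_ne_zero)

lemma IsNoise.memLp (h : IsNoise P ε) (i : ℕ) : MemLp (ε i) 2 P :=
  (h.ident i).symm.memLp_iff.1 ((memLp_two_iff_integrable_sq (h.meas 0).aestronglyMeasurable).2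
    h.integrable_sq)

lemma IsNoise.integral_eq_zero (h : IsNoise P ε) (i : ℕ) : ∫ ω, ε i ω ∂P = 0 := by
  rw [(h.ident i).integral_eq, h.mean]

lemma IsNoise.integral_sq_eq_one (h : IsNoise P ε) (i : ℕ) : ∫ ω, ε i ω ^ 2 ∂P = 1 := by
  rw [← h.var]
  exact ((h.ident i).comp (u := fun x => x ^ 2) (by fun_prop)).integral_eq

lemma IsRandomDesign.isModel (hX : IsRandomDesign P X ε) (hε : IsNoise P ε)
    (hU : IsDither P X ε U) : IsModel P X ε U :=
  ⟨hε, hX.meas, hX.indep, hX.indep_noise, hU⟩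

namespace IsModel

/-- The noise is centered given the predictor and the dithers. -/
lemma integral_mul_noise [IsProbabilityMeasure P] (h : IsModel P X ε U) (i : ℕ) {v : (Bit d → ℝ) × Vec d → ℝ}
    (hv : Measurable v) : ∫ ω, v (fun k => U i k ω, X i ω) * ε i ω ∂P = 0 := by
  have hm : Measurable fun ω => ((fun k => U i k ω), X i ω) :=
    (measurable_pi_lambda _ fun k => h.dither.meas i k).prodMk (h.measX i)
  have h1 := (h.indepFun_noise i).comp (φ := v) (ψ := id) hv measurable_id
  have h2 := h1.integral_fun_mul_eq_mul_integral (hv.comp hm).aestronglyMeasurable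
    (h.noise.meas i).aestronglyMeasurable
  simp only [Function.comp, id] at h2
  rw [h2, h.noise.integral_eq_zero, mul_zero]

end IsModel

end Noise

section Covariance

variable {d : ℕ}

/-- The vector `(X̃ X̃ᵀ + Δ) β` of one observation. -/
noncomputable def Params.gramMul (θ : Params d) (o : Obs d) (j : Fin d) : ℝ :=
  ∑ l, θ.gram o j l * θ.β l

namespace Params

variable (θ : Params d)

lemma measurable_gramMul (j : Fin d) : Measurable (fun o => θ.gramMul o j) :=
  Finset.measurable_fun_sum _ fun l _ => (θ.measurable_gram j l).mul_const _

lemma abs_gramMul_le (o : Obs d) (j : Fin d) : |θ.gramMul o j| ≤ θ.R ^ 2 * ∑ l, |θ.β l| :=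
  θ.abs_sum_gram_le o j

lemma score_eq (o : Obs d) (j : Fin d) :
    θ.score o j = θ.quant (.inr (.inr ())) o * θ.quant (.inl j) o - θ.gramMul o j := rfl

lemma gram_update_Y (o : Obs d) (r : ℝ) (j k : Fin d) :
    θ.gram (o.1, Function.update o.2 (.inr (.inr ())) r) j k = θ.gram o j k := by
  unfold gram
  rw [quant_update_of_ne _ (by simp), quant_update_of_ne _ (by simp),
    quant_update_of_ne _ (by simp)]

lemma gramMul_update_Y (o : Obs d) (r : ℝ) (j : Fin d) :
    θ.gramMul (o.1, Function.update o.2 (.inr (.inr ())) r) j = θ.gramMul o j := by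
  unfold gramMul
  simp_rw [gram_update_Y]

variable {Ω : Type*} [MeasurableSpace Ω] {P : Measure Ω}
  {X : ℕ → Ω → Vec d} {ε : ℕ → Ω → ℝ} {U : ℕ → Bit d → Ω → ℝ}

lemma scheme_GammaA (j k : Fin d) : (θ.scheme X ε U).GammaA P θ.β j k =
    ∫ ω, θ.gramMul (obs X ε U 0 ω) j * θ.gramMul (obs X ε U 0 ω) k ∂P := by
  unfold Scheme.GammaA
  rw [Matrix.of_apply]
  congr 1; ext ω
  rw [Matrix.mul_vecMulVec, Matrix.vecMulVec_mul, Matrix.vecMulVec_apply]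
  simp only [Matrix.mulVec, Matrix.vecMul, dotProduct, scheme_Gram, gramMul]
  congr 1
  refine Finset.sum_congr rfl fun l _ => ?_
  rw [gram_symm, mul_comm]

lemma scheme_GammaB (j k : Fin d) : (θ.scheme X ε U).GammaB P θ.β j k =
    ∫ ω, θ.gramMul (obs X ε U 0 ω) j * θ.quant (.inl k) (obs X ε U 0 ω) *
        θ.quant (.inr (.inr ())) (obs X ε U 0 ω) ∂P +
    ∫ ω, θ.gramMul (obs X ε U 0 ω) k * θ.quant (.inl j) (obs X ε U 0 ω) *
        θ.quant (.inr (.inr ())) (obs X ε U 0 ω) ∂P := by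
  unfold Scheme.GammaB
  rw [Matrix.add_apply, Matrix.of_apply, Matrix.of_apply]
  congr 2
  · ext ω
    rw [Matrix.mul_vecMulVec, Matrix.vecMulVec_apply, scheme_Xq, scheme_Yq]
    simp only [Matrix.mulVec, dotProduct, scheme_Gram, gramMul]
  · ext ω
    rw [Matrix.vecMulVec_mul, Matrix.vecMulVec_apply, scheme_Xq, scheme_Yq]
    simp only [Matrix.vecMul, dotProduct, scheme_Gram, gramMul]
    rw [mul_comm, mul_comm (θ.quant (.inl j) _)]
    congr 2
    refine Finset.sum_congr rfl fun l _ => ?_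
    rw [gram_symm, mul_comm]

variable [IsProbabilityMeasure P]

lemma integral_score_mul_score (h : IsModel P X ε U) (i : ℕ) (j k : Fin d) :
    ∫ ω, θ.score (obs X ε U i ω) j * θ.score (obs X ε U i ω) k ∂P =
      θ.L ^ 2 * ∫ ω, θ.quant (.inl j) (obs X ε U i ω) * θ.quant (.inl k) (obs X ε U i ω) ∂P
      + ∫ ω, θ.gramMul (obs X ε U i ω) j * θ.gramMul (obs X ε U i ω) k ∂P
      - (∫ ω, θ.gramMul (obs X ε U i ω) j * θ.quant (.inl k) (obs X ε U i ω) *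
          θ.quant (.inr (.inr ())) (obs X ε U i ω) ∂P +
        ∫ ω, θ.gramMul (obs X ε U i ω) k * θ.quant (.inl j) (obs X ε U i ω) *
          θ.quant (.inr (.inr ())) (obs X ε U i ω) ∂P) := by
  have hgq : ∀ j k, Integrable (fun ω => θ.gramMul (obs X ε U i ω) j *
      θ.quant (.inl k) (obs X ε U i ω) * θ.quant (.inr (.inr ())) (obs X ε U i ω)) P := fun j k =>
    h.integrable_of_bound i
      (v := fun o => θ.gramMul o j * θ.quant (.inl k) o * θ.quant (.inr (.inr ())) o)
      (((θ.measurable_gramMul j).mul (θ.measurable_quant _)).mul (θ.measurable_quant _))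
      (B := (θ.R ^ 2 * ∑ l, |θ.β l|) * |θ.R| * |θ.L|) fun o => by
        rw [abs_mul, abs_mul, abs_quant_inl, abs_quant_Y]
        gcongr
        exact θ.abs_gramMul_le o j
  have hgg : Integrable (fun ω => θ.gramMul (obs X ε U i ω) j * θ.gramMul (obs X ε U i ω) k) P :=
    h.integrable_of_bound i (v := fun o => θ.gramMul o j * θ.gramMul o k)
      ((θ.measurable_gramMul j).mul (θ.measurable_gramMul k))
      (B := (θ.R ^ 2 * ∑ l, |θ.β l|) * (θ.R ^ 2 * ∑ l, |θ.β l|)) fun o => by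
        rw [abs_mul]
        exact mul_le_mul (θ.abs_gramMul_le o j) (θ.abs_gramMul_le o k) (abs_nonneg _)
          ((abs_nonneg _).trans (θ.abs_gramMul_le o j))
  have hqq := h.integrable_quant_mul_quant θ i (.inl j) (.inl k)
  rw [← integral_const_mul, ← integral_add (hgq j k) (hgq k j),
    ← integral_add (hqq.const_mul _) hgg]
  refine Eq.trans ?_ (integral_sub ((hqq.const_mul (θ.L ^ 2)).add hgg)
    ((hgq j k).add (hgq k j)))
  congr 1; ext ω
  rw [score_eq, score_eq, ← θ.quant_Y_sq (obs X ε U i ω)]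
  ring

lemma scheme_Gamma (h : IsModel P X ε U) (j k : Fin d) :
    (θ.scheme X ε U).Gamma P θ.β j k =
      ∫ ω, θ.score (obs X ε U 0 ω) j * θ.score (obs X ε U 0 ω) k ∂P +
      θ.L ^ 2 * (if j = k then 0 else ∫ ω, X 0 ω j * X 0 ω k ∂P -
        ∫ ω, θ.gram (obs X ε U 0 ω) j k ∂P) := by
  rw [θ.integral_score_mul_score h, ← scheme_GammaA, ← scheme_GammaB]
  unfold Scheme.Gamma
  rw [Matrix.sub_apply, Matrix.add_apply, Matrix.smul_apply, Matrix.add_apply, Matrix.sub_apply,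
    Matrix.smul_apply, Matrix.one_apply, Matrix.diagonal_apply]
  change θ.L ^ 2 • (_ + θ.R ^ 2 • _) + _ - _ = _
  simp only [smul_eq_mul]
  by_cases hjk : j = k
  · subst hjk
    simp only [if_true, sub_self]
    simp_rw [← sq, quant_inl_sq]
    simp
  · simp only [if_neg hjk, gram]
    simp only [Scheme.Sigma, Matrix.of_apply]
    change θ.L ^ 2 * (∫ ω, X 0 ω j * X 0 ω k ∂P - 0 + _) + _ - _ = _
    ring

end Params

end Covariance

section Bounded

variable {d : ℕ} {Ω : Type*} [MeasurableSpace Ω] {P : Measure Ω} [IsProbabilityMeasure P]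
  {X : ℕ → Ω → Vec d} {ε : ℕ → Ω → ℝ} {U : ℕ → Bit d → Ω → ℝ} {θ : Params d} {i : ℕ}

lemma nonneg_of_ae_abs_le {Z : Ω → ℝ} {b : ℝ} (h : ∀ᵐ ω ∂P, |Z ω| ≤ b) : 0 ≤ b := by
  obtain ⟨ω, hω⟩ := h.exists
  exact (abs_nonneg _).trans hω

omit [IsProbabilityMeasure P] in
lemma clipped_X_ae (hX : ∀ᵐ ω ∂P, ∀ j, |X i ω j| ≤ θ.R) :
    ∀ᵐ ω ∂P, ∀ j, θ.clipped (.inl j) (obs X ε U i ω) = X i ω j := by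
  filter_upwards [hX] with ω hω j
  exact clip_symm_eq_self (hω j)

omit [IsProbabilityMeasure P] in
lemma clipped_Y_ae (hY : ∀ᵐ ω ∂P, |response θ.β θ.σ X ε i ω| ≤ θ.L) :
    ∀ᵐ ω ∂P, θ.clipped (.inr (.inr ())) (obs X ε U i ω) =
      (X i ω).ofLp ⬝ᵥ θ.β.ofLp + θ.σ * ε i ω := by
  filter_upwards [hY] with ω hω
  exact clip_symm_eq_self hω

namespace IsModel

lemma integral_gram_of_bounded (h : IsModel P X ε U) (hR : 0 ≤ θ.R) (hL : 0 ≤ θ.L)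
    (hX : ∀ᵐ ω ∂P, ∀ j, |X i ω j| ≤ θ.R) (j k : Fin d) :
    ∫ ω, θ.gram (obs X ε U i ω) j k ∂P = ∫ ω, X i ω j * X i ω k ∂P := by
  rw [h.integral_gram θ hR hL]
  refine integral_congr_ae ?_
  filter_upwards [clipped_X_ae (ε := ε) (U := U) hX] with ω hω
  rw [hω, hω]

lemma integral_score_of_bounded (h : IsModel P X ε U) (hR : 0 ≤ θ.R) (hL : 0 ≤ θ.L)
    (hX : ∀ᵐ ω ∂P, ∀ j, |X i ω j| ≤ θ.R) (hY : ∀ᵐ ω ∂P, |response θ.β θ.σ X ε i ω| ≤ θ.L)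
    (j : Fin d) : ∫ ω, θ.score (obs X ε U i ω) j ∂P = 0 := by
  rw [h.integral_score θ hR hL,
    ← h.integral_mul_noise i (v := fun p => p.2 j * θ.σ) (by fun_prop)]
  refine integral_congr_ae ?_
  filter_upwards [clipped_X_ae (ε := ε) (U := U) hX, clipped_Y_ae (U := U) hY] with ω hω hω'
  simp_rw [hω, hω', dotProduct]
  ring

end IsModel

lemma abs_integral_le_of_ae_abs_le {f : Ω → ℝ} {b : ℝ} (h : ∀ᵐ ω ∂P, |f ω| ≤ b) :
    |∫ ω, f ω ∂P| ≤ b := by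
  have := norm_integral_le_of_norm_le_const (μ := P) (f := f) (C := b) h
  simpa using this

omit [IsProbabilityMeasure P] in
lemma abs_sum_mul_le {v w : Fin d → ℝ} {b : ℝ} (h : ∀ j, |v j| ≤ b) :
    |∑ l, v l * w l| ≤ b * ∑ l, |w l| := by
  refine (Finset.abs_sum_le_sum_abs _ _).trans ?_
  rw [Finset.mul_sum]
  refine Finset.sum_le_sum fun l _ => ?_
  rw [abs_mul]
  exact mul_le_mul_of_nonneg_right (h l) (abs_nonneg _)

namespace IsModel

/-- Averaging over the noise and the dither of the response quantizer. -/
lemma integral_mul_quant_Y_of_bounded (h : IsModel P X ε U) (hR : 0 ≤ θ.R) (hL : 0 ≤ θ.L)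
    (hX : ∀ᵐ ω ∂P, ∀ j, |X i ω j| ≤ θ.R) (hY : ∀ᵐ ω ∂P, |response θ.β θ.σ X ε i ω| ≤ θ.L)
    {v : Obs d → ℝ} (hvm : Measurable v) {B : ℝ} (hb : ∀ o, |v o| ≤ B)
    (hva : ∀ o : Obs d, v (o.1, Function.update o.2 (.inr (.inr ())) 0) = v o)
    (hvε : ∀ o : Obs d, v ((o.1.1, 0), o.2) = v o) :
    ∫ ω, v (obs X ε U i ω) * θ.quant (.inr (.inr ())) (obs X ε U i ω) ∂P =
      ∫ ω, v (obs X ε U i ω) * ∑ l, X i ω l * θ.β l ∂P := by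
  have hB : 0 ≤ B := (abs_nonneg _).trans (hb 0)
  have hn : ∫ ω, v (obs X ε U i ω) * θ.σ * ε i ω ∂P = 0 := by
    rw [← h.integral_mul_noise i
      (v := fun p : (Bit d → ℝ) × Vec d => v ((p.2, 0), p.1) * θ.σ)
      ((hvm.comp (by fun_prop)).mul_const _)]
    congr 1; ext ω
    rw [← hvε (obs X ε U i ω)]
    rfl
  have hiX : Integrable (fun ω => v (obs X ε U i ω) * ∑ l, X i ω l * θ.β l) P := by
    have hm := h.measX i
    refine Integrable.of_bound
      ((hvm.comp (h.measurable_obs i)).mul (by fun_prop)).aestronglyMeasurable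
      (B * (θ.R * ∑ l, |θ.β l|)) ?_
    filter_upwards [hX] with ω hω
    rw [norm_mul]
    exact mul_le_mul (hb _) (abs_sum_mul_le hω) (abs_nonneg _) hB
  have hiε : Integrable (fun ω => v (obs X ε U i ω) * θ.σ * ε i ω) P := by
    refine Integrable.bdd_mul ((h.noise.memLp i).integrable (by norm_num))
      ((hvm.comp (h.measurable_obs i)).mul_const _).aestronglyMeasurable
      (c := B * |θ.σ|) (ae_of_all _ fun ω => ?_)
    rw [norm_mul]
    exact mul_le_mul_of_nonneg_right (hb _) (abs_nonneg _)
  rw [h.integral_mul_quant θ hR hL i (.inr (.inr ())) hvm hb hva,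
    ← add_zero (∫ ω, v (obs X ε U i ω) * ∑ l, X i ω l * θ.β l ∂P), ← hn, ← integral_add hiX hiε]
  refine integral_congr_ae ?_
  filter_upwards [clipped_Y_ae (U := U) hY] with ω hω
  rw [hω, dotProduct]
  ring

lemma abs_integral_gramMul_mul_quant_le (h : IsModel P X ε U) (hR : 0 ≤ θ.R) (hL : 0 ≤ θ.L)
    (hX : ∀ᵐ ω ∂P, ∀ j, |X i ω j| ≤ θ.R) (hY : ∀ᵐ ω ∂P, |response θ.β θ.σ X ε i ω| ≤ θ.L)
    (j k : Fin d) :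
    |∫ ω, θ.gramMul (obs X ε U i ω) j * θ.quant (.inl k) (obs X ε U i ω) *
        θ.quant (.inr (.inr ())) (obs X ε U i ω) ∂P| ≤ θ.R ^ 4 * (∑ l, |θ.β l|) ^ 2 := by
  have hb : ∀ o, |θ.gramMul o j * θ.quant (.inl k) o| ≤ (θ.R ^ 2 * ∑ l, |θ.β l|) * θ.R :=
    fun o => by
      rw [abs_mul, Params.abs_quant_inl, abs_of_nonneg hR]
      exact mul_le_mul_of_nonneg_right (θ.abs_gramMul_le o j) hR
  rw [h.integral_mul_quant_Y_of_bounded (v := fun o => θ.gramMul o j * θ.quant (.inl k) o) hR hL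
    hX hY ((θ.measurable_gramMul j).mul (θ.measurable_quant _)) hb
    (fun o => by rw [θ.gramMul_update_Y, θ.quant_update_of_ne (by simp)]) fun o => rfl]
  refine abs_integral_le_of_ae_abs_le ?_
  filter_upwards [hX] with ω hω
  rw [abs_mul]
  refine (mul_le_mul (hb _) (abs_sum_mul_le hω) (abs_nonneg _) (by positivity)).trans (le_of_eq ?_)
  ring

lemma abs_GammaA_sub_GammaB_le (h : IsModel P X ε U) (hR : 0 ≤ θ.R) (hL : 0 ≤ θ.L)
    (hX : ∀ᵐ ω ∂P, ∀ j, |X 0 ω j| ≤ θ.R) (hY : ∀ᵐ ω ∂P, |response θ.β θ.σ X ε 0 ω| ≤ θ.L)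
    (j k : Fin d) :
    |((θ.scheme X ε U).GammaA P θ.β - (θ.scheme X ε U).GammaB P θ.β) j k| ≤
      3 * θ.R ^ 4 * (∑ l, |θ.β l|) ^ 2 := by
  rw [Matrix.sub_apply, Params.scheme_GammaA, Params.scheme_GammaB]
  have h1 := h.abs_integral_gramMul_mul_quant_le hR hL hX hY j k
  have h2 := h.abs_integral_gramMul_mul_quant_le hR hL hX hY k j
  have h3 : |∫ ω, θ.gramMul (obs X ε U 0 ω) j * θ.gramMul (obs X ε U 0 ω) k ∂P| ≤
      θ.R ^ 4 * (∑ l, |θ.β l|) ^ 2 := by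
    refine abs_integral_le_of_ae_abs_le (ae_of_all _ fun ω => ?_)
    rw [abs_mul]
    refine (mul_le_mul (θ.abs_gramMul_le _ j) (θ.abs_gramMul_le _ k) (abs_nonneg _)
      ((abs_nonneg _).trans (θ.abs_gramMul_le (obs X ε U 0 ω) j))).trans (le_of_eq ?_)
    ring
  rw [abs_le] at h1 h2 h3 ⊢
  constructor <;> linarith [h1.1, h1.2, h2.1, h2.2, h3.1, h3.2]

end IsModel

/-- Asymptotic normality for a random design and fixed quantizer ranges. -/
theorem tendstoInDistribution_of_bounded {bhat : ℕ → Ω → Vec d} (hX : IsRandomDesign P X ε)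
    (h : IsModel P X ε U) (hXR : ∀ᵐ ω ∂P, ∀ j, |X 0 ω j| ≤ θ.R)
    (hYL : ∀ᵐ ω ∂P, |response θ.β θ.σ X ε 0 ω| ≤ θ.L)
    (hSig : ((θ.scheme X ε U).Sigma P).PosDef)
    (hest : ∀ n, (θ.scheme X ε U).IsEstimator P n (bhat n)) :
    TendstoInDistribution (fun (n : ℕ) ω => √(n : ℝ) • (bhat n ω - θ.β)) atTop id (fun _ => P)
      (multivariateGaussian 0 (((θ.scheme X ε U).Sigma P)⁻¹ * (θ.scheme X ε U).Gamma P θ.β *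
        ((θ.scheme X ε U).Sigma P)⁻¹)) := by
  have hbm : ∀ n : ℕ, AEMeasurable (fun ω => √(n : ℝ) • (bhat n ω - θ.β)) P := fun n =>
    AEMeasurable.const_smul ((hest n).1.sub_const θ.β) (√(n : ℝ))
  rcases Nat.eq_zero_or_pos d with rfl | hd
  · exact tendstoInDistribution_of_subsingleton hbm aemeasurable_id
  have hR : 0 ≤ θ.R := nonneg_of_ae_abs_le (P := P) (Z := fun ω => X 0 ω ⟨0, hd⟩)
    (hXR.mono fun ω hω => hω _)
  have hL : 0 ≤ θ.L := nonneg_of_ae_abs_le hYL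
  have hG : ∀ j k, ∫ ω, θ.gram (obs X ε U 0 ω) j k ∂P = (θ.scheme X ε U).Sigma P j k :=
    fun j k => h.integral_gram_of_bounded hR hL hXR j k
  have := tendstoInDistribution_iid (U := fun _ => U) (θ := fun _ => θ) (β := θ.β) (bhat := bhat)
    (Sig := (θ.scheme X ε U).Sigma P) (Γ := (θ.scheme X ε U).Gamma P θ.β) (c := fun _ => 1)
    (B := θ.scoreBound) (fun _ => h) hX.ident (fun _ => rfl) hest
    (Eventually.of_forall fun _ => one_ne_zero) (tendsto_const_div_atTop_nhds_zero_nat _)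
    (fun j k => by simp_rw [hG]; exact tendsto_const_nhds) hSig
    (Eventually.of_forall fun _ => by simp)
    (fun j => by simp [h.integral_score_of_bounded hR hL hXR hYL])
    (fun j k => by
      rw [θ.scheme_Gamma h, hG]
      simp only [Scheme.Sigma, Matrix.of_apply, Params.scheme, sub_self, ite_self, mul_zero,
        add_zero, one_pow, one_mul]
      exact tendsto_const_nhds)
  simpa only [one_mul] using this

end Bounded

section Sqrt

variable {d : ℕ} {A : Matrix (Fin d) (Fin d) ℝ}

lemma sqrt_mul_sqrt_of_posSemidef (hA : A.PosSemidef) : CFC.sqrt A * CFC.sqrt A = A :=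
  CFC.sqrt_mul_sqrt_self A hA.nonneg

lemma sqrt_transpose (A : Matrix (Fin d) (Fin d) ℝ) : (CFC.sqrt A)ᵀ = CFC.sqrt A := by
  have h := (Matrix.nonneg_iff_posSemidef.1 (CFC.sqrt_nonneg A)).isHermitian.eq
  rwa [Matrix.conjTranspose_eq_transpose_of_trivial] at h

lemma isUnit_det_sqrt (hA : A.PosDef) : IsUnit (CFC.sqrt A).det := by
  have h := isUnit_det_of_posDef hA
  rw [← sqrt_mul_sqrt_of_posSemidef hA.posSemidef, Matrix.det_mul] at h
  exact isUnit_of_mul_isUnit_left h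

lemma invSqrt_transpose (A : Matrix (Fin d) (Fin d) ℝ) : (invSqrt A)ᵀ = invSqrt A := by
  rw [invSqrt, Matrix.transpose_nonsing_inv, sqrt_transpose]

lemma invSqrt_mul_mul_invSqrt (hA : A.PosDef) : invSqrt A * A * invSqrt A = 1 := by
  have hu := isUnit_det_sqrt hA
  calc invSqrt A * A * invSqrt A
      = ((CFC.sqrt A)⁻¹ * CFC.sqrt A) * (CFC.sqrt A * (CFC.sqrt A)⁻¹) := by
        rw [Matrix.mul_assoc, Matrix.mul_assoc, ← Matrix.mul_assoc (CFC.sqrt A) (CFC.sqrt A),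
          sqrt_mul_sqrt_of_posSemidef hA.posSemidef]
        rfl
    _ = 1 := by rw [Matrix.nonsing_inv_mul _ hu, Matrix.mul_nonsing_inv _ hu, one_mul]

lemma dotProduct_mulVec_symm {B : Matrix (Fin d) (Fin d) ℝ} (hB : Bᵀ = B) (v w : Fin d → ℝ) :
    v ⬝ᵥ B *ᵥ w = (B *ᵥ v) ⬝ᵥ w := by
  rw [Matrix.dotProduct_mulVec, ← Matrix.mulVec_transpose, hB]

lemma dotProduct_mulVec_invSqrt (hA : A.PosDef) (v : Fin d → ℝ) :
    (invSqrt A *ᵥ v) ⬝ᵥ A *ᵥ (invSqrt A *ᵥ v) = v ⬝ᵥ v := by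
  rw [← dotProduct_mulVec_symm (invSqrt_transpose A), Matrix.mulVec_mulVec, Matrix.mulVec_mulVec,
    invSqrt_mul_mul_invSqrt hA, Matrix.one_mulVec]

lemma sqrt_mulVec_dotProduct_self (hA : A.PosSemidef) (v : Fin d → ℝ) :
    (CFC.sqrt A *ᵥ v) ⬝ᵥ (CFC.sqrt A *ᵥ v) = v ⬝ᵥ A *ᵥ v := by
  rw [← dotProduct_mulVec_symm (sqrt_transpose A), Matrix.mulVec_mulVec,
    sqrt_mul_sqrt_of_posSemidef hA]

lemma sq_apply_le_mulVec_single (B : Matrix (Fin d) (Fin d) ℝ) (j k : Fin d) :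
    B j k ^ 2 ≤ (B *ᵥ Pi.single k 1) ⬝ᵥ (B *ᵥ Pi.single k 1) := by
  rw [Matrix.mulVec_single_one, dotProduct]
  refine le_trans (le_of_eq ?_) (Finset.single_le_sum
    (f := fun i => B.col k i * B.col k i) (fun i _ => mul_self_nonneg _) (Finset.mem_univ j))
  simp [sq]

end Sqrt

section FixedDesign

variable {d : ℕ} {Ω : Type*} [MeasurableSpace Ω] {P : Measure Ω} [IsProbabilityMeasure P]

lemma iIndepFun_const {ι E : Type*} [MeasurableSpace E] (x : ι → E) :
    iIndepFun (fun i (_ : Ω) => x i) P := by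
  classical
  rw [iIndepFun_iff_measure_inter_preimage_eq_mul]
  intro S s _
  by_cases h : ∀ i ∈ S, x i ∈ s i
  · have e : ⋂ i ∈ S, (fun _ : Ω => x i) ⁻¹' s i = Set.univ := by
      ext ω; simpa using h
    rw [e, measure_univ, Finset.prod_eq_one]
    intro i hi
    simp [h i hi]
  · push Not at h
    obtain ⟨i, hi, hx⟩ := h
    have e : ⋂ i ∈ S, (fun _ : Ω => x i) ⁻¹' s i = ∅ := by
      ext ω
      simp only [Set.mem_iInter, Set.mem_preimage, Set.mem_empty_iff_false, iff_false, not_forall]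
      exact ⟨i, hi, hx⟩
    rw [e, measure_empty, Finset.prod_eq_zero hi]
    simp [hx]

variable {ε : ℕ → Ω → ℝ} {U : ℕ → Bit d → Ω → ℝ} {θ : Params d}

lemma IsDither.isModel_fixed {x : ℕ → Vec d} (hε : IsNoise P ε)
    (hU : IsDither P (fun i _ => x i) ε U) : IsModel P (fun i _ => x i) ε U :=
  ⟨hε, fun _ => measurable_const, iIndepFun_const x, indepFun_const_left _ _, hU⟩

namespace IsModel

/-- The noise is visible in every direction of the score. -/
lemma sq_le_integral_sq_score {x : ℕ → Vec d} (h : IsModel P (fun i _ => x i) ε U)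
    (hR : 0 ≤ θ.R) (hL : 0 ≤ θ.L) (hX : ∀ i j, |x i j| ≤ θ.R) (i : ℕ)
    (hY : ∀ᵐ ω ∂P, |response θ.β θ.σ (fun i _ => x i) ε i ω| ≤ θ.L) (v : Fin d → ℝ) :
    θ.σ ^ 2 * (v ⬝ᵥ (x i).ofLp) ^ 2 ≤
      ∫ ω, (v ⬝ᵥ θ.score (obs (fun i _ => x i) ε U i ω)) ^ 2 ∂P := by
  set X : ℕ → Ω → Vec d := fun i _ => x i with hXdef
  have hXae : ∀ᵐ ω ∂P, ∀ j, |X i ω j| ≤ θ.R := ae_of_all _ fun ω j => hX i j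
  set m : ℝ := ∑ l, x i l * θ.β l with hm
  set q : Obs d → ℝ := fun o => ∑ j, v j * θ.quant (.inl j) o with hq
  set g : Obs d → ℝ := fun o => ∑ j, v j * θ.gramMul o j with hg
  have hqm : Measurable q := Finset.measurable_fun_sum _ fun j _ =>
    (θ.measurable_quant _).const_mul _
  have hgm : Measurable g := Finset.measurable_fun_sum _ fun j _ =>
    (θ.measurable_gramMul _).const_mul _
  set A : ℝ := θ.R * ∑ l, |v l| with hA
  set G : ℝ := (θ.R ^ 2 * ∑ l, |θ.β l|) * ∑ l, |v l| with hG
  have hqb : ∀ o, |q o| ≤ A := fun o => by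
    have := abs_sum_mul_le (v := fun j => θ.quant (.inl j) o) (w := v) (b := θ.R) fun j => by
      rw [Params.abs_quant_inl, abs_of_nonneg hR]
    simpa only [hq, mul_comm (v _)] using this
  have hgb : ∀ o, |g o| ≤ G := fun o => by
    have := abs_sum_mul_le (v := fun j => θ.gramMul o j) (w := v) fun j => θ.abs_gramMul_le o j
    simpa only [hg, mul_comm (v _)] using this
  have hA0 : 0 ≤ A := (abs_nonneg _).trans (hqb 0)
  have hG0 : 0 ≤ G := (abs_nonneg _).trans (hgb 0)
  have hi : ∀ {f : Obs d → ℝ} {b : ℝ}, Measurable f → (∀ o, |f o| ≤ b) →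
      Integrable (fun ω => f (obs X ε U i ω)) P := fun hf hb => h.integrable_of_bound i hf hb
  have hqq : Integrable (fun ω => q (obs X ε U i ω) ^ 2) P :=
    hi (f := fun o => q o ^ 2) (hqm.pow_const 2) (b := A ^ 2) fun o => by
      rw [abs_pow]; exact pow_le_pow_left₀ (abs_nonneg _) (hqb o) 2
  have hgg : Integrable (fun ω => g (obs X ε U i ω) ^ 2) P :=
    hi (f := fun o => g o ^ 2) (hgm.pow_const 2) (b := G ^ 2) fun o => by
      rw [abs_pow]; exact pow_le_pow_left₀ (abs_nonneg _) (hgb o) 2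
  have hqgb : ∀ o, |q o * g o| ≤ A * G := fun o => by
    rw [abs_mul]; exact mul_le_mul (hqb o) (hgb o) (abs_nonneg _) hA0
  have hqg : Integrable (fun ω => q (obs X ε U i ω) * g (obs X ε U i ω)) P :=
    hi (f := fun o => q o * g o) (hqm.mul hgm) hqgb
  have hqgY : Integrable (fun ω => q (obs X ε U i ω) * g (obs X ε U i ω) *
      θ.quant (.inr (.inr ())) (obs X ε U i ω)) P :=
    hi (f := fun o => q o * g o * θ.quant (.inr (.inr ())) o)
      ((hqm.mul hgm).mul (θ.measurable_quant _)) (b := A * G * |θ.L|) fun o => by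
        rw [abs_mul, Params.abs_quant_Y]
        exact mul_le_mul_of_nonneg_right (hqgb o) (abs_nonneg _)
  have hcross : ∫ ω, q (obs X ε U i ω) * g (obs X ε U i ω) *
      θ.quant (.inr (.inr ())) (obs X ε U i ω) ∂P =
      ∫ ω, q (obs X ε U i ω) * g (obs X ε U i ω) * m ∂P :=
    h.integral_mul_quant_Y_of_bounded (v := fun o => q o * g o) hR hL hXae hY (hqm.mul hgm) hqgb
      (fun o => by
        simp only [hq, hg]
        simp_rw [θ.gramMul_update_Y]
        congr 1) fun o => rfl
  have hsq : ∫ ω, (v ⬝ᵥ θ.score (obs X ε U i ω)) ^ 2 ∂P =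
      ∫ ω, (θ.L ^ 2 - m ^ 2) * q (obs X ε U i ω) ^ 2 +
        (m * q (obs X ε U i ω) - g (obs X ε U i ω)) ^ 2 ∂P := by
    have e1 : ∀ o, (v ⬝ᵥ θ.score o) ^ 2 = θ.L ^ 2 * q o ^ 2 + g o ^ 2 -
        2 * (q o * g o * θ.quant (.inr (.inr ())) o) := by
      intro o
      have : v ⬝ᵥ θ.score o = θ.quant (.inr (.inr ())) o * q o - g o := by
        simp only [dotProduct, Params.score_eq, hq, hg, Finset.mul_sum, ← Finset.sum_sub_distrib]
        refine Finset.sum_congr rfl fun j _ => by ring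
      rw [this, ← θ.quant_Y_sq o]
      ring
    have e2 : ∀ o, (θ.L ^ 2 - m ^ 2) * q o ^ 2 + (m * q o - g o) ^ 2 =
        θ.L ^ 2 * q o ^ 2 + g o ^ 2 - 2 * (q o * g o * m) := fun o => by ring
    simp_rw [e1, e2]
    have hb := (hqq.const_mul (θ.L ^ 2)).add hgg
    refine (integral_sub hb (hqgY.const_mul 2)).trans
      (Eq.trans ?_ (integral_sub hb ((hqg.mul_const m).const_mul 2)).symm)
    rw [integral_const_mul, integral_const_mul, hcross]
  have hεi := (h.noise.memLp i).integrable (by norm_num : (1 : ℝ≥0∞) ≤ 2)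
  have hε2 := (h.noise.memLp i).integrable_sq
  have hLm : m ^ 2 + θ.σ ^ 2 ≤ θ.L ^ 2 := by
    have i1 : Integrable (fun ω => m ^ 2 + 2 * m * θ.σ * ε i ω) P :=
      (integrable_const _).add (hεi.const_mul _)
    have e : ∫ ω, (m ^ 2 + 2 * m * θ.σ * ε i ω) + θ.σ ^ 2 * ε i ω ^ 2 ∂P = m ^ 2 + θ.σ ^ 2 := by
      rw [integral_add i1 (hε2.const_mul _),
        integral_add (integrable_const _) (hεi.const_mul _), integral_const_mul,
        integral_const_mul, h.noise.integral_eq_zero, h.noise.integral_sq_eq_one]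
      simp
    have e' : ∫ _, θ.L ^ 2 ∂P = θ.L ^ 2 := by simp
    rw [← e, ← e']
    refine integral_mono_ae (i1.add (hε2.const_mul _))
      (integrable_const _) ?_
    filter_upwards [hY] with ω hω
    have h1 : |m + θ.σ * ε i ω| ≤ |θ.L| := by
      rw [abs_of_nonneg hL]
      exact hω
    have h2 := sq_le_sq.2 h1
    linarith [h2]
  have hqi : Integrable (fun ω => q (obs X ε U i ω)) P := hi hqm hqb
  have hqmean : ∫ ω, q (obs X ε U i ω) ∂P = v ⬝ᵥ (x i).ofLp := by
    simp only [hq]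
    rw [integral_finsetSum _ fun j _ => (h.integrable_of_bound i (θ.measurable_quant (.inl j))
      (fun o => θ.abs_quant_le _ o)).const_mul _, dotProduct]
    refine Finset.sum_congr rfl fun j _ => ?_
    rw [integral_const_mul]
    congr 1
    have h1 := h.integral_mul_quant θ hR hL i (.inl j) (v := fun _ => 1) measurable_const (B := 1)
      (by simp) (by simp)
    simp only [one_mul] at h1
    rw [h1, integral_congr_ae ((clipped_X_ae (ε := ε) (U := U) hXae).mono fun ω hω => hω j)]
    simp [hXdef]
  have hqsq : (v ⬝ᵥ (x i).ofLp) ^ 2 ≤ ∫ ω, q (obs X ε U i ω) ^ 2 ∂P := by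
    have h0 : 0 ≤ ∫ ω, (q (obs X ε U i ω) ^ 2 - 2 * (v ⬝ᵥ (x i).ofLp) * q (obs X ε U i ω))
        + (v ⬝ᵥ (x i).ofLp) ^ 2 ∂P :=
      integral_nonneg fun ω => by
        have := sq_nonneg (q (obs X ε U i ω) - v ⬝ᵥ (x i).ofLp)
        change (0 : ℝ) ≤ _
        linarith [this]
    have i1 : Integrable (fun ω => q (obs X ε U i ω) ^ 2 -
        2 * (v ⬝ᵥ (x i).ofLp) * q (obs X ε U i ω)) P := hqq.sub (hqi.const_mul _)
    rw [integral_add i1 (integrable_const _),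
      integral_sub hqq (hqi.const_mul _), integral_const_mul, hqmean] at h0
    simp only [integral_const, probReal_univ, one_smul] at h0
    linarith
  rw [hsq]
  calc θ.σ ^ 2 * (v ⬝ᵥ (x i).ofLp) ^ 2
      ≤ θ.σ ^ 2 * ∫ ω, q (obs X ε U i ω) ^ 2 ∂P := by gcongr
    _ = ∫ ω, θ.σ ^ 2 * q (obs X ε U i ω) ^ 2 ∂P := by rw [integral_const_mul]
    _ ≤ _ := by
      have hint : Integrable (fun ω => (m * q (obs X ε U i ω) - g (obs X ε U i ω)) ^ 2) P :=
        hi (f := fun o => (m * q o - g o) ^ 2) (((hqm.const_mul _).sub hgm).pow_const 2)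
          (b := (|m| * A + G) ^ 2) fun o => by
            rw [abs_pow]
            refine pow_le_pow_left₀ (abs_nonneg _) ((abs_sub _ _).trans ?_) 2
            rw [abs_mul]
            exact add_le_add (mul_le_mul_of_nonneg_left (hqb o) (abs_nonneg _)) (hgb o)
      refine integral_mono (hqq.const_mul _) ((hqq.const_mul _).add hint) fun ω => ?_
      have h1 : θ.σ ^ 2 ≤ θ.L ^ 2 - m ^ 2 := by linarith
      have h2 := mul_le_mul_of_nonneg_right h1 (sq_nonneg (q (obs X ε U i ω)))
      exact h2.trans (le_add_of_nonneg_right (sq_nonneg _))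

end IsModel

end FixedDesign

section FixedDesignLimit

variable {d : ℕ} {Ω : Type*} [MeasurableSpace Ω] {P : Measure Ω} [IsProbabilityMeasure P]
  {ε : ℕ → Ω → ℝ} {U : ℕ → Bit d → Ω → ℝ} {θ : Params d} {x : ℕ → Vec d}
  {Sbar : Matrix (Fin d) (Fin d) ℝ}

omit [IsProbabilityMeasure P] in
lemma scheme_V {X : ℕ → Ω → Vec d}
    (hmean : ∀ i j, ∫ ω, θ.score (obs X ε U i ω) j ∂P = 0) (n : ℕ) (j k : Fin d) :
    (θ.scheme X ε U).V P θ.β n j k = ((n : ℝ) ^ 2)⁻¹ *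
      ∑ i ∈ Finset.range n, ∫ ω, θ.score (obs X ε U i ω) j * θ.score (obs X ε U i ω) k ∂P := by
  unfold Scheme.V
  rw [Matrix.smul_apply, Matrix.sum_apply, smul_eq_mul]
  congr 1
  refine Finset.sum_congr rfl fun i _ => ?_
  rw [Matrix.of_apply]
  simp_rw [Params.scheme_score, covariance, hmean, sub_zero]

lemma dotProduct_mulVec_scheme_V {X : ℕ → Ω → Vec d} (h : IsModel P X ε U)
    (hmean : ∀ i j, ∫ ω, θ.score (obs X ε U i ω) j ∂P = 0) (n : ℕ) (v : Fin d → ℝ) :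
    v ⬝ᵥ (θ.scheme X ε U).V P θ.β n *ᵥ v = ((n : ℝ) ^ 2)⁻¹ *
      ∑ i ∈ Finset.range n, ∫ ω, (v ⬝ᵥ θ.score (obs X ε U i ω)) ^ 2 ∂P := by
  simp_rw [h.integral_sq_dotProduct_score, dotProduct_mulVec_eq_sum, scheme_V hmean]
  simp only [Finset.mul_sum]
  symm
  rw [Finset.sum_comm]
  refine Finset.sum_congr rfl fun j _ => ?_
  rw [Finset.sum_comm]
  refine Finset.sum_congr rfl fun k _ => Finset.sum_congr rfl fun i _ => by ring

omit [IsProbabilityMeasure P] in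
lemma scheme_V_isHermitian {X : ℕ → Ω → Vec d}
    (hmean : ∀ i j, ∫ ω, θ.score (obs X ε U i ω) j ∂P = 0) (n : ℕ) :
    ((θ.scheme X ε U).V P θ.β n).IsHermitian := by
  refine Matrix.IsHermitian.ext fun j k => ?_
  rw [star_trivial, scheme_V hmean, scheme_V hmean]
  simp_rw [mul_comm (θ.score _ k)]

lemma abs_scheme_V_le {X : ℕ → Ω → Vec d}
    (hmean : ∀ i j, ∫ ω, θ.score (obs X ε U i ω) j ∂P = 0) (n : ℕ) (j k : Fin d) :
    |(θ.scheme X ε U).V P θ.β n j k| ≤ θ.scoreBound ^ 2 * (n : ℝ)⁻¹ := by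
  rw [scheme_V hmean, abs_mul, abs_of_nonneg (by positivity)]
  have h1 : |∑ i ∈ Finset.range n, ∫ ω, θ.score (obs X ε U i ω) j *
      θ.score (obs X ε U i ω) k ∂P| ≤ n * θ.scoreBound ^ 2 := by
    refine (Finset.abs_sum_le_sum_abs _ _).trans ?_
    refine (Finset.sum_le_card_nsmul _ _ (θ.scoreBound ^ 2) fun i _ => ?_).trans (by simp)
    refine abs_integral_le_of_ae_abs_le (ae_of_all _ fun ω => ?_)
    rw [abs_mul, sq]
    exact mul_le_mul (θ.abs_score_le _ _) (θ.abs_score_le _ _) (abs_nonneg _)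
      ((abs_nonneg _).trans (θ.abs_score_le (obs X ε U i ω) j))
  refine (mul_le_mul_of_nonneg_left h1 (by positivity)).trans (le_of_eq ?_)
  rcases Nat.eq_zero_or_pos n with rfl | hn
  · simp
  · have : (n : ℝ) ≠ 0 := by exact_mod_cast hn.ne'
    field_simp

lemma dotProduct_mean_vecMulVec_mulVec (n : ℕ) (v : Fin d → ℝ) :
    v ⬝ᵥ ((n : ℝ)⁻¹ • ∑ i ∈ Finset.range n, Matrix.vecMulVec (x i).ofLp (x i).ofLp) *ᵥ v =
      (n : ℝ)⁻¹ * ∑ i ∈ Finset.range n, (v ⬝ᵥ (x i).ofLp) ^ 2 := by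
  rw [Matrix.smul_mulVec, dotProduct_smul, Matrix.sum_mulVec, dotProduct_sum, smul_eq_mul]
  congr 1
  refine Finset.sum_congr rfl fun i _ => ?_
  rw [Matrix.vecMulVec_mulVec, dotProduct_smul, sq, dotProduct_comm (x i).ofLp v]
  simp

lemma eventually_coercive_scheme_V (h : IsModel P (fun i _ => x i) ε U)
    (hσ : θ.σ ≠ 0) (hR : 0 ≤ θ.R) (hL : 0 ≤ θ.L) (hX : ∀ i j, |x i j| ≤ θ.R)
    (hY : ∀ i, ∀ᵐ ω ∂P, |response θ.β θ.σ (fun i _ => x i) ε i ω| ≤ θ.L)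
    (hlim : Tendsto (fun n : ℕ => (n : ℝ)⁻¹ • ∑ i ∈ Finset.range n,
      Matrix.vecMulVec (x i).ofLp (x i).ofLp) atTop (𝓝 Sbar)) (hS : Sbar.PosDef) :
    ∃ c : ℝ, 0 < c ∧ ∀ᶠ n : ℕ in atTop, ∀ v : Fin d → ℝ,
      c * (n : ℝ)⁻¹ * (v ⬝ᵥ v) ≤ v ⬝ᵥ (θ.scheme (fun i _ => x i) ε U).V P θ.β n *ᵥ v := by
  obtain ⟨c, hc, hcS⟩ := exists_coercive_of_posDef hS
  refine ⟨θ.σ ^ 2 * (c / 2), by positivity, ?_⟩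
  have hmean : ∀ i j, ∫ ω, θ.score (obs (fun i _ => x i) ε U i ω) j ∂P = 0 := fun i j =>
    h.integral_score_of_bounded hR hL (ae_of_all _ fun ω j => hX i j) (hY i) j
  filter_upwards [hlim.eventually (eventually_coercive hc hcS)] with n hn v
  rw [dotProduct_mulVec_scheme_V h hmean]
  calc θ.σ ^ 2 * (c / 2) * (n : ℝ)⁻¹ * (v ⬝ᵥ v)
      = θ.σ ^ 2 * (n : ℝ)⁻¹ * (c / 2 * (v ⬝ᵥ v)) := by ring
    _ ≤ θ.σ ^ 2 * (n : ℝ)⁻¹ * ((n : ℝ)⁻¹ * ∑ i ∈ Finset.range n, (v ⬝ᵥ (x i).ofLp) ^ 2) := by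
        rw [← dotProduct_mean_vecMulVec_mulVec]
        exact mul_le_mul_of_nonneg_left (hn v) (by positivity)
    _ = ((n : ℝ) ^ 2)⁻¹ * ∑ i ∈ Finset.range n, θ.σ ^ 2 * (v ⬝ᵥ (x i).ofLp) ^ 2 := by
        rw [← Finset.mul_sum, sq (n : ℝ), mul_inv]; ring
    _ ≤ _ := by
        refine mul_le_mul_of_nonneg_left (Finset.sum_le_sum fun i _ => ?_) (by positivity)
        exact h.sq_le_integral_sq_score hR hL hX i (hY i) v

/-- Asymptotic normality for a fixed design and fixed quantizer ranges. -/
theorem tendstoInDistribution_fixed {bhat : ℕ → Ω → Vec d}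
    (h : IsModel P (fun i _ => x i) ε U)
    (hσ : θ.σ ≠ 0) (hX : ∀ i j, |x i j| ≤ θ.R)
    (hY : ∀ i, ∀ᵐ ω ∂P, |response θ.β θ.σ (fun i _ => x i) ε i ω| ≤ θ.L)
    (hlim : Tendsto (fun n : ℕ => (n : ℝ)⁻¹ • ∑ i ∈ Finset.range n,
      Matrix.vecMulVec (x i).ofLp (x i).ofLp) atTop (𝓝 Sbar)) (hS : Sbar.PosDef)
    (hest : ∀ n, (θ.scheme (fun i _ => x i) ε U).IsEstimator P n (bhat n)) :
    (∀ᶠ n in atTop, ((θ.scheme (fun i _ => x i) ε U).V P θ.β n).PosDef) ∧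
    (∀ j k, (fun n => (θ.scheme (fun i _ => x i) ε U).V P θ.β n j k) =O[atTop]
      fun n : ℕ => (n : ℝ)⁻¹) ∧
    TendstoInDistribution (fun (n : ℕ) ω =>
      matVec (invSqrt ((θ.scheme (fun i _ => x i) ε U).V P θ.β n) * Sbar) (bhat n ω - θ.β))
      atTop id (fun _ => P) (multivariateGaussian 0 1) := by
  have hbm : ∀ n, AEMeasurable (fun ω => bhat n ω - θ.β) P := fun n => (hest n).1.sub_const θ.β
  rcases Nat.eq_zero_or_pos d with rfl | hd
  · refine ⟨Eventually.of_forall fun n => ?_, fun j => j.elim0,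
      tendstoInDistribution_of_subsingleton
        (fun n => (continuous_matVec _).measurable.comp_aemeasurable (hbm n)) aemeasurable_id⟩
    rw [Subsingleton.elim ((θ.scheme (fun i _ => x i) ε U).V P θ.β n) 1]
    exact Matrix.PosDef.one
  have : Nonempty (Fin d) := ⟨⟨0, hd⟩⟩
  have hR : 0 ≤ θ.R := (abs_nonneg _).trans (hX 0 ⟨0, hd⟩)
  have hL : 0 ≤ θ.L := nonneg_of_ae_abs_le (hY 0)
  have hmean : ∀ i j, ∫ ω, θ.score (obs (fun i _ => x i) ε U i ω) j ∂P = 0 := fun i j =>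
    h.integral_score_of_bounded hR hL (ae_of_all _ fun ω j => hX i j) (hY i) j
  obtain ⟨c, hc, hcV⟩ := eventually_coercive_scheme_V h hσ hR hL hX hY hlim hS
  set V := fun n => (θ.scheme (fun i _ => x i) ε U).V P θ.β n with hV
  change ∀ᶠ n : ℕ in atTop, ∀ v : Fin d → ℝ, c * (n : ℝ)⁻¹ * (v ⬝ᵥ v) ≤ v ⬝ᵥ V n *ᵥ v at hcV
  have hVpos : ∀ᶠ n in atTop, (V n).PosDef := by
    filter_upwards [hcV, eventually_gt_atTop 0] with n hn hn0
    have : (0 : ℝ) < n := by exact_mod_cast hn0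
    exact posDef_of_coercive (scheme_V_isHermitian hmean n) (c := c * (n : ℝ)⁻¹) (by positivity) hn
  refine ⟨hVpos, fun j k => ?_, ?_⟩
  · refine Asymptotics.IsBigO.of_bound (θ.scoreBound ^ 2) (Eventually.of_forall fun n => ?_)
    rw [Real.norm_eq_abs, Real.norm_eq_abs, abs_of_nonneg (a := (n : ℝ)⁻¹) (by positivity)]
    exact abs_scheme_V_le hmean n j k
  set H : ℕ → Matrix (Fin d) (Fin d) ℝ := fun n => (√(n : ℝ))⁻¹ • invSqrt (V n) with hH
  have hHT : ∀ n, (H n)ᵀ = H n := fun n => by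
    rw [hH, Matrix.transpose_smul, invSqrt_transpose]
  have hHV : ∀ᶠ n : ℕ in atTop, ∀ v, (n : ℝ) * ((H n *ᵥ v) ⬝ᵥ V n *ᵥ (H n *ᵥ v)) = v ⬝ᵥ v := by
    filter_upwards [hVpos, eventually_gt_atTop 0] with n hn hn0 v
    have hn' : (0 : ℝ) < n := by exact_mod_cast hn0
    have hs : √(n : ℝ) * √(n : ℝ) = n := Real.mul_self_sqrt hn'.le
    have hs0 : √(n : ℝ) ≠ 0 := (Real.sqrt_pos.2 hn').ne'
    simp only [hH, Matrix.smul_mulVec, Matrix.mulVec_smul, dotProduct_smul, smul_dotProduct,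
      smul_eq_mul]
    rw [dotProduct_mulVec_invSqrt hn]
    nth_rewrite 1 [← hs]
    field_simp
  have hHinv : ∀ᶠ n : ℕ in atTop, H n * (√(n : ℝ) • CFC.sqrt (V n)) = 1 := by
    filter_upwards [hVpos, eventually_gt_atTop 0] with n hn hn0
    have hn' : (0 : ℝ) < n := by exact_mod_cast hn0
    have hs0 : √(n : ℝ) ≠ 0 := (Real.sqrt_pos.2 hn').ne'
    simp only [hH, Matrix.smul_mul, Matrix.mul_smul, smul_smul, invSqrt]
    rw [mul_inv_cancel₀ hs0, one_smul, Matrix.nonsing_inv_mul _ (isUnit_det_sqrt hn)]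
  have hHb : ∀ᶠ n : ℕ in atTop, ∀ j k, |H n j k| ≤ √(c⁻¹) := by
    filter_upwards [hcV, hHV, eventually_gt_atTop 0] with n hn hn2 hn0 j k
    have hn' : (0 : ℝ) < n := by exact_mod_cast hn0
    refine Real.abs_le_sqrt ((sq_apply_le_mulVec_single (H n) j k).trans ?_)
    have h1 := hn (H n *ᵥ Pi.single k 1)
    have h2 := hn2 (Pi.single k 1)
    have h3 : (Pi.single k 1 : Fin d → ℝ) ⬝ᵥ Pi.single k 1 = 1 := by simp
    rw [h3] at h2
    have h4 := mul_le_mul_of_nonneg_left h1 hn'.le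
    rw [h2] at h4
    rw [← one_div, le_div_iff₀ hc]
    refine le_trans (le_of_eq ?_) h4
    field_simp
  have hHib : ∀ᶠ n : ℕ in atTop, ∀ j k, |(H n)⁻¹ j k| ≤ √(θ.scoreBound ^ 2) := by
    filter_upwards [hVpos, hHinv, eventually_gt_atTop 0] with n hn hn2 hn0 j k
    have hn' : (0 : ℝ) < n := by exact_mod_cast hn0
    rw [Matrix.inv_eq_right_inv hn2, Matrix.smul_apply, smul_eq_mul]
    refine Real.abs_le_sqrt ?_
    have h1 := sq_apply_le_mulVec_single (CFC.sqrt (V n)) j k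
    rw [sqrt_mulVec_dotProduct_self hn.posSemidef] at h1
    have h2 := (abs_le.1 (abs_scheme_V_le (P := P) (ε := ε) (U := U) hmean n k k)).2
    have h3 : Pi.single k 1 ⬝ᵥ V n *ᵥ Pi.single k 1 = V n k k := by simp
    rw [h3] at h1
    rw [mul_pow, Real.sq_sqrt hn'.le]
    calc (n : ℝ) * CFC.sqrt (V n) j k ^ 2 ≤ n * (θ.scoreBound ^ 2 * (n : ℝ)⁻¹) :=
          mul_le_mul_of_nonneg_left (h1.trans h2) hn'.le
      _ = θ.scoreBound ^ 2 := by field_simp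
  have hmain := tendstoInDistribution_scheme (X := fun i _ => x i) (ε := ε) (P := P)
    (U := fun _ => U) (θ := fun _ => θ) (β := θ.β)
    (bhat := bhat) (Sig := Sbar) (Γ := 1) (H := H) (μ := fun _ => 0)
    (B := √(c⁻¹) * (d * θ.scoreBound))
    (κ := √(c⁻¹) * √(θ.scoreBound ^ 2)) (fun _ => h) (fun _ => rfl) hest
    (tendsto_const_div_atTop_nhds_zero_nat _) ?_ hS Matrix.PosSemidef.one ?_ ?_ ?_ ?_ (by simp) ?_
  · refine hmain.congr (fun n => ae_of_all _ fun ω => ?_) ae_eq_rfl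
    simp only [hH]
    rcases Nat.eq_zero_or_pos n with rfl | hn
    · have hV0 : V 0 = 0 := by
        ext j k
        simp [hV, scheme_V hmean]
      have hV1 : invSqrt (V 0) = 0 := by
        rw [hV0]
        simp [invSqrt]
      change _ = matVec (invSqrt (V 0) * Sbar) _
      rw [hV1]
      ext j
      simp [matVec]
    · have hs0 : √(n : ℝ) ≠ 0 := (Real.sqrt_pos.2 (by exact_mod_cast hn)).ne'
      simp only [matVec]
      rw [Matrix.smul_mul, Matrix.smul_mulVec, WithLp.toLp_smul, smul_smul, mul_inv_cancel₀ hs0,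
        one_smul]
  · intro j k
    have h1 : Tendsto (fun n : ℕ => ((n : ℝ)⁻¹ • ∑ i ∈ Finset.range n,
      Matrix.vecMulVec (x i).ofLp (x i).ofLp) j k) atTop (𝓝 (Sbar j k)) :=
      ((continuous_id.matrix_elem j k).tendsto Sbar).comp hlim
    refine h1.congr fun n => ?_
    rw [Matrix.smul_apply, Matrix.sum_apply, smul_eq_mul]
    congr 1
    refine Finset.sum_congr rfl fun i _ => ?_
    rw [h.integral_gram_of_bounded hR hL (ae_of_all _ fun ω j => hX i j)]
    simp [Matrix.vecMulVec_apply]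
  · filter_upwards [hHinv] with n hn
    exact (Matrix.isUnit_iff_isUnit_det _).1 (IsUnit.of_mul_eq_one _ hn)
  · filter_upwards [hHb, hHib] with n h1 h2 j a b k
    rw [abs_mul]
    exact mul_le_mul (h1 _ _) (h2 _ _) (abs_nonneg _) (Real.sqrt_nonneg _)
  · filter_upwards [hHb] with n h1 o j
    refine (abs_sum_mul_le (h1 j)).trans (mul_le_mul_of_nonneg_left ?_ (Real.sqrt_nonneg _))
    refine (Finset.sum_le_card_nsmul _ _ θ.scoreBound fun l _ => θ.abs_score_le o l).trans ?_
    simp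
  · refine Eventually.of_forall fun n i _ j => ?_
    simp only [Matrix.mulVec, dotProduct]
    rw [integral_finsetSum _ fun k _ => (h.integrable_score θ i k).const_mul _]
    simp_rw [integral_const_mul, hmean]
    simp
  · intro t
    refine tendsto_const_nhds.congr' ?_
    filter_upwards [hHV, eventually_gt_atTop 0] with n hn hn0
    have hn' : (n : ℝ) ≠ 0 := by exact_mod_cast hn0.ne'
    rw [Matrix.one_mulVec, ← hn t, dotProduct_mulVec_scheme_V h hmean]
    simp_rw [dotProduct_mulVec_symm (hHT n)]
    field_simp

end FixedDesignLimit

section SubGaussian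

variable {Ω : Type*} [MeasurableSpace Ω] {P : Measure Ω} {Z W : Ω → ℝ}

lemma exists_of_psiTwo_lt {k : ℝ} (h : psiTwo P Z < ENNReal.ofReal k) :
    ∃ t : ℝ, 0 < t ∧ t < k ∧ ∫⁻ ω, ENNReal.ofReal (Real.exp (|Z ω| ^ 2 / t ^ 2)) ∂P ≤ 2 := by
  obtain ⟨s, ⟨t, ht, rfl, hs⟩, hlt⟩ := sInf_lt_iff.1 h
  exact ⟨t, ht, (ENNReal.ofReal_lt_ofReal_iff_of_nonneg ht.le).1 hlt, hs⟩

lemma psiTwo_le_of_abs_le {c k : ℝ} (hc : 0 < c) (hWZ : ∀ ω, |W ω| ≤ c * |Z ω|)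
    (h : psiTwo P Z < ENNReal.ofReal k) : psiTwo P W ≤ ENNReal.ofReal (c * k) := by
  obtain ⟨t, ht, htk, hint⟩ := exists_of_psiTwo_lt h
  refine le_trans (sInf_le ⟨c * t, by positivity, rfl, le_trans (lintegral_mono fun ω => ?_) hint⟩)
    (ENNReal.ofReal_le_ofReal (by gcongr))
  refine ENNReal.ofReal_le_ofReal (Real.exp_le_exp.2 ?_)
  rw [mul_pow, ← div_div]
  refine div_le_div_of_nonneg_right ?_ (by positivity)
  rw [div_le_iff₀ (by positivity), mul_comm, ← mul_pow]
  exact pow_le_pow_left₀ (abs_nonneg _) (hWZ ω) 2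

lemma measure_le_abs_le_of_lintegral_exp_le {t : ℝ} (hZ : Measurable Z)
    (h : ∫⁻ ω, ENNReal.ofReal (Real.exp (|Z ω| ^ 2 / t ^ 2)) ∂P ≤ 2) {u : ℝ} (hu : 0 ≤ u) :
    P {ω | u ≤ |Z ω|} ≤ ENNReal.ofReal (2 * Real.exp (-(u ^ 2 / t ^ 2))) := by
  have hm : Measurable fun ω => ENNReal.ofReal (Real.exp (|Z ω| ^ 2 / t ^ 2)) := by
    have : Measurable fun ω => |Z ω| := by simpa [Real.norm_eq_abs] using hZ.norm
    fun_prop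
  have h1 := (mul_meas_ge_le_lintegral (μ := P) hm
    (ENNReal.ofReal (Real.exp (u ^ 2 / t ^ 2)))).trans h
  have h2 : {ω | u ≤ |Z ω|} ⊆ {ω | ENNReal.ofReal (Real.exp (u ^ 2 / t ^ 2)) ≤
      ENNReal.ofReal (Real.exp (|Z ω| ^ 2 / t ^ 2))} := by
    intro ω hω
    have hω' : u ≤ |Z ω| := hω
    refine ENNReal.ofReal_le_ofReal (Real.exp_le_exp.2 ?_)
    exact div_le_div_of_nonneg_right (pow_le_pow_left₀ hu hω' 2) (sq_nonneg t)
  refine (measure_mono h2).trans ?_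
  rw [Real.exp_neg, mul_comm, ENNReal.ofReal_mul (by positivity),
    ENNReal.ofReal_inv_of_pos (Real.exp_pos _), mul_comm, ← div_eq_mul_inv,
    ENNReal.le_div_iff_mul_le (Or.inl (by simp [Real.exp_pos])) (Or.inl ENNReal.ofReal_ne_top),
    mul_comm]
  simpa using h1

lemma one_le_of_lintegral_exp_le [IsProbabilityMeasure P] {t : ℝ} (ht : 0 < t)
    (hvar : ∫ ω, Z ω ^ 2 ∂P = 1)
    (h : ∫⁻ ω, ENNReal.ofReal (Real.exp (|Z ω| ^ 2 / t ^ 2)) ∂P ≤ 2) : 1 ≤ t := by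
  have hi : Integrable (fun ω => Z ω ^ 2) P :=
    Integrable.of_integral_ne_zero (by rw [hvar]; exact one_ne_zero)
  have h1 : ∫⁻ ω, ENNReal.ofReal (1 + Z ω ^ 2 / t ^ 2) ∂P ≤ 2 := by
    refine le_trans (lintegral_mono fun ω => ENNReal.ofReal_le_ofReal ?_) h
    rw [sq_abs, add_comm]
    exact Real.add_one_le_exp _
  have hi1 : Integrable (fun ω => 1 + Z ω ^ 2 / t ^ 2) P :=
    (integrable_const _).add (hi.div_const _)
  rw [← ofReal_integral_eq_lintegral_ofReal hi1
    (ae_of_all _ fun ω => by positivity), integral_add (integrable_const _) (hi.div_const _),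
    integral_div, hvar] at h1
  simp only [integral_const, probReal_univ, one_smul] at h1
  rw [show (2 : ℝ≥0∞) = ENNReal.ofReal 2 by simp, ENNReal.ofReal_le_ofReal_iff (by norm_num)] at h1
  have h2 : 1 / t ^ 2 ≤ 1 := by linarith
  rw [div_le_one (by positivity)] at h2
  nlinarith

lemma one_le_psiTwo [IsProbabilityMeasure P] (hvar : ∫ ω, Z ω ^ 2 ∂P = 1) : 1 ≤ psiTwo P Z := by
  refine le_sInf ?_
  rintro s ⟨t, ht, rfl, h⟩
  rw [← ENNReal.ofReal_one]
  exact ENNReal.ofReal_le_ofReal (one_le_of_lintegral_exp_le ht hvar h)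

/-- A sub-Gaussian variable rarely exceeds a logarithmic range. -/
lemma measure_lt_abs_le {k C : ℝ} (hk : 0 < k) (hC : 1 / 2 ≤ C) (hZ : Measurable Z)
    (h : psiTwo P Z ≤ ENNReal.ofReal k) {n : ℕ} (hn : 0 < n) {u : ℝ} (hu : 0 ≤ u)
    (hu2 : 6 * (C * k ^ 2) * Real.log n ≤ u ^ 2) :
    P {ω | u < |Z ω|} ≤ ENNReal.ofReal (2 * ((n : ℝ) ^ 2)⁻¹) := by
  have hk1 : psiTwo P Z < ENNReal.ofReal (√(3 / 2) * k) := by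
    refine h.trans_lt ((ENNReal.ofReal_lt_ofReal_iff (by positivity)).2 ?_)
    have : 1 < √(3 / 2) := by rw [Real.lt_sqrt (by norm_num)]; norm_num
    nlinarith
  obtain ⟨t, ht, htk, hint⟩ := exists_of_psiTwo_lt hk1
  have hn' : (0 : ℝ) < n := by exact_mod_cast hn
  have hlog : 0 ≤ Real.log n := Real.log_natCast_nonneg n
  have ht2 : t ^ 2 ≤ 3 / 2 * k ^ 2 := by
    calc t ^ 2 ≤ (√(3 / 2) * k) ^ 2 := pow_le_pow_left₀ ht.le htk.le 2
      _ = 3 / 2 * k ^ 2 := by rw [mul_pow, Real.sq_sqrt (by norm_num)]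
  have hle : 2 * Real.log n ≤ u ^ 2 / t ^ 2 := by
    rw [le_div_iff₀ (by positivity)]
    refine le_trans ?_ hu2
    calc 2 * Real.log n * t ^ 2 ≤ 2 * Real.log n * (3 / 2 * k ^ 2) := by gcongr
      _ = 6 * (1 / 2 * k ^ 2) * Real.log n := by ring
      _ ≤ 6 * (C * k ^ 2) * Real.log n := by gcongr
  have hsub : {ω | u < |Z ω|} ⊆ {ω | u ≤ |Z ω|} := fun ω (hω : u < |Z ω|) => hω.le
  refine (measure_mono hsub).trans
    ((measure_le_abs_le_of_lintegral_exp_le hZ hint hu).trans (ENNReal.ofReal_le_ofReal ?_))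
  gcongr
  rw [Real.exp_neg]
  refine inv_anti₀ (by positivity) ?_
  calc (n : ℝ) ^ 2 = Real.exp (2 * Real.log n) := by
        rw [mul_comm, Real.exp_mul, Real.exp_log hn']; norm_cast
    _ ≤ _ := Real.exp_le_exp.2 hle

variable {d : ℕ} {X : Ω → Vec d}

lemma psiTwo_inner_le_psiTwoVec {v : Vec d} (hv : ‖v‖ = 1) :
    psiTwo P (fun ω => inner ℝ (X ω) v) ≤ psiTwoVec P X :=
  le_iSup (fun v : {v : Vec d // ‖v‖ = 1} => psiTwo P (fun ω => inner ℝ (X ω) v.1)) ⟨v, hv⟩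

lemma psiTwo_apply_le_psiTwoVec (j : Fin d) : psiTwo P (fun ω => X ω j) ≤ psiTwoVec P X := by
  have h := psiTwo_inner_le_psiTwoVec (P := P) (X := X) (v := EuclideanSpace.single j (1 : ℝ))
    (by simp)
  simpa [EuclideanSpace.inner_single_right] using h

lemma inner_matVec_of_transpose_eq {A : Matrix (Fin d) (Fin d) ℝ} (hA : Aᵀ = A) (v w : Vec d) :
    inner ℝ (matVec A v) w = inner ℝ v (matVec A w) := by
  simp only [matVec, EuclideanSpace.inner_eq_star_dotProduct, star_trivial]
  rw [dotProduct_mulVec_symm hA]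

lemma exists_norm_matVec_le (A : Matrix (Fin d) (Fin d) ℝ) :
    ∃ M : ℝ, 0 < M ∧ ∀ v : Vec d, ‖v‖ = 1 → ‖matVec A v‖ ≤ M := by
  obtain ⟨M, hM⟩ := (isCompact_sphere (0 : Vec d) 1).exists_bound_of_continuousOn
    (continuous_matVec A).continuousOn
  refine ⟨max M 1, by positivity, fun v hv => (hM v (by simpa using hv)).trans (le_max_left _ _)⟩

lemma psiTwoVec_matVec_lt_top {A : Matrix (Fin d) (Fin d) ℝ} (hA : Aᵀ = A)
    (h : psiTwoVec P X < ∞) : psiTwoVec P (fun ω => matVec A (X ω)) < ∞ := by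
  obtain ⟨M, hM, hAM⟩ := exists_norm_matVec_le A
  set k : ℝ := (psiTwoVec P X).toReal + 1 with hk
  have hk1 : psiTwoVec P X < ENNReal.ofReal k := by
    rw [hk, ENNReal.lt_ofReal_iff_toReal_lt h.ne]
    linarith
  refine lt_of_le_of_lt (iSup_le fun v => ?_) (ENNReal.ofReal_lt_top (r := M * k))
  simp_rw [inner_matVec_of_transpose_eq hA]
  rcases eq_or_ne (matVec A v.1) 0 with h0 | h0
  · obtain ⟨w, hw⟩ : ∃ w : Vec d, ‖w‖ = 1 := ⟨v.1, v.2⟩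
    refine psiTwo_le_of_abs_le hM (Z := fun ω => inner ℝ (X ω) w) (fun ω => ?_)
      ((psiTwo_inner_le_psiTwoVec hw).trans_lt hk1)
    rw [h0, inner_zero_right, abs_zero]
    positivity
  · refine psiTwo_le_of_abs_le hM
      (Z := fun ω => inner ℝ (X ω) (‖matVec A v.1‖⁻¹ • matVec A v.1)) (fun ω => ?_)
      ((psiTwo_inner_le_psiTwoVec (norm_smul_inv_norm h0)).trans_lt hk1)
    have hp : 0 < ‖matVec A v.1‖ := norm_pos_iff.2 h0
    rw [inner_smul_right, abs_mul, abs_inv, abs_norm, ← mul_assoc]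
    refine le_mul_of_one_le_left (abs_nonneg _) ?_
    rw [← div_eq_mul_inv, one_le_div hp]
    exact hAM _ v.2

/-- Standardized vectors have directional variance one. -/
lemma integral_sq_inner_invSqrt {Sig : Matrix (Fin d) (Fin d) ℝ} (hSig : Sig.PosDef)
    (hS : Sig = Matrix.of fun j k => ∫ ω, X ω j * X ω k ∂P)
    (hX : ∀ j, MemLp (fun ω => X ω j) 2 P) {v : Vec d} (hv : ‖v‖ = 1) :
    ∫ ω, (inner ℝ (matVec (invSqrt Sig) (X ω)) v : ℝ) ^ 2 ∂P = 1 := by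
  simp_rw [inner_matVec_of_transpose_eq (invSqrt_transpose Sig)]
  set w := matVec (invSqrt Sig) v with hw
  have e : ∀ ω, (inner ℝ (X ω) w : ℝ) ^ 2 = ∑ j, ∑ k, w j * w k * (X ω j * X ω k) := by
    intro ω
    rw [EuclideanSpace.inner_eq_star_dotProduct, star_trivial, sq_dotProduct_eq_sum]
  simp_rw [e]
  have hi : ∀ j k, Integrable (fun ω => X ω j * X ω k) P := fun j k => (hX j).integrable_mul (hX k)
  rw [integral_finsetSum _ fun j _ => integrable_finsetSum _ fun k _ => (hi j k).const_mul _]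
  simp_rw [integral_finsetSum _ fun k _ => (hi _ k).const_mul _, integral_const_mul]
  have h1 := dotProduct_mulVec_invSqrt hSig v.ofLp
  rw [dotProduct_mulVec_eq_sum, dotProduct_self_eq_norm_sq] at h1
  have h2 : (WithLp.toLp 2 v.ofLp : Vec d) = v := rfl
  rw [h2, hv, one_pow] at h1
  rw [← h1]
  refine Finset.sum_congr rfl fun j _ => Finset.sum_congr rfl fun k _ => ?_
  nth_rewrite 3 [hS]
  rfl

end SubGaussian

section Ranges

variable {d : ℕ} {Ω : Type*} [MeasurableSpace Ω] {P : Measure Ω} {X : ℕ → Ω → Vec d}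
  {ε : ℕ → Ω → ℝ} {C σ : ℝ} {β : Vec d} {Sig : Matrix (Fin d) (Fin d) ℝ}

lemma IsSubGaussianDesign.memLp (hX : IsSubGaussianDesign P X) (hm : Measurable (X 0)) (j : Fin d) :
    MemLp (fun ω => X 0 ω j) 2 P :=
  (memLp_two_iff_integrable_sq (by fun_prop : Measurable fun ω => X 0 ω j).aestronglyMeasurable).2
    (Integrable.of_integral_ne_zero (by rw [hX.var j]; exact one_ne_zero))

lemma iSup_psiTwo_lt_top (hX : IsSubGaussianDesign P X) :
    ⨆ j : Fin d, psiTwo P (fun ω => X 0 ω j) < ∞ :=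
  lt_of_le_of_lt (iSup_le fun j => psiTwo_apply_le_psiTwoVec (X := X 0) j) hX.subGaussian

variable [IsProbabilityMeasure P]

lemma one_le_toReal_iSup_psiTwo (hX : IsSubGaussianDesign P X) (j : Fin d) :
    1 ≤ (⨆ j : Fin d, psiTwo P (fun ω => X 0 ω j)).toReal := by
  rw [← ENNReal.ofReal_le_iff_le_toReal (iSup_psiTwo_lt_top hX).ne, ENNReal.ofReal_one]
  exact (one_le_psiTwo (hX.var j)).trans (le_iSup (fun j => psiTwo P (fun ω => X 0 ω j)) j)

omit [IsProbabilityMeasure P] in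
lemma log_mul_natCast (hd : 0 < d) {n : ℕ} (hn : 0 < n) :
    Real.log (n * d) = Real.log n + Real.log d :=
  Real.log_mul (by exact_mod_cast hn.ne') (by exact_mod_cast hd.ne')

omit [IsProbabilityMeasure P] in
lemma rangeX_sq (hC : 0 ≤ C) (hd : 0 < d) {n : ℕ} (hn : 0 < n) :
    rangeX P C 2 X n ^ 2 = 6 * (C * (⨆ j : Fin d, psiTwo P (fun ω => X 0 ω j)).toReal ^ 2) *
      (Real.log n + Real.log d) := by
  have h1 := Real.log_natCast_nonneg n
  have h2 := Real.log_natCast_nonneg d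
  unfold rangeX
  rw [log_mul_natCast hd hn, Real.sq_sqrt (by positivity)]
  ring

lemma measure_rangeX_lt_le (hX : IsSubGaussianDesign P X) (hm : Measurable (X 0)) (hC : 1 / 2 ≤ C)
    (j : Fin d) {n : ℕ} (hn : 0 < n) :
    P {ω | rangeX P C 2 X n < |X 0 ω j|} ≤ ENNReal.ofReal (2 * ((n : ℝ) ^ 2)⁻¹) := by
  have hd : 0 < d := j.pos
  have hK := one_le_toReal_iSup_psiTwo hX j
  refine measure_lt_abs_le (lt_of_lt_of_le one_pos hK) hC (by fun_prop) ?_ hn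
    (Real.sqrt_nonneg _) ?_
  · rw [ENNReal.ofReal_toReal (iSup_psiTwo_lt_top hX).ne]
    exact le_iSup (fun j => psiTwo P (fun ω => X 0 ω j)) j
  · rw [rangeX_sq (by linarith) hd hn]
    have h2 := Real.log_natCast_nonneg d
    gcongr
    linarith

lemma measure_lt_abs_dotProduct_le (hX : IsSubGaussianDesign P X) (hm : Measurable (X 0)) (hC : 1 / 2 ≤ C)
    (hS : Sig = Matrix.of fun j k => ∫ ω, X 0 ω j * X 0 ω k ∂P) (hSig : Sig.PosDef) (β : Vec d)
    {n : ℕ} (hn : 0 < n) :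
    P {ω | √(2 * (2 + 1) * (C * (psiTwoVec P (fun ω => matVec (invSqrt Sig) (X 0 ω))).toReal ^ 2))
      * ‖matVec (CFC.sqrt Sig) β‖ * √(Real.log n) < |(X 0 ω).ofLp ⬝ᵥ β.ofLp|} ≤
        ENNReal.ofReal (2 * ((n : ℝ) ^ 2)⁻¹) := by
  set K' := (psiTwoVec P (fun ω => matVec (invSqrt Sig) (X 0 ω))).toReal with hK'
  have hfin := psiTwoVec_matVec_lt_top (invSqrt_transpose Sig) hX.subGaussian
  set w := matVec (CFC.sqrt Sig) β with hw
  have hu := isUnit_det_sqrt hSig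
  have hinner : ∀ ω, (X 0 ω).ofLp ⬝ᵥ β.ofLp = inner ℝ (matVec (invSqrt Sig) (X 0 ω)) w := by
    intro ω
    rw [inner_matVec_of_transpose_eq (invSqrt_transpose Sig)]
    have : matVec (invSqrt Sig) w = β := by
      ext j
      simp only [hw, matVec, invSqrt, Matrix.mulVec_mulVec, Matrix.nonsing_inv_mul _ hu,
        Matrix.one_mulVec]
    rw [this, EuclideanSpace.inner_eq_star_dotProduct, star_trivial, dotProduct_comm]
  rcases eq_or_ne w 0 with h0 | h0
  · have : {ω | √(2 * (2 + 1) * (C * K' ^ 2)) * ‖w‖ * √(Real.log n) <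
        |(X 0 ω).ofLp ⬝ᵥ β.ofLp|} = ∅ := by
      ext ω
      simp [hinner, h0]
    rw [this, measure_empty]
    exact zero_le
  · have hp : 0 < ‖w‖ := norm_pos_iff.2 h0
    have hv : ‖‖w‖⁻¹ • w‖ = 1 := norm_smul_inv_norm h0
    set v := ‖w‖⁻¹ • w with hvdef
    have hle := psiTwo_inner_le_psiTwoVec (P := P)
      (X := fun ω => matVec (invSqrt Sig) (X 0 ω)) hv
    have hone := one_le_psiTwo
      (integral_sq_inner_invSqrt hSig hS (hX.memLp hm) hv)
    have hK1 : 1 ≤ K' := by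
      rw [hK', ← ENNReal.ofReal_le_iff_le_toReal hfin.ne, ENNReal.ofReal_one]
      exact hone.trans hle
    have hlog := Real.log_natCast_nonneg n
    have hmeas : Measurable fun ω => (inner ℝ (matVec (invSqrt Sig) (X 0 ω)) v : ℝ) := by
      have := (continuous_matVec (invSqrt Sig)).measurable.comp hm
      exact Measurable.inner this measurable_const
    refine le_trans (measure_mono ?_) (measure_lt_abs_le (k := K')
      (u := √(2 * (2 + 1) * (C * K' ^ 2)) * √(Real.log n))
      (lt_of_lt_of_le one_pos hK1) hC hmeas (by rwa [hK', ENNReal.ofReal_toReal hfin.ne]) hn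
      (by positivity) ?_)
    · intro ω hω
      rw [Set.mem_ofPred_eq] at hω ⊢
      rw [hinner] at hω
      rw [hvdef, inner_smul_right, abs_mul, abs_of_pos (inv_pos.2 hp), inv_mul_eq_div,
        lt_div_iff₀ hp]
      refine lt_of_eq_of_lt ?_ hω
      ring
    · rw [mul_pow, Real.sq_sqrt hlog, Real.sq_sqrt (by positivity)]
      exact le_of_eq (by ring)

/-- With high probability the quantizers do not truncate. -/
lemma measure_notMem_range_le (hX : IsSubGaussianDesign P X) (hm : Measurable (X 0))
    (hε : IsNoise P ε) (hεsub : psiTwo P (ε 0) < ∞) (hσ : 0 < σ) (hC : 1 / 2 ≤ C)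
    (hS : Sig = Matrix.of fun j k => ∫ ω, X 0 ω j * X 0 ω k ∂P) (hSig : Sig.PosDef)
    {n : ℕ} (hn : 0 < n) :
    P.real {ω | ¬((∀ j, |X 0 ω j| ≤ rangeX P C 2 X n) ∧
      |response β σ X ε 0 ω| ≤ rangeY P C 2 β σ Sig X ε n)} ≤ (2 * d + 4) * ((n : ℝ) ^ 2)⁻¹ := by
  set K'' := (psiTwo P (ε 0)).toReal with hK''
  have hK1 : 1 ≤ K'' := by
    rw [hK'', ← ENNReal.ofReal_le_iff_le_toReal hεsub.ne, ENNReal.ofReal_one]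
    exact one_le_psiTwo hε.var
  have hlog := Real.log_natCast_nonneg n
  set u1 := √(2 * (2 + 1) * (C * (psiTwoVec P (fun ω => matVec (invSqrt Sig) (X 0 ω))).toReal ^ 2))
    * ‖matVec (CFC.sqrt Sig) β‖ * √(Real.log n) with hu1
  set u2 := √(2 * (2 + 1) * (C * K'' ^ 2)) * √(Real.log n) with hu2
  have h1 := measure_lt_abs_dotProduct_le hX hm hC hS hSig β hn
  have h2 : P {ω | u2 < |ε 0 ω|} ≤ ENNReal.ofReal (2 * ((n : ℝ) ^ 2)⁻¹) := by
    refine measure_lt_abs_le (k := K'') (lt_of_lt_of_le one_pos hK1) hC (hε.meas 0)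
      (by rw [hK'', ENNReal.ofReal_toReal hεsub.ne]) hn (by positivity) ?_
    rw [hu2, mul_pow, Real.sq_sqrt hlog, Real.sq_sqrt (by positivity)]
    exact le_of_eq (by ring)
  have hL : rangeY P C 2 β σ Sig X ε n = u1 + σ * u2 := by
    simp only [rangeY, hu1, hu2]
    ring
  have hsub : {ω | ¬((∀ j, |X 0 ω j| ≤ rangeX P C 2 X n) ∧
      |response β σ X ε 0 ω| ≤ rangeY P C 2 β σ Sig X ε n)} ⊆
      (⋃ j, {ω | rangeX P C 2 X n < |X 0 ω j|}) ∪
        ({ω | u1 < |(X 0 ω).ofLp ⬝ᵥ β.ofLp|} ∪ {ω | u2 < |ε 0 ω|}) := by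
    intro ω
    contrapose
    intro hω
    simp only [Set.mem_union, Set.mem_iUnion, Set.mem_ofPred_eq, not_or, not_exists, not_lt] at hω
    rw [Set.mem_ofPred_eq, not_not]
    refine ⟨hω.1, ?_⟩
    rw [hL]
    refine (abs_add_le _ _).trans (add_le_add hω.2.1 ?_)
    rw [abs_mul, abs_of_pos hσ]
    exact mul_le_mul_of_nonneg_left hω.2.2 hσ.le
  have hb0 : 0 ≤ 2 * ((n : ℝ) ^ 2)⁻¹ := by positivity
  have h3 : P (⋃ j, {ω | rangeX P C 2 X n < |X 0 ω j|}) ≤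
      ENNReal.ofReal (d * (2 * ((n : ℝ) ^ 2)⁻¹)) := by
    refine (measure_iUnion_fintype_le _ _).trans ?_
    refine (Finset.sum_le_card_nsmul _ _ _ fun j _ =>
      measure_rangeX_lt_le hX hm hC j hn).trans (le_of_eq ?_)
    rw [ENNReal.ofReal_mul (by positivity)]
    simp
  refine ENNReal.toReal_le_of_le_ofReal (by positivity) ((measure_mono hsub).trans
    ((measure_union_le _ _).trans ((add_le_add h3 ((measure_union_le _ _).trans
      (add_le_add h1 h2))).trans (le_of_eq ?_))))
  rw [← ENNReal.ofReal_add hb0 hb0, ← ENNReal.ofReal_add (by positivity) (by positivity)]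
  congr 1
  ring

omit [IsProbabilityMeasure P] in
lemma tendsto_log_natCast : Tendsto (fun n : ℕ => Real.log n) atTop atTop :=
  Real.tendsto_log_atTop.comp tendsto_natCast_atTop_atTop

lemma exists_tendsto_rangeX_sq_div_log (hX : IsSubGaussianDesign P X) (hC : 1 / 2 ≤ C)
    (hd : 0 < d) :
    ∃ r : ℝ, 0 < r ∧ Tendsto (fun n : ℕ => rangeX P C 2 X n ^ 2 / Real.log n) atTop (𝓝 r) := by
  set K := (⨆ j : Fin d, psiTwo P (fun ω => X 0 ω j)).toReal with hK
  have hK1 : 1 ≤ K := one_le_toReal_iSup_psiTwo hX ⟨0, hd⟩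
  refine ⟨6 * (C * K ^ 2), by positivity, ?_⟩
  have h1 : Tendsto (fun n : ℕ => 6 * (C * K ^ 2) * (1 + Real.log d / Real.log n)) atTop
      (𝓝 (6 * (C * K ^ 2) * (1 + 0))) :=
    (tendsto_const_nhds.add (tendsto_const_nhds.div_atTop tendsto_log_natCast)).const_mul _
  rw [add_zero, mul_one] at h1
  refine h1.congr' ?_
  filter_upwards [eventually_gt_atTop 1] with n hn
  have hlog : 0 < Real.log n := Real.log_pos (by exact_mod_cast hn)
  rw [rangeX_sq (by linarith) hd (by lia), ← hK]
  field_simp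

lemma exists_tendsto_rangeY_sq_div_log (hε : IsNoise P ε) (hεsub : psiTwo P (ε 0) < ∞)
    (hσ : 0 < σ) (hC : 1 / 2 ≤ C) :
    ∃ r : ℝ, 0 < r ∧
      Tendsto (fun n : ℕ => rangeY P C 2 β σ Sig X ε n ^ 2 / Real.log n) atTop (𝓝 r) := by
  set K'' := (psiTwo P (ε 0)).toReal with hK''
  have hK1 : 1 ≤ K'' := by
    rw [hK'', ← ENNReal.ofReal_le_iff_le_toReal hεsub.ne, ENNReal.ofReal_one]
    exact one_le_psiTwo hε.var
  have hp : 0 < √(2 * (2 + 1) * (C * K'' ^ 2)) := Real.sqrt_pos.2 (by positivity)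
  refine ⟨(√(2 * (2 + 1) * (C * (psiTwoVec P (fun ω => matVec (invSqrt Sig) (X 0 ω))).toReal ^ 2))
    * ‖matVec (CFC.sqrt Sig) β‖ + σ * √(2 * (2 + 1) * (C * K'' ^ 2))) ^ 2, by positivity, ?_⟩
  refine tendsto_const_nhds.congr' ?_
  filter_upwards [eventually_gt_atTop 1] with n hn
  have hlog : 0 < Real.log n := Real.log_pos (by exact_mod_cast hn)
  simp only [rangeY]
  rw [mul_pow, Real.sq_sqrt hlog.le, mul_div_assoc, div_self hlog.ne', mul_one]

end Ranges

/-- The limit of `E[G_{jl} G_{km}] / R⁴`, where `G = X̃ X̃ᵀ + Δ` and `R → ∞`. -/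
def pairing {d : ℕ} (j l k m : Fin d) : ℝ :=
  if j ≠ l ∧ (k = j ∧ m = l ∨ k = l ∧ m = j) then 1 else 0

/-- The limit of `E[G β βᵀ G] / R⁴`, where `G = X̃ X̃ᵀ + Δ` and `R → ∞`. -/
def pairingMatrix {d : ℕ} (β : Vec d) : Matrix (Fin d) (Fin d) ℝ :=
  Matrix.of fun j k => ∑ l, ∑ m, β l * β m * pairing j l k m

section Pairing

variable {d : ℕ}

lemma sum_sum_mul_pairing (v w : Fin d → ℝ) (j l : Fin d) :
    ∑ k, ∑ m, v k * w m * pairing j l k m = if j = l then 0 else v j * w l + v l * w j := by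
  by_cases h : j = l
  · simp [pairing, h]
  · have e : ∀ k m, v k * w m * pairing j l k m =
        (if k = j then v k else 0) * (if m = l then w m else 0) +
        (if k = l then v k else 0) * (if m = j then w m else 0) := by
      intro k m
      unfold pairing
      by_cases h1 : k = j
      · subst h1
        by_cases h2 : m = l <;> simp [h, h2]
      · by_cases h3 : k = l
        · subst h3
          by_cases h4 : m = j <;> simp [h, h4, h1]
        · simp [h1, h3]
    simp_rw [e, Finset.sum_add_distrib, ← Finset.mul_sum, ← Finset.sum_mul]
    simp [h]

lemma pairingMatrix_nonneg (β : Vec d) (v : Fin d → ℝ) : 0 ≤ v ⬝ᵥ pairingMatrix β *ᵥ v := by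
  have h1 : v ⬝ᵥ pairingMatrix β *ᵥ v =
      ∑ j, ∑ l, v j * β l * (if j = l then 0 else v j * β l + v l * β j) := by
    simp_rw [← sum_sum_mul_pairing, dotProduct_mulVec_eq_sum, pairingMatrix, Matrix.of_apply]
    refine Finset.sum_congr rfl fun j _ => ?_
    simp_rw [Finset.mul_sum]
    rw [Finset.sum_comm]
    refine Finset.sum_congr rfl fun l _ => Finset.sum_congr rfl fun k _ =>
      Finset.sum_congr rfl fun m _ => by ring
  have h2 : v ⬝ᵥ pairingMatrix β *ᵥ v =
      ∑ j, ∑ l, v l * β j * (if j = l then 0 else v j * β l + v l * β j) := by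
    rw [h1, Finset.sum_comm]
    refine Finset.sum_congr rfl fun j _ => Finset.sum_congr rfl fun l _ => ?_
    by_cases h : j = l
    · simp [h]
    · rw [if_neg h, if_neg (Ne.symm h), add_comm]
  have h3 : 0 ≤ v ⬝ᵥ pairingMatrix β *ᵥ v + v ⬝ᵥ pairingMatrix β *ᵥ v := by
    conv_rhs => rw [h1]
    conv_rhs => arg 2; rw [← h1, h2]
    rw [← Finset.sum_add_distrib]
    refine Finset.sum_nonneg fun j _ => ?_
    rw [← Finset.sum_add_distrib]
    refine Finset.sum_nonneg fun l _ => ?_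
    split_ifs
    · simp
    · rw [← add_mul]
      exact mul_self_nonneg _
  linarith

lemma pairing_symm (j l k m : Fin d) : pairing j l k m = pairing k m j l := by
  unfold pairing
  refine if_congr ?_ rfl rfl
  constructor <;> rintro ⟨h, ⟨rfl, rfl⟩ | ⟨rfl, rfl⟩⟩ <;> simp [h, Ne.symm h]

lemma pairingMatrix_symm (β : Vec d) (j k : Fin d) : pairingMatrix β j k = pairingMatrix β k j := by
  simp only [pairingMatrix, Matrix.of_apply]
  rw [Finset.sum_comm]
  refine Finset.sum_congr rfl fun l _ => Finset.sum_congr rfl fun m _ => ?_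
  rw [pairing_symm, mul_comm (β m)]

/-- The limit of `E[s sᵀ] / log² n`, where `s` is the score and `R² ~ r log n`, `L² ~ l log n`. -/
def limitCovariance (β : Vec d) (r l : ℝ) : Matrix (Fin d) (Fin d) ℝ :=
  (l * r) • (1 : Matrix (Fin d) (Fin d) ℝ) + r ^ 2 • pairingMatrix β

lemma limitCovariance_posDef (β : Vec d) {r l : ℝ} (hr : 0 < r) (hl : 0 < l) :
    (limitCovariance β r l).PosDef := by
  refine posDef_of_coercive (Matrix.IsHermitian.ext fun j k => ?_) (mul_pos hl hr) fun v => ?_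
  · simp only [limitCovariance, Matrix.add_apply, Matrix.smul_apply, star_trivial, Matrix.one_apply,
      eq_comm (a := k)]
    rw [pairingMatrix_symm]
  · unfold limitCovariance
    rw [Matrix.add_mulVec, Matrix.smul_mulVec, Matrix.smul_mulVec, Matrix.one_mulVec, dotProduct_add,
      dotProduct_smul, dotProduct_smul, smul_eq_mul, smul_eq_mul]
    have := pairingMatrix_nonneg β v
    exact le_add_of_nonneg_right (by positivity)

end Pairing

section Moments

variable {d : ℕ} {Ω : Type*} [MeasurableSpace Ω] {P : Measure Ω} [IsProbabilityMeasure P]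
  {X : ℕ → Ω → Vec d} {ε : ℕ → Ω → ℝ} {U : ℕ → Bit d → Ω → ℝ} {θ : Params d} {i : ℕ} {M : ℝ}

lemma Params.abs_clipped_le_abs_target (hR : 0 ≤ θ.R) (hL : 0 ≤ θ.L) (a : Bit d) (o : Obs d) :
    |θ.clipped a o| ≤ |θ.target a o.1| := by
  rcases a with j | j | j
  · exact abs_clip_symm_le_abs hR _
  · change |clip 0 (θ.R ^ 2) (o.1.1 j ^ 2)| ≤ |o.1.1 j ^ 2|
    rw [clip_sq hR, abs_pow, abs_pow]
    exact pow_le_pow_left₀ (abs_nonneg _) (abs_clip_symm_le_abs hR _) 2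
  · exact abs_clip_symm_le_abs hL _

namespace IsModel

lemma abs_integral_mul_quant_mul_quant_le (h : IsModel P X ε U) (hR : 0 ≤ θ.R) (hL : 0 ≤ θ.L)
    {a b : Bit d} (hab : a ≠ b) {v : Obs d → ℝ} (hv : Measurable v) {B : ℝ} (hB : ∀ o, |v o| ≤ B)
    (hva : ∀ o : Obs d, v (o.1, Function.update o.2 a 0) = v o)
    (hvb : ∀ o : Obs d, v (o.1, Function.update o.2 b 0) = v o)
    (hi : Integrable (fun ω => θ.target a (X i ω, ε i ω) * θ.target b (X i ω, ε i ω)) P)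
    (hM : ∫ ω, |θ.target a (X i ω, ε i ω) * θ.target b (X i ω, ε i ω)| ∂P ≤ M) :
    |∫ ω, v (obs X ε U i ω) * θ.quant a (obs X ε U i ω) * θ.quant b (obs X ε U i ω) ∂P| ≤
      B * M := by
  have hB0 : 0 ≤ B := (abs_nonneg _).trans (hB 0)
  rw [h.integral_mul_quant_mul_quant θ hR hL i hab hv hB hva hvb]
  refine (abs_integral_le_integral_abs).trans (le_trans ?_ (mul_le_mul_of_nonneg_left hM hB0))
  rw [← integral_const_mul]
  refine integral_mono_of_nonneg (ae_of_all _ fun ω => abs_nonneg _) (hi.abs.const_mul _)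
    (ae_of_all _ fun ω => ?_)
  simp only
  rw [mul_assoc, abs_mul, abs_mul, abs_mul]
  exact mul_le_mul (hB _) (mul_le_mul (θ.abs_clipped_le_abs_target hR hL a (obs X ε U i ω))
    (θ.abs_clipped_le_abs_target hR hL b (obs X ε U i ω)) (abs_nonneg _) (abs_nonneg _))
    (by positivity) hB0

lemma abs_integral_quantX_mul_quantX_le (h : IsModel P X ε U) (hR : 0 ≤ θ.R) (hL : 0 ≤ θ.L)
    (hX : ∀ j, MemLp (fun ω => X i ω j) 2 P) (hM : ∀ j k, ∫ ω, |X i ω j * X i ω k| ∂P ≤ M)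
    {j k : Fin d} (hjk : j ≠ k) {v : Obs d → ℝ} (hv : Measurable v) {B : ℝ} (hB : ∀ o, |v o| ≤ B)
    (hva : ∀ o : Obs d, v (o.1, Function.update o.2 (.inl j) 0) = v o)
    (hvb : ∀ o : Obs d, v (o.1, Function.update o.2 (.inl k) 0) = v o) :
    |∫ ω, v (obs X ε U i ω) * θ.quant (.inl j) (obs X ε U i ω) *
      θ.quant (.inl k) (obs X ε U i ω) ∂P| ≤ B * M :=
  h.abs_integral_mul_quant_mul_quant_le hR hL (by simpa using hjk) hv hB hva hvb
    ((hX j).integrable_mul (hX k)) (hM j k)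

lemma abs_integral_gram_self_mul_gram_le (h : IsModel P X ε U) (hR : 0 ≤ θ.R) (hL : 0 ≤ θ.L)
    (hX : ∀ j, MemLp (fun ω => X i ω j) 2 P) (hM : ∀ j k, ∫ ω, |X i ω j * X i ω k| ∂P ≤ M)
    (j k m : Fin d) :
    |∫ ω, θ.gram (obs X ε U i ω) j j * θ.gram (obs X ε U i ω) k m ∂P| ≤ θ.R ^ 2 * M := by
  have h1 : ∫ ω, θ.gram (obs X ε U i ω) j j ∂P ≤ M := by
    rw [h.integral_gram θ hR hL]
    refine le_trans (integral_mono (h.integrable_clipped_mul_clipped θ hR hL i _ _)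
      ((hX j).integrable_mul (hX j)).abs fun ω => ?_) (hM j j)
    refine (le_abs_self _).trans ?_
    simp only [Pi.mul_apply]
    rw [abs_mul, abs_mul]
    have := θ.abs_clipped_le_abs_target hR hL (.inl j) (obs X ε U i ω)
    exact mul_le_mul this this (abs_nonneg _) (abs_nonneg _)
  refine (abs_integral_le_integral_abs).trans
    (le_trans ?_ (mul_le_mul_of_nonneg_left h1 (sq_nonneg θ.R)))
  rw [← integral_const_mul]
  refine integral_mono_of_nonneg (ae_of_all _ fun ω => abs_nonneg _)
    ((h.integrable_of_bound i (θ.measurable_gram j j) fun o => θ.abs_gram_le o j j).const_mul _)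
    (ae_of_all _ fun ω => ?_)
  simp only
  have hg : 0 ≤ θ.gram (obs X ε U i ω) j j := by
    simp only [Params.gram, if_true]
    exact θ.quant_sq_nonneg _ _
  rw [abs_mul, abs_of_nonneg hg, mul_comm]
  exact mul_le_mul_of_nonneg_right (θ.abs_gram_le _ _ _) hg

lemma abs_integral_gram_mul_gram_sub_le (h : IsModel P X ε U) (hR : 0 ≤ θ.R) (hL : 0 ≤ θ.L)
    (hX : ∀ j, MemLp (fun ω => X i ω j) 2 P) (hM : ∀ j k, ∫ ω, |X i ω j * X i ω k| ∂P ≤ M)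
    (j l k m : Fin d) :
    |∫ ω, θ.gram (obs X ε U i ω) j l * θ.gram (obs X ε U i ω) k m ∂P -
      θ.R ^ 4 * pairing j l k m| ≤ θ.R ^ 2 * M := by
  have hM0 : 0 ≤ M := (integral_nonneg fun ω => abs_nonneg _).trans (hM j j)
  have hq : ∀ (j : Fin d) (o : Obs d), θ.quant (.inl j) o * θ.quant (.inl j) o = θ.R ^ 2 :=
    fun j o => by rw [← sq, θ.quant_inl_sq]
  have hconst : ∀ {a b : Fin d}, a ≠ b → |∫ ω, θ.R ^ 2 * θ.quant (.inl a) (obs X ε U i ω) *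
      θ.quant (.inl b) (obs X ε U i ω) ∂P| ≤ θ.R ^ 2 * M := fun hab =>
    h.abs_integral_quantX_mul_quantX_le (v := fun _ => θ.R ^ 2) hR hL hX hM hab measurable_const
      (fun _ => (abs_of_nonneg (sq_nonneg _)).le) (fun _ => rfl) (fun _ => rfl)
  by_cases hjl : j = l
  · subst hjl
    simpa [pairing] using h.abs_integral_gram_self_mul_gram_le hR hL hX hM j k m
  by_cases hkm : k = m
  · subst hkm
    have hw : pairing j l k k = 0 := by
      rw [pairing_symm]
      simp [pairing]
    rw [hw, mul_zero, sub_zero]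
    simpa only [mul_comm] using h.abs_integral_gram_self_mul_gram_le hR hL hX hM k j l
  simp only [Params.gram, if_neg hjl, if_neg hkm]
  by_cases hkj : k = j
  · subst hkj
    by_cases hml : m = l
    · subst hml
      have e : ∀ o : Obs d, θ.quant (.inl k) o * θ.quant (.inl m) o *
          (θ.quant (.inl k) o * θ.quant (.inl m) o) = θ.R ^ 4 := fun o => by
        rw [mul_mul_mul_comm, hq, hq]; ring
      simp only [e, pairing]
      simp [hjl]
      positivity
    · have hw : pairing k l k m = 0 := by simp [pairing, hml, hjl]
      have e : ∀ o : Obs d, θ.quant (.inl k) o * θ.quant (.inl l) o *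
          (θ.quant (.inl k) o * θ.quant (.inl m) o) =
          θ.R ^ 2 * θ.quant (.inl l) o * θ.quant (.inl m) o := fun o => by
        rw [mul_mul_mul_comm, hq]; ring
      simp only [e, hw, mul_zero, sub_zero]
      exact hconst (Ne.symm hml)
  by_cases hkl : k = l
  · subst hkl
    by_cases hmj : m = j
    · subst hmj
      have e : ∀ o : Obs d, θ.quant (.inl m) o * θ.quant (.inl k) o *
          (θ.quant (.inl k) o * θ.quant (.inl m) o) = θ.R ^ 4 := fun o => by
        rw [mul_comm (θ.quant (.inl k) o), mul_mul_mul_comm, hq, hq]; ring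
      simp only [e, pairing]
      simp [hjl]
      positivity
    · have hw : pairing j k k m = 0 := by simp [pairing, hmj, hkj]
      have e : ∀ o : Obs d, θ.quant (.inl j) o * θ.quant (.inl k) o *
          (θ.quant (.inl k) o * θ.quant (.inl m) o) =
          θ.R ^ 2 * θ.quant (.inl j) o * θ.quant (.inl m) o := fun o => by
        rw [mul_comm (θ.quant (.inl j) o), mul_mul_mul_comm, hq]; ring
      simp only [e, hw, mul_zero, sub_zero]
      exact hconst (Ne.symm hmj)
  have hw : pairing j l k m = 0 := by simp [pairing, hkj, hkl]
  rw [hw, mul_zero, sub_zero]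
  by_cases hmj : m = j
  · subst hmj
    have e : ∀ o : Obs d, θ.quant (.inl m) o * θ.quant (.inl l) o *
        (θ.quant (.inl k) o * θ.quant (.inl m) o) =
        θ.R ^ 2 * θ.quant (.inl l) o * θ.quant (.inl k) o := fun o => by
      rw [mul_comm (θ.quant (.inl k) o), mul_mul_mul_comm, hq]; ring
    simp only [e]
    exact hconst (Ne.symm hkl)
  by_cases hml : m = l
  · subst hml
    have e : ∀ o : Obs d, θ.quant (.inl j) o * θ.quant (.inl m) o *
        (θ.quant (.inl k) o * θ.quant (.inl m) o) =
        θ.R ^ 2 * θ.quant (.inl j) o * θ.quant (.inl k) o := fun o => by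
      rw [mul_mul_mul_comm, hq]; ring
    simp only [e]
    exact hconst (Ne.symm hkj)
  simp only [← mul_assoc (θ.quant (.inl j) _ * θ.quant (.inl l) _)]
  refine h.abs_integral_quantX_mul_quantX_le (v := fun o => θ.quant (.inl j) o * θ.quant (.inl l) o)
    hR hL hX hM hkm ((θ.measurable_quant _).mul (θ.measurable_quant _)) (fun o => ?_) (fun o => ?_)
    (fun o => ?_)
  · rw [abs_mul, θ.abs_quant_inl, θ.abs_quant_inl, ← sq, sq_abs]
  · rw [θ.quant_update_of_ne (by simpa using Ne.symm hkj),
      θ.quant_update_of_ne (by simpa using Ne.symm hkl)]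
  · rw [θ.quant_update_of_ne (by simpa using Ne.symm hmj),
      θ.quant_update_of_ne (by simpa using Ne.symm hml)]

lemma abs_integral_gram_mul_quant_mul_quantY_le (h : IsModel P X ε U) (hR : 0 ≤ θ.R) (hL : 0 ≤ θ.L)
    (hi : ∀ j, Integrable (fun ω => X i ω j * response θ.β θ.σ X ε i ω) P)
    (hM : ∀ j, ∫ ω, |X i ω j * response θ.β θ.σ X ε i ω| ∂P ≤ M) (j l k : Fin d) :
    |∫ ω, θ.gram (obs X ε U i ω) j l * θ.quant (.inl k) (obs X ε U i ω) *
      θ.quant (.inr (.inr ())) (obs X ε U i ω) ∂P| ≤ θ.R ^ 2 * M := by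
  have hq : ∀ (j : Fin d) (o : Obs d), θ.quant (.inl j) o * θ.quant (.inl j) o = θ.R ^ 2 :=
    fun j o => by rw [← sq, θ.quant_inl_sq]
  have key : ∀ (k : Fin d) (v : Obs d → ℝ), Measurable v → (∀ o, |v o| ≤ θ.R ^ 2) →
      (∀ o : Obs d, v (o.1, Function.update o.2 (.inl k) 0) = v o) →
      (∀ o : Obs d, v (o.1, Function.update o.2 (.inr (.inr ())) 0) = v o) →
      |∫ ω, v (obs X ε U i ω) * θ.quant (.inl k) (obs X ε U i ω) *
        θ.quant (.inr (.inr ())) (obs X ε U i ω) ∂P| ≤ θ.R ^ 2 * M := fun k v hv hB h1 h2 =>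
    h.abs_integral_mul_quant_mul_quant_le hR hL (by simp) hv hB h1 h2 (hi k) (hM k)
  have hconst : ∀ k, |∫ ω, θ.R ^ 2 * θ.quant (.inl k) (obs X ε U i ω) *
        θ.quant (.inr (.inr ())) (obs X ε U i ω) ∂P| ≤ θ.R ^ 2 * M := fun k =>
    key k (fun _ => θ.R ^ 2) measurable_const (fun _ => (abs_of_nonneg (sq_nonneg _)).le)
      (fun _ => rfl) (fun _ => rfl)
  by_cases hjl : j = l
  · subst hjl
    refine key k (fun o => θ.gram o j j) (θ.measurable_gram j j) (fun o => θ.abs_gram_le o j j)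
      (fun o => ?_) (fun o => θ.gram_update_Y o 0 j j)
    simp only [Params.gram, if_true]
    rw [θ.quant_update_of_ne (by simp)]
  simp only [Params.gram, if_neg hjl]
  by_cases hkj : k = j
  · subst hkj
    have e : ∀ o : Obs d, θ.quant (.inl k) o * θ.quant (.inl l) o * θ.quant (.inl k) o =
        θ.R ^ 2 * θ.quant (.inl l) o := fun o => by rw [mul_right_comm, hq]
    simp only [e]
    exact hconst l
  by_cases hkl : k = l
  · subst hkl
    have e : ∀ o : Obs d, θ.quant (.inl j) o * θ.quant (.inl k) o * θ.quant (.inl k) o =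
        θ.R ^ 2 * θ.quant (.inl j) o := fun o => by rw [mul_assoc, hq, mul_comm]
    simp only [e]
    exact hconst j
  refine key k (fun o => θ.quant (.inl j) o * θ.quant (.inl l) o)
    ((θ.measurable_quant _).mul (θ.measurable_quant _)) (fun o => ?_) (fun o => ?_) (fun o => ?_)
  · rw [abs_mul, θ.abs_quant_inl, θ.abs_quant_inl, ← sq, sq_abs]
  · rw [θ.quant_update_of_ne (by simpa using Ne.symm hkj),
      θ.quant_update_of_ne (by simpa using Ne.symm hkl)]
  · rw [θ.quant_update_of_ne (by simp), θ.quant_update_of_ne (by simp)]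

lemma abs_integral_gramMul_mul_quant_mul_quantY_le (h : IsModel P X ε U) (hR : 0 ≤ θ.R)
    (hL : 0 ≤ θ.L) (hi : ∀ j, Integrable (fun ω => X i ω j * response θ.β θ.σ X ε i ω) P)
    (hM : ∀ j, ∫ ω, |X i ω j * response θ.β θ.σ X ε i ω| ∂P ≤ M) (j k : Fin d) :
    |∫ ω, θ.gramMul (obs X ε U i ω) j * θ.quant (.inl k) (obs X ε U i ω) *
      θ.quant (.inr (.inr ())) (obs X ε U i ω) ∂P| ≤ θ.R ^ 2 * M * ∑ l, |θ.β l| := by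
  have e : ∫ ω, θ.gramMul (obs X ε U i ω) j * θ.quant (.inl k) (obs X ε U i ω) *
      θ.quant (.inr (.inr ())) (obs X ε U i ω) ∂P =
      ∑ l, (∫ ω, θ.gram (obs X ε U i ω) j l * θ.quant (.inl k) (obs X ε U i ω) *
      θ.quant (.inr (.inr ())) (obs X ε U i ω) ∂P) * θ.β l := by
    simp_rw [← integral_mul_const]
    rw [← integral_finsetSum]
    · congr 1; ext ω
      simp only [Params.gramMul, Finset.sum_mul]
      refine Finset.sum_congr rfl fun l _ => by ring
    · intro l _
      refine Integrable.mul_const (h.integrable_of_bound i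
        (v := fun o => θ.gram o j l * θ.quant (.inl k) o * θ.quant (.inr (.inr ())) o)
        (((θ.measurable_gram j l).mul (θ.measurable_quant _)).mul (θ.measurable_quant _))
        (B := θ.R ^ 2 * |θ.R| * |θ.L|) fun o => ?_) _
      rw [abs_mul, abs_mul, θ.abs_quant_inl, θ.abs_quant_Y]
      gcongr
      exact θ.abs_gram_le o j l
  rw [e]
  exact abs_sum_mul_le fun l => h.abs_integral_gram_mul_quant_mul_quantY_le hR hL hi hM j l k

lemma abs_integral_gramMul_mul_gramMul_sub_le (h : IsModel P X ε U) (hR : 0 ≤ θ.R) (hL : 0 ≤ θ.L)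
    (hX : ∀ j, MemLp (fun ω => X i ω j) 2 P) (hM : ∀ j k, ∫ ω, |X i ω j * X i ω k| ∂P ≤ M)
    (j k : Fin d) :
    |∫ ω, θ.gramMul (obs X ε U i ω) j * θ.gramMul (obs X ε U i ω) k ∂P -
      θ.R ^ 4 * pairingMatrix θ.β j k| ≤ θ.R ^ 2 * M * (∑ l, |θ.β l|) ^ 2 := by
  have hint : ∀ l m, Integrable (fun ω => θ.gram (obs X ε U i ω) j l *
      θ.gram (obs X ε U i ω) k m) P := fun l m =>
    h.integrable_of_bound i (v := fun o => θ.gram o j l * θ.gram o k m)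
      ((θ.measurable_gram j l).mul (θ.measurable_gram k m)) (B := θ.R ^ 2 * θ.R ^ 2) fun o => by
        rw [abs_mul]
        exact mul_le_mul (θ.abs_gram_le _ _ _) (θ.abs_gram_le _ _ _) (abs_nonneg _) (sq_nonneg _)
  have e : ∫ ω, θ.gramMul (obs X ε U i ω) j * θ.gramMul (obs X ε U i ω) k ∂P =
      ∑ l, ∑ m, θ.β l * θ.β m *
        ∫ ω, θ.gram (obs X ε U i ω) j l * θ.gram (obs X ε U i ω) k m ∂P := by
    simp_rw [← integral_const_mul]
    rw [← Finset.sum_congr rfl fun l _ =>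
        integral_finsetSum _ fun m _ => (hint l m).const_mul (θ.β l * θ.β m),
      ← integral_finsetSum _ fun l _ => integrable_finsetSum _ fun m _ => (hint l m).const_mul _]
    congr 1; ext ω
    simp only [Params.gramMul, Finset.sum_mul_sum]
    refine Finset.sum_congr rfl fun l _ => Finset.sum_congr rfl fun m _ => by ring
  have e2 : (∑ l, |θ.β l|) ^ 2 = ∑ l, ∑ m, |θ.β l| * |θ.β m| := by
    rw [sq, Finset.sum_mul_sum]
  rw [e, e2, pairingMatrix, Matrix.of_apply, Finset.mul_sum, Finset.mul_sum,
    ← Finset.sum_sub_distrib]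
  refine (Finset.abs_sum_le_sum_abs _ _).trans (Finset.sum_le_sum fun l _ => ?_)
  rw [Finset.mul_sum, Finset.mul_sum, ← Finset.sum_sub_distrib]
  refine (Finset.abs_sum_le_sum_abs _ _).trans (Finset.sum_le_sum fun m _ => ?_)
  have h1 := h.abs_integral_gram_mul_gram_sub_le hR hL hX hM j l k m
  rw [mul_left_comm, ← mul_sub, abs_mul, abs_mul, mul_comm]
  exact mul_le_mul_of_nonneg_right h1 (by positivity)

/-- The second moments of the score, up to lower-order terms. -/
lemma abs_integral_score_mul_score_sub_le (h : IsModel P X ε U) (hR : 0 ≤ θ.R) (hL : 0 ≤ θ.L)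
    (hX : ∀ j, MemLp (fun ω => X i ω j) 2 P) (hM : ∀ j k, ∫ ω, |X i ω j * X i ω k| ∂P ≤ M)
    (hiY : ∀ j, Integrable (fun ω => X i ω j * response θ.β θ.σ X ε i ω) P)
    (hMY : ∀ j, ∫ ω, |X i ω j * response θ.β θ.σ X ε i ω| ∂P ≤ M) (j k : Fin d) :
    |∫ ω, θ.score (obs X ε U i ω) j * θ.score (obs X ε U i ω) k ∂P -
      (θ.L ^ 2 * θ.R ^ 2 * (1 : Matrix (Fin d) (Fin d) ℝ) j k +
        θ.R ^ 4 * pairingMatrix θ.β j k)| ≤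
      θ.L ^ 2 * M + θ.R ^ 2 * (M * (2 * ∑ l, |θ.β l| + (∑ l, |θ.β l|) ^ 2)) := by
  have hM0 : 0 ≤ M := (integral_nonneg fun ω => abs_nonneg _).trans (hM j j)
  have h1 := h.abs_integral_gramMul_mul_quant_mul_quantY_le hR hL hiY hMY j k
  have h2 := h.abs_integral_gramMul_mul_quant_mul_quantY_le hR hL hiY hMY k j
  have h3 := h.abs_integral_gramMul_mul_gramMul_sub_le hR hL hX hM j k
  have h4 : |∫ ω, θ.quant (.inl j) (obs X ε U i ω) * θ.quant (.inl k) (obs X ε U i ω) ∂P -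
      θ.R ^ 2 * (1 : Matrix (Fin d) (Fin d) ℝ) j k| ≤ M := by
    by_cases hjk : j = k
    · subst hjk
      simp_rw [← sq, θ.quant_inl_sq]
      simpa using hM0
    · rw [Matrix.one_apply_ne hjk, mul_zero, sub_zero]
      have := h.abs_integral_quantX_mul_quantX_le (v := fun _ => 1) (B := 1) hR hL hX hM hjk
        measurable_const (by simp) (by simp) (by simp)
      simpa only [one_mul] using this
  have h5 := mul_le_mul_of_nonneg_left h4 (sq_nonneg θ.L)
  rw [← abs_of_nonneg (sq_nonneg θ.L), ← abs_mul, abs_of_nonneg (sq_nonneg θ.L), mul_sub] at h5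
  rw [θ.integral_score_mul_score h]
  rw [abs_le] at h1 h2 h3 h5 ⊢
  constructor <;> linarith [h1.1, h1.2, h2.1, h2.2, h3.1, h3.2, h5.1, h5.2]

end IsModel

end Moments

section Bias

variable {d : ℕ} {Ω : Type*} [MeasurableSpace Ω] {P : Measure Ω} [IsProbabilityMeasure P]
  {X : ℕ → Ω → Vec d} {ε : ℕ → Ω → ℝ} {U : ℕ → Bit d → Ω → ℝ} {θ : Params d}

namespace IsModel

omit [IsProbabilityMeasure P] in
lemma indepFun_apply_noise (h : IsModel P X ε U) (j : Fin d) :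
    IndepFun (fun ω => X 0 ω j) (ε 0) P :=
  h.indep_noise.comp (φ := fun f : ℕ → Vec d => f 0 j) (ψ := fun f : ℕ → ℝ => f 0)
    (by fun_prop) (by fun_prop)

omit [IsProbabilityMeasure P] in
lemma integrable_sq_mul_sq_noise (h : IsModel P X ε U) {j : Fin d}
    (hX : MemLp (fun ω => X 0 ω j) 2 P) : Integrable (fun ω => X 0 ω j ^ 2 * ε 0 ω ^ 2) P :=
  ((h.indepFun_apply_noise j).comp (φ := fun x => x ^ 2) (ψ := fun x => x ^ 2) (by fun_prop)
    (by fun_prop)).integrable_mul hX.integrable_sq (h.noise.memLp 0).integrable_sq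

omit [IsProbabilityMeasure P] in
lemma integral_sq_mul_sq_noise (h : IsModel P X ε U) (j : Fin d) :
    ∫ ω, X 0 ω j ^ 2 * ε 0 ω ^ 2 ∂P = ∫ ω, X 0 ω j ^ 2 ∂P := by
  have hm := h.measX 0
  have hn := h.noise.meas 0
  have := ((h.indepFun_apply_noise j).comp (φ := fun x => x ^ 2) (ψ := fun x => x ^ 2)
    (by fun_prop) (by fun_prop)).integral_fun_mul_eq_mul_integral
    (by fun_prop : Measurable fun ω => X 0 ω j ^ 2).aestronglyMeasurable
    (by fun_prop : Measurable fun ω => ε 0 ω ^ 2).aestronglyMeasurable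
  simp only [Function.comp] at this
  rw [this, h.noise.var, mul_one]

/-- The bias caused by truncation. -/
lemma abs_integral_score_le (h : IsModel P X ε U) (hR : 0 ≤ θ.R) (hL : 0 ≤ θ.L)
    (hX : ∀ j, MemLp (fun ω => X 0 ω j) 2 P) (j : Fin d) {a p : ℝ} (ha : 0 < a)
    (hp : P.real {ω | ¬((∀ j, |X 0 ω j| ≤ θ.R) ∧ |response θ.β θ.σ X ε 0 ω| ≤ θ.L)} ≤ p) :
    |∫ ω, θ.score (obs X ε U 0 ω) j ∂P| ≤
      θ.scoreBound * p + |θ.σ| / 2 * (a * ∫ ω, X 0 ω j ^ 2 ∂P + a⁻¹ * p) := by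
  set A := {ω | ¬((∀ j, |X 0 ω j| ≤ θ.R) ∧ |response θ.β θ.σ X ε 0 ω| ≤ θ.L)} with hA
  have hm := h.measX 0
  have hn := h.noise.meas 0
  have hAm : MeasurableSet A := by
    have hr : Measurable (response θ.β θ.σ X ε 0) := by
      unfold response
      simp only [dotProduct]
      fun_prop
    have e : A = ((⋂ j, {ω | |X 0 ω j| ≤ θ.R}) ∩ {ω | |response θ.β θ.σ X ε 0 ω| ≤ θ.L})ᶜ := by
      ext ω
      simp [hA]
    rw [e]
    refine (MeasurableSet.inter (MeasurableSet.iInter fun j => ?_) ?_).compl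
    · exact measurableSet_le (by fun_prop : Measurable fun ω => X 0 ω j).abs measurable_const
    · exact measurableSet_le hr.abs measurable_const
  set f : Ω → ℝ := fun ω => θ.clipped (.inl j) (obs X ε U 0 ω) *
    (θ.clipped (.inr (.inr ())) (obs X ε U 0 ω) -
      ∑ l, θ.clipped (.inl l) (obs X ε U 0 ω) * θ.β l) with hf
  set g : Ω → ℝ := fun ω => X 0 ω j * θ.σ * ε 0 ω with hg
  have hcX : ∀ l ω, |θ.clipped (.inl l) (obs X ε U 0 ω)| ≤ θ.R := fun l ω => abs_clip_symm_le hR _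
  have hcY : ∀ ω, |θ.clipped (.inr (.inr ())) (obs X ε U 0 ω)| ≤ θ.L :=
    fun ω => abs_clip_symm_le hL _
  have hfb : ∀ ω, |f ω| ≤ θ.scoreBound := fun ω => by
    rw [hf, Params.scoreBound, abs_of_nonneg hR, abs_of_nonneg hL, abs_mul]
    refine (mul_le_mul (hcX j ω) ((abs_sub _ _).trans (add_le_add (hcY ω)
      (abs_sum_mul_le fun l => hcX l ω))) (abs_nonneg _) hR).trans (le_of_eq (by ring))
  have hfm : Measurable f := by
    have hc : ∀ b, Measurable fun ω => θ.clipped b (obs X ε U 0 ω) := fun b =>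
      (θ.measurable_clipped b).comp (h.measurable_obs 0)
    exact (hc _).mul ((hc _).sub (Finset.measurable_fun_sum _ fun l _ => (hc _).mul_const _))
  have hfi : Integrable f P :=
    Integrable.of_bound hfm.aestronglyMeasurable θ.scoreBound (ae_of_all _ hfb)
  have hgi : Integrable g P := by
    have : Integrable (fun ω => X 0 ω j * ε 0 ω) P :=
      (hX j).integrable_mul (h.noise.memLp 0)
    refine (this.const_mul θ.σ).congr (ae_of_all _ fun ω => ?_)
    simp only [hg]
    ring
  have hg0 : ∫ ω, g ω ∂P = 0 := h.integral_mul_noise 0 (v := fun q => q.2 j * θ.σ) (by fun_prop)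
  have e : ∫ ω, θ.score (obs X ε U 0 ω) j ∂P = ∫ ω, f ω - g ω ∂P := by
    rw [integral_sub hfi hgi, hg0, sub_zero, h.integral_score θ hR hL]
  have hSi := (h.integrable_sq_mul_sq_noise (hX j)).const_mul a
  have hind1 : Integrable (A.indicator fun _ => θ.scoreBound) P :=
    (integrable_const _).indicator hAm
  have hind2 : Integrable (A.indicator fun _ => a⁻¹) P := (integrable_const _).indicator hAm
  have hpt : ∀ ω, |f ω - g ω| ≤ A.indicator (fun _ => θ.scoreBound) ω +
      |θ.σ| / 2 * (a * (X 0 ω j ^ 2 * ε 0 ω ^ 2) + A.indicator (fun _ => a⁻¹) ω) := by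
    intro ω
    by_cases hω : ω ∈ A
    · rw [Set.indicator_of_mem hω, Set.indicator_of_mem hω]
      refine (abs_sub _ _).trans (add_le_add (hfb ω) ?_)
      have h1 : |X 0 ω j * ε 0 ω| ≤ (a * (X 0 ω j ^ 2 * ε 0 ω ^ 2) + a⁻¹) / 2 := by
        have h2 := two_mul_le_add_sq (√a * |X 0 ω j * ε 0 ω|) (√a)⁻¹
        have h3 : √a ≠ 0 := (Real.sqrt_pos.2 ha).ne'
        rw [mul_pow, Real.sq_sqrt ha.le, sq_abs, inv_pow, Real.sq_sqrt ha.le, mul_pow] at h2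
        have h4 : 2 * (√a * |X 0 ω j * ε 0 ω|) * (√a)⁻¹ = 2 * |X 0 ω j * ε 0 ω| := by
          field_simp
        linarith
      change |X 0 ω j * θ.σ * ε 0 ω| ≤ _
      rw [mul_right_comm, abs_mul]
      have := mul_le_mul_of_nonneg_right h1 (abs_nonneg θ.σ)
      linarith
    · rw [Set.indicator_of_notMem hω, Set.indicator_of_notMem hω]
      have hω' : (∀ j, |X 0 ω j| ≤ θ.R) ∧ |response θ.β θ.σ X ε 0 ω| ≤ θ.L := not_not.1 hω
      have e1 : ∀ l, θ.clipped (.inl l) (obs X ε U 0 ω) = X 0 ω l := fun l =>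
        clip_symm_eq_self (hω'.1 l)
      have e2 : θ.clipped (.inr (.inr ())) (obs X ε U 0 ω) =
          (X 0 ω).ofLp ⬝ᵥ θ.β.ofLp + θ.σ * ε 0 ω := clip_symm_eq_self hω'.2
      have e3 : f ω - g ω = 0 := by
        simp only [hf, hg, e1, e2, dotProduct]
        ring
      rw [e3, abs_zero]
      positivity
  have hint := (hSi.add hind2).const_mul (|θ.σ| / 2)
  rw [e]
  refine abs_integral_le_integral_abs.trans ((integral_mono (hfi.sub hgi).abs
    (hind1.add hint) hpt).trans ?_)
  have e5 : ∫ ω, A.indicator (fun _ => θ.scoreBound) ω +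
      |θ.σ| / 2 * (a * (X 0 ω j ^ 2 * ε 0 ω ^ 2) + A.indicator (fun _ => a⁻¹) ω) ∂P =
      θ.scoreBound * P.real A + |θ.σ| / 2 * (a * ∫ ω, X 0 ω j ^ 2 ∂P + a⁻¹ * P.real A) := by
    refine (integral_add hind1 hint).trans ?_
    rw [integral_const_mul]
    have e6 := integral_add hSi hind2
    simp only [Pi.add_apply] at e6 ⊢
    rw [e6, integral_const_mul, h.integral_sq_mul_sq_noise, integral_indicator_const _ hAm,
      integral_indicator_const _ hAm, smul_eq_mul, smul_eq_mul]
    ring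
  refine e5.le.trans ?_
  have hsb : 0 ≤ θ.scoreBound := by
    unfold Params.scoreBound
    positivity
  gcongr

end IsModel

end Bias

section GrowingRanges

variable {d : ℕ} {Ω : Type*} [MeasurableSpace Ω] {P : Measure Ω} [IsProbabilityMeasure P]
  {X : ℕ → Ω → Vec d} {ε : ℕ → Ω → ℝ} {U : ℕ → ℕ → Bit d → Ω → ℝ} {θ : ℕ → Params d}
  {β : Vec d} {σ r l : ℝ}

omit [IsProbabilityMeasure P] in
lemma memLp_response (hn : IsNoise P ε) (hX : ∀ j, MemLp (fun ω => X 0 ω j) 2 P) :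
    MemLp (response β σ X ε 0) 2 P := by
  unfold response
  simp only [dotProduct]
  refine MemLp.add (memLp_finsetSum _ fun j _ => ?_) ((hn.memLp 0).const_mul σ)
  exact (hX j).mul_const (β j)

lemma tendsto_atTop_of_tendsto_sq_div_log {u : ℕ → ℝ} (hu : ∀ n, 0 ≤ u n) (hr : 0 < r)
    (h : Tendsto (fun n : ℕ => u n ^ 2 / Real.log n) atTop (𝓝 r)) : Tendsto u atTop atTop := by
  have h1 : Tendsto (fun n : ℕ => u n ^ 2 / Real.log n * Real.log n) atTop atTop :=
    h.pos_mul_atTop hr tendsto_log_natCast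
  have h2 : Tendsto (fun n : ℕ => √(u n ^ 2 / Real.log n * Real.log n)) atTop atTop :=
    Real.tendsto_sqrt_atTop.comp h1
  refine h2.congr' ?_
  filter_upwards [eventually_gt_atTop 1] with n hn
  have hlog : 0 < Real.log n := Real.log_pos (by exact_mod_cast hn)
  rw [div_mul_cancel₀ _ hlog.ne', Real.sqrt_sq (hu n)]

lemma tendsto_pow_four_div {u : ℕ → ℝ}
    (h : Tendsto (fun n : ℕ => u n ^ 2 / Real.log n) atTop (𝓝 r)) :
    Tendsto (fun n : ℕ => u n ^ 4 / n) atTop (𝓝 0) := by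
  have h1 : Tendsto (fun n : ℕ => Real.log n ^ 2 / n) atTop (𝓝 0) :=
    (Real.isLittleO_pow_log_id_atTop (n := 2)).tendsto_div_nhds_zero.comp
      tendsto_natCast_atTop_atTop
  have h2 := (h.pow 2).mul h1
  rw [mul_zero] at h2
  refine h2.congr' ?_
  filter_upwards [eventually_gt_atTop 1] with n hn
  have hlog : 0 < Real.log n := Real.log_pos (by exact_mod_cast hn)
  field_simp

/-- The second moments of the score grow like `log² n`. -/
lemma tendsto_integral_score_mul_score_div (h : ∀ n, IsModel P X ε (U n)) (hβ : ∀ n, (θ n).β = β)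
    (hσ : ∀ n, (θ n).σ = σ) (hR : ∀ n, 0 ≤ (θ n).R) (hL : ∀ n, 0 ≤ (θ n).L)
    (hX : ∀ j, MemLp (fun ω => X 0 ω j) 2 P)
    (hRr : Tendsto (fun n : ℕ => (θ n).R ^ 2 / Real.log n) atTop (𝓝 r))
    (hLl : Tendsto (fun n : ℕ => (θ n).L ^ 2 / Real.log n) atTop (𝓝 l)) (j k : Fin d) :
    Tendsto (fun n : ℕ => (∫ ω, (θ n).score (obs X ε (U n) 0 ω) j *
      (θ n).score (obs X ε (U n) 0 ω) k ∂P) / Real.log n ^ 2) atTop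
      (𝓝 (limitCovariance β r l j k)) := by
  have hY := memLp_response (β := β) (σ := σ) (h 0).noise hX
  have hiY : ∀ j, Integrable (fun ω => X 0 ω j * response β σ X ε 0 ω) P := fun j =>
    (hX j).integrable_mul hY
  obtain ⟨M1, hM1⟩ := Finite.exists_le fun p : Fin d × Fin d => ∫ ω, |X 0 ω p.1 * X 0 ω p.2| ∂P
  obtain ⟨M2, hM2⟩ := Finite.exists_le fun j : Fin d => ∫ ω, |X 0 ω j * response β σ X ε 0 ω| ∂P
  set M := max M1 M2
  set K := M * (2 * ∑ l, |β l| + (∑ l, |β l|) ^ 2) with hK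
  have hbound : ∀ n, |∫ ω, (θ n).score (obs X ε (U n) 0 ω) j *
      (θ n).score (obs X ε (U n) 0 ω) k ∂P -
      ((θ n).L ^ 2 * (θ n).R ^ 2 * (1 : Matrix (Fin d) (Fin d) ℝ) j k +
        (θ n).R ^ 4 * pairingMatrix β j k)| ≤ (θ n).L ^ 2 * M + (θ n).R ^ 2 * K := fun n => by
    have := (h n).abs_integral_score_mul_score_sub_le (M := M) (hR n) (hL n) hX
      (fun j k => (hM1 (j, k)).trans (le_max_left _ _)) (by rw [hβ n, hσ n]; exact hiY)
      (fun j => by rw [hβ n, hσ n]; exact (hM2 j).trans (le_max_right _ _)) j k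
    rwa [hβ n] at this
  have hmain : Tendsto (fun n : ℕ => (θ n).L ^ 2 / Real.log n * ((θ n).R ^ 2 / Real.log n) *
      (1 : Matrix (Fin d) (Fin d) ℝ) j k + ((θ n).R ^ 2 / Real.log n) ^ 2 *
      pairingMatrix β j k) atTop (𝓝 (limitCovariance β r l j k)) :=
    ((hLl.mul hRr).mul_const _).add ((hRr.pow 2).mul_const _)
  have herr : Tendsto (fun n : ℕ => ((θ n).L ^ 2 / Real.log n * M + (θ n).R ^ 2 / Real.log n * K) /
      Real.log n) atTop (𝓝 0) :=
    ((hLl.mul_const M).add (hRr.mul_const K)).div_atTop tendsto_log_natCast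
  have hdiff : Tendsto (fun n : ℕ => (∫ ω, (θ n).score (obs X ε (U n) 0 ω) j *
      (θ n).score (obs X ε (U n) 0 ω) k ∂P) / Real.log n ^ 2 -
      ((θ n).L ^ 2 / Real.log n * ((θ n).R ^ 2 / Real.log n) *
      (1 : Matrix (Fin d) (Fin d) ℝ) j k + ((θ n).R ^ 2 / Real.log n) ^ 2 *
      pairingMatrix β j k)) atTop (𝓝 0) := by
    refine squeeze_zero_norm' ?_ herr
    filter_upwards [eventually_gt_atTop 1] with n hn
    have hlog : 0 < Real.log n := Real.log_pos (by exact_mod_cast hn)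
    have e : (∫ ω, (θ n).score (obs X ε (U n) 0 ω) j *
      (θ n).score (obs X ε (U n) 0 ω) k ∂P) / Real.log n ^ 2 -
      ((θ n).L ^ 2 / Real.log n * ((θ n).R ^ 2 / Real.log n) *
      (1 : Matrix (Fin d) (Fin d) ℝ) j k + ((θ n).R ^ 2 / Real.log n) ^ 2 *
      pairingMatrix β j k) = (∫ ω, (θ n).score (obs X ε (U n) 0 ω) j *
      (θ n).score (obs X ε (U n) 0 ω) k ∂P -
      ((θ n).L ^ 2 * (θ n).R ^ 2 * (1 : Matrix (Fin d) (Fin d) ℝ) j k +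
        (θ n).R ^ 4 * pairingMatrix β j k)) / Real.log n ^ 2 := by
      field_simp
    rw [e, Real.norm_eq_abs, abs_div, abs_of_nonneg (sq_nonneg (Real.log (n : ℝ))),
      div_le_iff₀ (by positivity)]
    refine (hbound n).trans (le_of_eq ?_)
    field_simp
  have := hdiff.add hmain
  simpa using this

lemma tendsto_integral_gram (h : ∀ n, IsModel P X ε (U n)) (hR : ∀ n, 0 ≤ (θ n).R)
    (hL : ∀ n, 0 ≤ (θ n).L) (hX : ∀ j, MemLp (fun ω => X 0 ω j) 2 P)
    (hRt : Tendsto (fun n => (θ n).R) atTop atTop) (j k : Fin d) :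
    Tendsto (fun n : ℕ => ∫ ω, (θ n).gram (obs X ε (U n) 0 ω) j k ∂P) atTop
      (𝓝 (∫ ω, X 0 ω j * X 0 ω k ∂P)) := by
  simp_rw [fun n => (h n).integral_gram (θ n) (hR n) (hL n)]
  refine tendsto_integral_of_dominated_convergence (fun ω => |X 0 ω j * X 0 ω k|) (fun n => ?_)
    ((hX j).integrable_mul (hX k)).abs (fun n => ae_of_all _ fun ω => ?_)
    (ae_of_all _ fun ω => ?_)
  · exact ((((θ n).measurable_clipped _).comp ((h n).measurable_obs 0)).mul
      (((θ n).measurable_clipped _).comp ((h n).measurable_obs 0))).aestronglyMeasurable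
  · rw [Real.norm_eq_abs, abs_mul, abs_mul]
    exact mul_le_mul ((θ n).abs_clipped_le_abs_target (hR n) (hL n) (.inl j) _)
      ((θ n).abs_clipped_le_abs_target (hR n) (hL n) (.inl k) _) (abs_nonneg _) (abs_nonneg _)
  · refine tendsto_const_nhds.congr' ?_
    filter_upwards [hRt.eventually_ge_atTop (|X 0 ω j|), hRt.eventually_ge_atTop (|X 0 ω k|)]
      with n h1 h2
    have e : ∀ m : Fin d, |X 0 ω m| ≤ (θ n).R →
        (θ n).clipped (.inl m) (obs X ε (U n) 0 ω) = X 0 ω m := fun m hm => clip_symm_eq_self hm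
    rw [e j h1, e k h2]

lemma tendsto_scheme_Gamma_sub (h : ∀ n, IsModel P X ε (U n)) (hβ : ∀ n, (θ n).β = β)
    (hR : ∀ n, 0 ≤ (θ n).R) (hL : ∀ n, 0 ≤ (θ n).L)
    (hX : ∀ j, MemLp (fun ω => X 0 ω j) 2 P) (hr : 0 < r)
    (hRr : Tendsto (fun n : ℕ => (θ n).R ^ 2 / Real.log n) atTop (𝓝 r))
    (hLl : Tendsto (fun n : ℕ => (θ n).L ^ 2 / Real.log n) atTop (𝓝 l)) (j k : Fin d) :
    Tendsto (fun n : ℕ => (((θ n).scheme X ε (U n)).Gamma P β j k -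
      ∫ ω, (θ n).score (obs X ε (U n) 0 ω) j * (θ n).score (obs X ε (U n) 0 ω) k ∂P) /
      Real.log n ^ 2) atTop (𝓝 0) := by
  have h1 : Tendsto (fun n : ℕ => if j = k then 0 else ∫ ω, X 0 ω j * X 0 ω k ∂P -
        ∫ ω, (θ n).gram (obs X ε (U n) 0 ω) j k ∂P) atTop (𝓝 0) := by
    split_ifs
    · exact tendsto_const_nhds
    · have := (tendsto_integral_gram h hR hL hX
        (tendsto_atTop_of_tendsto_sq_div_log hR hr hRr) j k).const_sub
        (∫ ω, X 0 ω j * X 0 ω k ∂P)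
      rwa [sub_self] at this
  have h2 := (hLl.mul h1).div_atTop tendsto_log_natCast
  refine h2.congr fun n => ?_
  rw [← hβ n, (θ n).scheme_Gamma (h n), add_sub_cancel_left, sq (Real.log _), ← div_div]
  ring

lemma tendsto_scheme_Gamma_div (h : ∀ n, IsModel P X ε (U n)) (hβ : ∀ n, (θ n).β = β)
    (hσ : ∀ n, (θ n).σ = σ) (hR : ∀ n, 0 ≤ (θ n).R) (hL : ∀ n, 0 ≤ (θ n).L)
    (hX : ∀ j, MemLp (fun ω => X 0 ω j) 2 P) (hr : 0 < r)
    (hRr : Tendsto (fun n : ℕ => (θ n).R ^ 2 / Real.log n) atTop (𝓝 r))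
    (hLl : Tendsto (fun n : ℕ => (θ n).L ^ 2 / Real.log n) atTop (𝓝 l)) (j k : Fin d) :
    Tendsto (fun n : ℕ => ((θ n).scheme X ε (U n)).Gamma P β j k / Real.log n ^ 2) atTop
      (𝓝 (limitCovariance β r l j k)) := by
  have := (tendsto_scheme_Gamma_sub h hβ hR hL hX hr hRr hLl j k).add
    (tendsto_integral_score_mul_score_div h hβ hσ hR hL hX hRr hLl j k)
  rw [zero_add] at this
  refine this.congr fun n => ?_
  rw [← add_div, sub_add_cancel]

lemma eventually_log_pos : ∀ᶠ n : ℕ in atTop, 0 < Real.log n := by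
  filter_upwards [eventually_gt_atTop 1] with n hn
  exact Real.log_pos (by exact_mod_cast hn)

/-- Existence of the limit of the covariance matrices. -/
lemma exists_tendsto_scheme_Gamma {Γ' : ℕ → Matrix (Fin d) (Fin d) ℝ}
    {Γ₀ : Matrix (Fin d) (Fin d) ℝ} {τ : ℕ → ℝ} {a c : ℝ} (ha : 0 < a)
    (hτ : ∀ᶠ n : ℕ in atTop, a * Real.log n ≤ τ n)
    (hΓ : ∀ j k, Tendsto (fun n : ℕ => Γ' n j k / Real.log n ^ 2) atTop (𝓝 (Γ₀ j k)))
    (hc : Tendsto (fun n : ℕ => τ n / Real.log n) atTop (𝓝 c)) :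
    ∃ Γ, Tendsto (fun n => (τ n ^ 2)⁻¹ • Γ' n) atTop (𝓝 Γ) := by
  have hc0 : c ≠ 0 := by
    refine (lt_of_lt_of_le ha (ge_of_tendsto hc ?_)).ne'
    filter_upwards [hτ, eventually_log_pos] with n hn hlog
    rwa [le_div_iff₀ hlog]
  refine ⟨(c ^ 2)⁻¹ • Γ₀, tendsto_pi_nhds.2 fun j => tendsto_pi_nhds.2 fun k => ?_⟩
  refine (((hc.pow 2).inv₀ (pow_ne_zero 2 hc0)).mul (hΓ j k)).congr' ?_
  filter_upwards [eventually_log_pos] with n hlog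
  rw [Matrix.smul_apply, smul_eq_mul]
  field_simp

lemma posDef_of_tendsto_scheme_Gamma {Γ' : ℕ → Matrix (Fin d) (Fin d) ℝ}
    {Γ₀ Γ : Matrix (Fin d) (Fin d) ℝ} {τ : ℕ → ℝ} {a b : ℝ} (ha : 0 < a)
    (hτ : ∀ᶠ n : ℕ in atTop, a * Real.log n ≤ τ n ∧ τ n ≤ b * Real.log n) (hΓ₀ : Γ₀.PosDef)
    (hΓ' : ∀ j k, Tendsto (fun n : ℕ => Γ' n j k / Real.log n ^ 2) atTop (𝓝 (Γ₀ j k)))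
    (hΓ : Tendsto (fun n => (τ n ^ 2)⁻¹ • Γ' n) atTop (𝓝 Γ)) (hd : 0 < d) : Γ.PosDef := by
  have hΓe : ∀ j k, Tendsto (fun n => (τ n ^ 2)⁻¹ * Γ' n j k) atTop (𝓝 (Γ j k)) := fun j k =>
    ((continuous_id.matrix_elem j k).tendsto Γ).comp hΓ
  set j₀ : Fin d := ⟨0, hd⟩
  have hpos : 0 < Γ₀ j₀ j₀ := hΓ₀.diag_pos
  have hratio : Tendsto (fun n : ℕ => (Real.log n / τ n) ^ 2) atTop
      (𝓝 (Γ j₀ j₀ / Γ₀ j₀ j₀)) := by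
    refine ((hΓe j₀ j₀).div (hΓ' j₀ j₀) hpos.ne').congr' ?_
    filter_upwards [eventually_log_pos, (hΓ' j₀ j₀).eventually_ne hpos.ne'] with n hlog hne
    simp only [Pi.div_apply]
    have : Γ' n j₀ j₀ ≠ 0 := by
      intro h0
      simp [h0] at hne
    field_simp
  have hκ : 0 < Γ j₀ j₀ / Γ₀ j₀ j₀ := by
    obtain ⟨n, ⟨h1, h2⟩, hlog⟩ := (hτ.and eventually_log_pos).exists
    have hb : 0 < b := by
      have : 0 < b * Real.log n := lt_of_lt_of_le (mul_pos ha hlog) (h1.trans h2)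
      exact pos_of_mul_pos_left this hlog.le
    refine lt_of_lt_of_le (by positivity : 0 < (b⁻¹) ^ 2) (ge_of_tendsto hratio ?_)
    filter_upwards [hτ, eventually_log_pos] with n hn hlog
    have hτn : 0 < τ n := lt_of_lt_of_le (mul_pos ha hlog) hn.1
    refine pow_le_pow_left₀ (by positivity) ?_ 2
    rw [le_div_iff₀ hτn, inv_mul_le_iff₀ hb]
    exact hn.2
  have he : Γ = (Γ j₀ j₀ / Γ₀ j₀ j₀) • Γ₀ := by
    ext j k
    refine tendsto_nhds_unique (hΓe j k) ((hratio.mul (hΓ' j k)).congr' ?_)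
    filter_upwards [hτ, eventually_log_pos] with n hn hlog
    have hτn : 0 < τ n := lt_of_lt_of_le (mul_pos ha hlog) hn.1
    field_simp
  rw [he]
  exact hΓ₀.smul hκ

lemma tendsto_mean_score {c : ℕ → ℝ} {a B D : ℝ} (h : ∀ n, IsModel P X ε (U n))
    (hβ : ∀ n, (θ n).β = β) (hσ : ∀ n, (θ n).σ = σ) (hR : ∀ n, 0 ≤ (θ n).R)
    (hL : ∀ n, 0 ≤ (θ n).L) (hX : ∀ j, MemLp (fun ω => X 0 ω j) 2 P)
    (hp : ∀ n : ℕ, 0 < n → P.real {ω | ¬((∀ j, |X 0 ω j| ≤ (θ n).R) ∧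
      |response β σ X ε 0 ω| ≤ (θ n).L)} ≤ D * ((n : ℝ) ^ 2)⁻¹)
    (hc : ∀ᶠ n in atTop, |c n| ≤ a) (hsb : ∀ᶠ n in atTop, |c n| * (θ n).scoreBound ≤ B)
    (j : Fin d) :
    Tendsto (fun n : ℕ => √(n : ℝ) * (c n * ∫ ω, (θ n).score (obs X ε (U n) 0 ω) j ∂P)) atTop
      (𝓝 0) := by
  have hD : 0 ≤ D := by
    have := measureReal_nonneg.trans (hp 1 one_pos)
    simpa using this
  set s := ∫ ω, X 0 ω j ^ 2 ∂P with hs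
  have hs0 : 0 ≤ s := integral_nonneg fun ω => sq_nonneg _
  have hlim : Tendsto (fun n : ℕ => (√(n : ℝ))⁻¹ * (B * D + a * (|σ| / 2 * (s + D)))) atTop
      (𝓝 (0 * (B * D + a * (|σ| / 2 * (s + D))))) :=
    (tendsto_inv_atTop_zero.comp (Real.tendsto_sqrt_atTop.comp tendsto_natCast_atTop_atTop)).mul_const _
  rw [zero_mul] at hlim
  refine squeeze_zero_norm' ?_ hlim
  filter_upwards [hc, hsb, eventually_gt_atTop 0] with n h1 h2 hn
  have hn' : (1 : ℝ) ≤ n := by exact_mod_cast hn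
  have hn0 : (0 : ℝ) < n := by linarith
  have hb := (h n).abs_integral_score_le (hR n) (hL n) hX j (a := (n : ℝ)⁻¹)
    (p := D * ((n : ℝ) ^ 2)⁻¹) (by positivity) (by rw [hβ n, hσ n]; exact hp n hn)
  rw [hσ n, ← hs] at hb
  have hB : 0 ≤ B := by
    refine le_trans (mul_nonneg (abs_nonneg _) ?_) h2
    unfold Params.scoreBound
    positivity
  have hinv : ((n : ℝ) ^ 2)⁻¹ ≤ (n : ℝ)⁻¹ := inv_anti₀ hn0 (by nlinarith)
  have key : |c n| * |∫ ω, (θ n).score (obs X ε (U n) 0 ω) j ∂P| ≤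
      (n : ℝ)⁻¹ * (B * D + a * (|σ| / 2 * (s + D))) := by
    calc |c n| * |∫ ω, (θ n).score (obs X ε (U n) 0 ω) j ∂P|
        ≤ |c n| * ((θ n).scoreBound * (D * ((n : ℝ) ^ 2)⁻¹) +
          |σ| / 2 * ((n : ℝ)⁻¹ * s + ((n : ℝ)⁻¹)⁻¹ * (D * ((n : ℝ) ^ 2)⁻¹))) :=
          mul_le_mul_of_nonneg_left hb (abs_nonneg _)
      _ = (|c n| * (θ n).scoreBound) * (D * ((n : ℝ) ^ 2)⁻¹) +
          |c n| * (|σ| / 2 * ((n : ℝ)⁻¹ * (s + D))) := by field_simp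
      _ ≤ B * (D * (n : ℝ)⁻¹) + a * (|σ| / 2 * ((n : ℝ)⁻¹ * (s + D))) := by gcongr
      _ = _ := by ring
  rw [Real.norm_eq_abs, abs_mul, abs_mul, abs_of_nonneg (Real.sqrt_nonneg _)]
  refine (mul_le_mul_of_nonneg_left key (Real.sqrt_nonneg _)).trans (le_of_eq ?_)
  rw [← mul_assoc]
  congr 1
  have h3 : √(n : ℝ) ≠ 0 := (Real.sqrt_pos.2 hn0).ne'
  rw [eq_comm, inv_eq_iff_eq_inv, mul_inv, inv_inv, inv_mul_eq_div, eq_div_iff h3]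
  exact Real.mul_self_sqrt hn0.le

/-- Asymptotic normality for quantizer ranges of logarithmic growth. -/
theorem tendstoInDistribution_growing {bhat : ℕ → Ω → Vec d} {τ : ℕ → ℝ} {a D : ℝ}
    {Sig Γ : Matrix (Fin d) (Fin d) ℝ}
    (hXr : IsRandomDesign P X ε) (h : ∀ n, IsModel P X ε (U n))
    (hβ : ∀ n, (θ n).β = β) (hσ : ∀ n, (θ n).σ = σ) (hR : ∀ n, 0 ≤ (θ n).R)
    (hL : ∀ n, 0 ≤ (θ n).L) (hX : ∀ j, MemLp (fun ω => X 0 ω j) 2 P) (hr : 0 < r)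
    (hRr : Tendsto (fun n : ℕ => (θ n).R ^ 2 / Real.log n) atTop (𝓝 r))
    (hLl : Tendsto (fun n : ℕ => (θ n).L ^ 2 / Real.log n) atTop (𝓝 l))
    (hp : ∀ n : ℕ, 0 < n → P.real {ω | ¬((∀ j, |X 0 ω j| ≤ (θ n).R) ∧
      |response β σ X ε 0 ω| ≤ (θ n).L)} ≤ D * ((n : ℝ) ^ 2)⁻¹)
    (hSig : Sig = Matrix.of fun j k => ∫ ω, X 0 ω j * X 0 ω k ∂P) (hpos : Sig.PosDef)
    (hest : ∀ n, ((θ n).scheme X ε (U n)).IsEstimator P n (bhat n)) (ha : 0 < a)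
    (hτ : ∀ᶠ n : ℕ in atTop, a * Real.log n ≤ τ n)
    (hΓ : Tendsto (fun n => (τ n ^ 2)⁻¹ • ((θ n).scheme X ε (U n)).Gamma P β) atTop (𝓝 Γ)) :
    TendstoInDistribution (fun (n : ℕ) ω => ((τ n)⁻¹ * √(n : ℝ)) • (bhat n ω - β)) atTop id
      (fun _ => P) (multivariateGaussian 0 (Sig⁻¹ * Γ * Sig⁻¹)) := by
  have hτpos : ∀ᶠ n : ℕ in atTop, 0 < τ n := by
    filter_upwards [hτ, eventually_log_pos] with n hn hlog
    exact lt_of_lt_of_le (mul_pos ha hlog) hn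
  have hτinv : ∀ᶠ n : ℕ in atTop, |(τ n)⁻¹| ≤ a⁻¹ * (Real.log n)⁻¹ := by
    filter_upwards [hτ, eventually_log_pos] with n hn hlog
    have h1 := mul_pos ha hlog
    rw [abs_of_pos (inv_pos.2 (lt_of_lt_of_le h1 hn)), ← mul_inv]
    exact inv_anti₀ h1 hn
  obtain ⟨B, hB⟩ : ∃ B, ∀ᶠ n : ℕ in atTop, |(τ n)⁻¹| * (θ n).scoreBound ≤ B := by
    set S := ∑ l, |β l| with hS
    have h1 : Tendsto (fun n : ℕ => a⁻¹ * (((θ n).L ^ 2 / Real.log n + (θ n).R ^ 2 / Real.log n) / 2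
        + (θ n).R ^ 2 / Real.log n * S)) atTop (𝓝 (a⁻¹ * ((l + r) / 2 + r * S))) :=
      (((hLl.add hRr).div_const 2).add (hRr.mul_const S)).const_mul _
    refine ⟨a⁻¹ * ((l + r) / 2 + r * S) + 1, ?_⟩
    filter_upwards [h1.eventually_le_const (lt_add_one _), hτinv, eventually_log_pos]
      with n hn hn2 hlog
    refine le_trans ?_ hn
    have h2 : (θ n).scoreBound ≤ ((θ n).L ^ 2 + (θ n).R ^ 2) / 2 + (θ n).R ^ 2 * S := by
      unfold Params.scoreBound
      rw [hβ n, ← hS]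
      have := two_mul_le_add_sq |(θ n).L| |(θ n).R|
      rw [sq_abs, sq_abs] at this
      linarith
    have h3 : 0 ≤ (θ n).scoreBound := by
      unfold Params.scoreBound
      positivity
    calc |(τ n)⁻¹| * (θ n).scoreBound ≤ a⁻¹ * (Real.log n)⁻¹ *
          (((θ n).L ^ 2 + (θ n).R ^ 2) / 2 + (θ n).R ^ 2 * S) :=
          mul_le_mul hn2 h2 h3 (by positivity)
      _ = _ := by ring
  refine tendstoInDistribution_iid (c := fun n => (τ n)⁻¹) (B := B) h hXr.ident hβ hest ?_
    (tendsto_pow_four_div hRr) (fun j k => ?_) hpos hB (fun j => ?_) (fun j k => ?_)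
  · filter_upwards [hτpos] with n hn
    exact inv_ne_zero hn.ne'
  · rw [hSig]
    exact tendsto_integral_gram h hR hL hX (tendsto_atTop_of_tendsto_sq_div_log hR hr hRr) j k
  · refine tendsto_mean_score (a := a⁻¹) (B := B) h hβ hσ hR hL hX hp ?_ hB j
    filter_upwards [hτinv, tendsto_log_natCast.eventually_ge_atTop 1] with n hn hlog
    refine hn.trans (mul_le_of_le_one_right (inv_nonneg.2 ha.le) (inv_le_one_of_one_le₀ hlog))
  · have h1 : Tendsto (fun n => (τ n ^ 2)⁻¹ * ((θ n).scheme X ε (U n)).Gamma P β j k) atTop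
        (𝓝 (Γ j k)) := ((continuous_id.matrix_elem j k).tendsto Γ).comp hΓ
    have h2 := tendsto_scheme_Gamma_sub h hβ hR hL hX hr hRr hLl j k
    have h3 : Tendsto (fun n : ℕ => (τ n ^ 2)⁻¹ * (((θ n).scheme X ε (U n)).Gamma P β j k -
      ∫ ω, (θ n).score (obs X ε (U n) 0 ω) j * (θ n).score (obs X ε (U n) 0 ω) k ∂P)) atTop
      (𝓝 0) := by
      have h4 := h2.norm.const_mul (a⁻¹ ^ 2)
      rw [norm_zero, mul_zero] at h4
      refine squeeze_zero_norm' ?_ h4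
      filter_upwards [hτinv, eventually_log_pos] with n hn hlog
      rw [norm_mul, norm_div, Real.norm_eq_abs, ← inv_pow, abs_pow, div_eq_inv_mul, ← mul_assoc]
      refine mul_le_mul_of_nonneg_right ?_ (norm_nonneg _)
      refine (pow_le_pow_left₀ (abs_nonneg _) hn 2).trans (le_of_eq ?_)
      rw [Real.norm_eq_abs, abs_of_nonneg (sq_nonneg (Real.log (n : ℝ))), mul_pow, inv_pow (Real.log _)]
    have h5 := h1.sub h3
    rw [sub_zero] at h5
    refine h5.congr fun n => ?_
    rw [inv_pow]
    ring

end GrowingRanges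

end QuantReg

theorem theorem1 {Ω : Type*} [MeasurableSpace Ω] (P : Measure Ω) [IsProbabilityMeasure P]
    (d : ℕ) (β : QuantReg.Vec d) (σ : ℝ) (hσ : 0 < σ)
    (ε : ℕ → Ω → ℝ) (hε : QuantReg.IsNoise P ε) :
    -- (I) random design, fixed quantizer ranges
    (∀ (X : ℕ → Ω → QuantReg.Vec d) (U : ℕ → QuantReg.Bit d → Ω → ℝ) (R L : ℝ)
        (S : QuantReg.Scheme d Ω) (bhat : ℕ → Ω → QuantReg.Vec d),
      S = { X := X, Y := QuantReg.response β σ X ε, U := U, R := R, L := L } →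
      QuantReg.IsRandomDesign P X ε →
      QuantReg.IsDither P X ε U →
      (∀ᵐ ω ∂P, ∀ j, |X 0 ω j| ≤ R) →
      (∀ᵐ ω ∂P, |QuantReg.response β σ X ε 0 ω| ≤ L) →
      (S.Sigma P).PosDef →
      (∀ n, S.IsEstimator P n (bhat n)) →
      TendstoInDistribution (fun (n : ℕ) ω => √(n : ℝ) • (bhat n ω - β)) atTop id (fun _ => P)
          (multivariateGaussian 0 ((S.Sigma P)⁻¹ * S.Gamma P β * (S.Sigma P)⁻¹)) ∧
        ∀ j k, |(S.GammaA P β - S.GammaB P β) j k| ≤ 3 * R ^ 4 * (∑ l, |β l|) ^ 2) ∧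
    -- (II) sub-Gaussian random design, growing quantizer ranges
    (∀ (X : ℕ → Ω → QuantReg.Vec d) (U : ℕ → ℕ → QuantReg.Bit d → Ω → ℝ) (C : ℝ)
        (Sig : Matrix (Fin d) (Fin d) ℝ)
        (S : ℕ → QuantReg.Scheme d Ω) (bhat : ℕ → Ω → QuantReg.Vec d) (τ : ℕ → ℝ),
      (∀ n, S n = { X := X, Y := QuantReg.response β σ X ε, U := U n,
                    R := QuantReg.rangeX P C 2 X n,
                    L := QuantReg.rangeY P C 2 β σ Sig X ε n }) →
      Sig = Matrix.of (fun j k => ∫ ω, X 0 ω j * X 0 ω k ∂P) →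
      1 / 2 ≤ C →
      QuantReg.IsRandomDesign P X ε →
      QuantReg.IsSubGaussianDesign P X →
      QuantReg.psiTwo P (ε 0) < ∞ →
      (∀ n, QuantReg.IsDither P X ε (U n)) →
      Sig.PosDef →
      (∀ n, (S n).IsEstimator P n (bhat n)) →
      (∃ a b : ℝ, 0 < a ∧ ∀ᶠ n : ℕ in atTop, a * Real.log n ≤ τ n ∧ τ n ≤ b * Real.log n) →
      ((∃ c : ℝ, Tendsto (fun n : ℕ => τ n / Real.log n) atTop (𝓝 c)) →
        ∃ Γ, Tendsto (fun n => (τ n ^ 2)⁻¹ • (S n).Gamma P β) atTop (𝓝 Γ)) ∧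
      ∀ Γ, Tendsto (fun n => (τ n ^ 2)⁻¹ • (S n).Gamma P β) atTop (𝓝 Γ) →
        Γ.PosDef ∧
        TendstoInDistribution (fun (n : ℕ) ω => ((τ n)⁻¹ * √(n : ℝ)) • (bhat n ω - β)) atTop id
          (fun _ => P) (multivariateGaussian 0 (Sig⁻¹ * Γ * Sig⁻¹))) ∧
    -- (III) fixed design
    (∀ (x : ℕ → QuantReg.Vec d) (U : ℕ → QuantReg.Bit d → Ω → ℝ) (R L : ℝ)
        (Sbar : Matrix (Fin d) (Fin d) ℝ)
        (S : QuantReg.Scheme d Ω) (bhat : ℕ → Ω → QuantReg.Vec d),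
      S = { X := fun i _ => x i, Y := QuantReg.response β σ (fun i _ => x i) ε, U := U,
            R := R, L := L } →
      QuantReg.IsDither P (fun i _ => x i) ε U →
      (∀ i j, |x i j| ≤ R) →
      (∀ i, ∀ᵐ ω ∂P, |QuantReg.response β σ (fun i _ => x i) ε i ω| ≤ L) →
      Tendsto (fun n : ℕ => (n : ℝ)⁻¹ • ∑ i ∈ Finset.range n,
        Matrix.vecMulVec (x i).ofLp (x i).ofLp) atTop (𝓝 Sbar) →
      Sbar.PosDef →
      (∀ n, S.IsEstimator P n (bhat n)) →
      (∀ᶠ n in atTop, (S.V P β n).PosDef) ∧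
      (∀ j k, (fun n => S.V P β n j k) =O[atTop] fun n : ℕ => (n : ℝ)⁻¹) ∧
      TendstoInDistribution
        (fun (n : ℕ) ω => QuantReg.matVec (QuantReg.invSqrt (S.V P β n) * Sbar) (bhat n ω - β))
        atTop id (fun _ => P) (multivariateGaussian 0 1)) := by
  refine ⟨?_, ?_, ?_⟩
  · intro X U R L S bhat hS hX hU hXR hYL hSig hest
    have h := hX.isModel hε hU
    obtain rfl : S = (⟨β, σ, R, L⟩ : QuantReg.Params d).scheme X ε U := hS
    refine ⟨QuantReg.tendstoInDistribution_of_bounded (θ := ⟨β, σ, R, L⟩) hX h hXR hYL hSig hest,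
      fun j k => ?_⟩
    exact h.abs_GammaA_sub_GammaB_le (θ := ⟨β, σ, R, L⟩)
      (QuantReg.nonneg_of_ae_abs_le (P := P) (hXR.mono fun ω hω => hω j))
      (QuantReg.nonneg_of_ae_abs_le hYL) hXR hYL j k
  · intro X U C Sig S bhat τ hS hSig hC hX hsub hεsub hU hpos hest ⟨a, b, ha, hτ⟩
    rcases Nat.eq_zero_or_pos d with rfl | hd
    · refine ⟨fun _ => ⟨0, ?_⟩, fun Γ _ => ⟨?_, ?_⟩⟩
      · rw [show (fun n => (τ n ^ 2)⁻¹ • (S n).Gamma P β) = fun _ => 0 from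
          funext fun n => Subsingleton.elim _ _]
        exact tendsto_const_nhds
      · rw [Subsingleton.elim Γ 1]
        exact Matrix.PosDef.one
      · exact QuantReg.tendstoInDistribution_of_subsingleton
          (fun n => AEMeasurable.const_smul ((hest n).1.sub_const β)
            ((τ n)⁻¹ * √(n : ℝ))) aemeasurable_id
    have h : ∀ n, QuantReg.IsModel P X ε (U n) := fun n => hX.isModel hε (hU n)
    obtain rfl : S = fun n => (⟨β, σ, QuantReg.rangeX P C 2 X n,
      QuantReg.rangeY P C 2 β σ Sig X ε n⟩ : QuantReg.Params d).scheme X ε (U n) := funext hS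
    have hm := hX.meas 0
    have hXL := hsub.memLp hm
    have hR : ∀ n, 0 ≤ QuantReg.rangeX P C 2 X n := fun n => Real.sqrt_nonneg _
    have hL : ∀ n, 0 ≤ QuantReg.rangeY P C 2 β σ Sig X ε n := fun n => by
      unfold QuantReg.rangeY
      positivity
    obtain ⟨r, hr, hRr⟩ := QuantReg.exists_tendsto_rangeX_sq_div_log hsub hC hd
    obtain ⟨l, hl, hLl⟩ := QuantReg.exists_tendsto_rangeY_sq_div_log (β := β) (Sig := Sig) (X := X)
      hε hεsub hσ hC
    have hlim := QuantReg.tendsto_scheme_Gamma_div (θ := fun n => ⟨β, σ,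
      QuantReg.rangeX P C 2 X n, QuantReg.rangeY P C 2 β σ Sig X ε n⟩) h (fun _ => rfl)
      (fun _ => rfl) hR hL hXL hr hRr hLl
    have hτa := hτ.mono fun n hn => hn.1
    refine ⟨fun ⟨c, hc⟩ => QuantReg.exists_tendsto_scheme_Gamma ha hτa hlim hc, fun Γ hΓ =>
      ⟨QuantReg.posDef_of_tendsto_scheme_Gamma ha hτ (QuantReg.limitCovariance_posDef β hr hl)
        hlim hΓ hd, ?_⟩⟩
    exact QuantReg.tendstoInDistribution_growing (θ := fun n => ⟨β, σ,
      QuantReg.rangeX P C 2 X n, QuantReg.rangeY P C 2 β σ Sig X ε n⟩) hX h (fun _ => rfl)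
      (fun _ => rfl) hR hL hXL hr hRr hLl
      (fun n hn => QuantReg.measure_notMem_range_le hsub hm hε hεsub hσ hC hSig hpos hn)
      hSig hpos hest ha hτa hΓ
  · intro x U R L Sbar S bhat hS hU hXR hYL hlim hpos hest
    obtain rfl : S = (⟨β, σ, R, L⟩ : QuantReg.Params d).scheme (fun i _ => x i) ε U := hS
    exact QuantReg.tendstoInDistribution_fixed (θ := ⟨β, σ, R, L⟩)
      (QuantReg.IsDither.isModel_fixed hε hU) hσ.ne' hXR hYL hlim hpos hest
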